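/- \textbf{Setting.} Concept names, role names and individual names come from countably infinite sets. $\mathcal{ALC}$-concepts are built from $\top$, $\bot$ and concept names by $\sqcap,\sqcup,\neg,\exists r.C,\forall r.C$ with $r$ a role name; an $\mathcal{ALC}$-TBox is a finite set of inclusions $C\sqsubseteq D$ between $\mathcal{ALC}$-concepts. An ABox is a non-empty finite set of assertions $A(a)$, $r(a,b)$, and $\mathsf{Ind}(\mathcal A)$ is the set of individual names in $\mathcal A$. An interpretation has a non-empty domain and interprets concept names as subsets of it and role names as binary relations on it; it is a model of $\mathcal A$ if $\mathsf{Ind}(\mathcal A)$ is contained in the domain (individual names are interpreted as themselves) and all assertions hold. A PEQ $q(\vec x)$ is a first-order formula built from atoms $A(x)$, $r(x,y)$ by $\wedge,\vee,\exists$. We write $\mathcal T,\mathcal A\models q(\vec a)$ if $\mathcal I\models q(\vec a)$ for all common models $\mathcal I$ of $\mathcal T$ and $\mathcal A$; the query evaluation problem for $(\mathcal T,q)$ is to decide this, given $\mathcal A$ and a tuple $\vec a$ from $\mathsf{Ind}(\mathcal A)$. $\mathcal T$ is materializable if every ABox $\mathcal A$ that has a common model with $\mathcal T$ has a common model $\mathcal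 I$ with $\mathcal T$ such that, for all PEQs $q$ and all $\vec a$ from $\mathsf{Ind}(\mathcal A)$, $\mathcal I\models q(\vec a)$ iff $\mathcal T,\mathcal A\models q(\vec a)$. A signature $\Sigma$ is a finite set of concept and role names; a $\Sigma$-ABox uses only concept and role names from $\Sigma$. $\mathcal A\to\mathcal B$ means that there is a map $h:\mathsf{Ind}(\mathcal A)\to\mathsf{Ind}(\mathcal B)$ such that $A(a)\in\mathcal A$ implies $A(h(a))\in\mathcal B$ and $r(a,b)\in\mathcal A$ implies $r(h(a),h(b))\in\mathcal B$. A template over $\Sigma$ is a $\Sigma$-ABox $\mathcal B$, and $\mathsf{CSP}(\mathcal B)$ is the problem to decide, given a $\Sigma$-ABox $\mathcal A$, whether $\mathcal A\to\mathcal B$. \textbf{Theorem.} There is a polynomial time algorithm that, given a signature $\Sigma$ and a template $\mathcal B$ over $\Sigma$, computes a materializable $\mathcal{ALC}$-TBox $\mathcal T_{\mathcal B}$ and a concept name $M$ such that the following hold. 1. For every $\Sigma$-ABox $\mathcal A$: $\mathcal A\to\mathcal B$ if and only if $\mathcal T_{\mathcal B},\mathcal A\not\models\exists x\,M(x)$.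 2. For every PEQ $q$: if some $\Sigma$-ABox does not map homomorphically to $\mathcal B$, then the query evaluation problem for $(\mathcal T_{\mathcal B},q)$ is polynomial time many-one reducible to the complement of $\mathsf{CSP}(\mathcal B)$; and if every $\Sigma$-ABox maps homomorphically to $\mathcal B$, then the query evaluation problem for $(\mathcal T_{\mathcal B},q)$ is decidable in polynomial time. -/

import Mathlib

namespace DL

/-! ### Syntax -/

/-- Names are words over `{0,1}`, a countably infinite set. Concept names, role names and
individual names are kept apart by the syntactic position in which they occur. -/
abbrev Name : Type := List Bool

/-- `ALC`-concepts. -/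
inductive Concept : Type
  | top : Concept
  | bot : Concept
  | atom (A : Name) : Concept
  | inter (C D : Concept) : Concept
  | union (C D : Concept) : Concept
  | neg (C : Concept) : Concept
  | ex (r : Name) (C : Concept) : Concept
  | all (r : Name) (C : Concept) : Concept

/-- A concept inclusion `lhs ⊑ rhs` between `ALC`-concepts. -/
structure ConceptInclusion : Type where
  lhs : Concept
  rhs : Concept

/-- An `ALC`-TBox: a finite set of concept inclusions, presented by a list of its elements. -/
abbrev TBox : Type := List ConceptInclusion

/-- Assertions `A(a)` and `r(a,b)`. -/
inductive Assertion : Type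
  | concept (A a : Name) : Assertion
  | role (r a b : Name) : Assertion

/-- The individual names occurring in an assertion. -/
def Assertion.Ind : Assertion → Set Name
  | .concept _ a => {a}
  | .role _ a b => {a, b}

/-- An ABox: a non-empty finite set of assertions, presented by a list of its elements. -/
structure ABox : Type where
  assertions : List Assertion
  nonempty : assertions ≠ []

instance : Membership Assertion ABox := ⟨fun 𝒜 α => α ∈ 𝒜.assertions⟩

/-- The individual names used in an ABox. -/
def ABox.Ind (𝒜 : ABox) : Set Name := {a | ∃ α ∈ 𝒜, a ∈ α.Ind}

/-- A signature: a finite set of concept names and a finite set of role names. -/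
structure Signature : Type where
  concepts : List Name
  roles : List Name

/-- The concept or role name of the assertion belongs to the signature. -/
def Assertion.Over (S : Signature) : Assertion → Prop
  | .concept A _ => A ∈ S.concepts
  | .role r _ _ => r ∈ S.roles

/-- `𝒜` is an ABox over the signature `S`. -/
def ABox.Over (𝒜 : ABox) (S : Signature) : Prop := ∀ α ∈ 𝒜, α.Over S

/-- Positive existential queries with `n` answer variables, built from atoms `A(x)` and `r(x,y)`
by conjunction, disjunction and existential quantification. The answer variables are the
variables `0, …, n-1`; the quantifier `ex` binds the last variable of its body. -/
inductive PEQ : ℕ → Type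
  | concept {n : ℕ} (A : Name) (x : Fin n) : PEQ n
  | role {n : ℕ} (r : Name) (x y : Fin n) : PEQ n
  | and {n : ℕ} (p q : PEQ n) : PEQ n
  | or {n : ℕ} (p q : PEQ n) : PEQ n
  | ex {n : ℕ} (q : PEQ (n + 1)) : PEQ n

/-- The Boolean query `∃ x, M(x)`. -/
def PEQ.someInstance (M : Name) : PEQ 0 := .ex (.concept M 0)

/-! ### Semantics -/

/-- Interpretations. Under the standard name assumption an individual name may or may not be an
element of the domain; `name a = some d` says that `a` is an element of the domain, namely `d`. -/
structure Interpretation : Type 1 where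
  Dom : Type
  nonempty : Nonempty Dom
  concept : Name → Set Dom
  role : Name → Dom → Dom → Prop
  name : Name → Option Dom
  name_inj : ∀ a b d, name a = some d → name b = some d → a = b

namespace Interpretation

/-- The extension of a concept. -/
def ext (I : Interpretation) : Concept → Set I.Dom
  | .top => Set.univ
  | .bot => ∅
  | .atom A => I.concept A
  | .inter C D => I.ext C ∩ I.ext D
  | .union C D => I.ext C ∪ I.ext D
  | .neg C => (I.ext C)ᶜ
  | .ex r C => {d | ∃ e, I.role r d e ∧ e ∈ I.ext C}
  | .all r C => {d | ∀ e, I.role r d e → e ∈ I.ext C}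

/-- `I` is a model of the TBox. -/
def ModelsTBox (I : Interpretation) (𝒯 : TBox) : Prop :=
  ∀ c ∈ 𝒯, I.ext c.lhs ⊆ I.ext c.rhs

/-- Satisfaction of an assertion; this includes that its individual names are in the domain. -/
def SatAssertion (I : Interpretation) : Assertion → Prop
  | .concept A a => ∃ d, I.name a = some d ∧ d ∈ I.concept A
  | .role r a b => ∃ d e, I.name a = some d ∧ I.name b = some e ∧ I.role r d e

/-- `I` is a model of the ABox. -/
def ModelsABox (I : Interpretation) (𝒜 : ABox) : Prop := ∀ α ∈ 𝒜, I.SatAssertion α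

/-- First-order satisfaction of a positive existential query under an assignment. -/
def Holds (I : Interpretation) : {n : ℕ} → PEQ n → (Fin n → I.Dom) → Prop
  | _, .concept A x, π => π x ∈ I.concept A
  | _, .role r x y, π => I.role r (π x) (π y)
  | _, .and p q, π => I.Holds p π ∧ I.Holds q π
  | _, .or p q, π => I.Holds p π ∨ I.Holds q π
  | _, .ex q, π => ∃ d : I.Dom, I.Holds q (Fin.snoc π d)

/-- The tuple `a` of individual names is an answer to `q` in `I`. -/
def Answers (I : Interpretation) {n : ℕ} (q : PEQ n) (a : Fin n → Name) : Prop :=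
  ∃ π : Fin n → I.Dom, (∀ i, I.name (a i) = some (π i)) ∧ I.Holds q π

end Interpretation

/-- `𝒯, 𝒜 ⊨ q(a)`: the tuple `a` is a certain answer to `q` in `𝒜` with respect to `𝒯`. -/
def CertainAnswer (𝒯 : TBox) (𝒜 : ABox) {n : ℕ} (q : PEQ n) (a : Fin n → Name) : Prop :=
  ∀ I : Interpretation, I.ModelsTBox 𝒯 → I.ModelsABox 𝒜 → I.Answers q a

/-- `𝒜` is consistent with respect to `𝒯`. -/
def Consistent (𝒯 : TBox) (𝒜 : ABox) : Prop :=
  ∃ I : Interpretation, I.ModelsTBox 𝒯 ∧ I.ModelsABox 𝒜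

/-- `I` is a PEQ-materialization of `𝒯` and `𝒜`. -/
def IsMaterialization (I : Interpretation) (𝒯 : TBox) (𝒜 : ABox) : Prop :=
  I.ModelsTBox 𝒯 ∧ I.ModelsABox 𝒜 ∧
    ∀ (n : ℕ) (q : PEQ n) (a : Fin n → Name), (∀ i, a i ∈ 𝒜.Ind) →
      (I.Answers q a ↔ CertainAnswer 𝒯 𝒜 q a)

/-- `𝒯` is materializable. -/
def Materializable (𝒯 : TBox) : Prop :=
  ∀ 𝒜 : ABox, Consistent 𝒯 𝒜 → ∃ I : Interpretation, IsMaterialization I 𝒯 𝒜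

/-- `𝒜 → ℬ`: there is a homomorphism from `𝒜` to `ℬ`. As every individual name of an ABox occurs
in one of its assertions, the map `h` automatically sends `𝒜.Ind` to `ℬ.Ind`; its values outside
`𝒜.Ind` are irrelevant. -/
def ABox.HomTo (𝒜 ℬ : ABox) : Prop :=
  ∃ h : Name → Name,
    (∀ A a, Assertion.concept A a ∈ 𝒜 → Assertion.concept A (h a) ∈ ℬ) ∧
    (∀ r a b, Assertion.role r a b ∈ 𝒜 → Assertion.role r (h a) (h b) ∈ ℬ)

/-- A CSP template: a signature together with an ABox over it. -/
structure Template : Type where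
  sig : Signature
  abox : ABox
  abox_over : abox.Over sig

/-! ### Encodings as words over a finite alphabet -/

/-- The alphabet. -/
inductive Sym : Type
  | bit (b : Bool) | delim
  | top | bot | atom | inter | union | neg | ex | all | incl
  | conceptAssertion | roleAssertion | conceptName | roleName | answer

def encodeName (s : Name) : List Sym := s.map Sym.bit ++ [Sym.delim]

def Concept.encode : Concept → List Sym
  | .top => [Sym.top]
  | .bot => [Sym.bot]
  | .atom A => Sym.atom :: encodeName A
  | .inter C D => Sym.inter :: (C.encode ++ D.encode)
  | .union C D => Sym.union :: (C.encode ++ D.encode)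
  | .neg C => Sym.neg :: C.encode
  | .ex r C => Sym.ex :: (encodeName r ++ C.encode)
  | .all r C => Sym.all :: (encodeName r ++ C.encode)

def encodeTBox (𝒯 : TBox) : List Sym :=
  𝒯.flatMap fun c => Sym.incl :: (c.lhs.encode ++ c.rhs.encode)

/-- Encoding of a TBox together with a distinguished concept name. -/
def encodeTBoxWithName (p : TBox × Name) : List Sym := encodeName p.2 ++ encodeTBox p.1

def Assertion.encode : Assertion → List Sym
  | .concept A a => Sym.conceptAssertion :: (encodeName A ++ encodeName a)
  | .role r a b => Sym.roleAssertion :: (encodeName r ++ encodeName a ++ encodeName b)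

def ABox.encode (𝒜 : ABox) : List Sym := 𝒜.assertions.flatMap Assertion.encode

def Signature.encode (S : Signature) : List Sym :=
  (S.concepts.flatMap fun A => Sym.conceptName :: encodeName A) ++
    (S.roles.flatMap fun r => Sym.roleName :: encodeName r)

def Template.encode (ℬ : Template) : List Sym := ℬ.sig.encode ++ ℬ.abox.encode

/-! ### Polynomial time -/

/-- The function `f` is computable in polynomial time by a Turing machine, with respect to the
encodings `ea` and `eb` of its arguments and values. -/
def PolyTimeComputable {α β Γ₀ Γ₁ : Type} (ea : α → List Γ₀) (eb : β → List Γ₁) (f : α → β) :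
    Prop :=
  Nonempty (Turing.TM2ComputableInPolyTime ea eb f)

/-- A decision problem: encoded instances and the set of yes-instances. -/
structure Problem : Type 1 where
  Inst : Type
  encode : Inst → List Sym
  Yes : Inst → Prop

/-- The complement of a decision problem: the same instances, with the answers exchanged. -/
def Problem.compl (P : Problem) : Problem where
  Inst := P.Inst
  encode := P.encode
  Yes x := ¬ P.Yes x

/-- Polynomial time many-one reducibility. -/
def Problem.PolyTimeReducible (P Q : Problem) : Prop :=
  ∃ f : P.Inst → Q.Inst, PolyTimeComputable P.encode Q.encode f ∧ ∀ x, P.Yes x ↔ Q.Yes (f x)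

/-- The problem is decidable in polynomial time. -/
def Problem.InPTime (P : Problem) : Prop :=
  ∃ f : P.Inst → Bool, PolyTimeComputable P.encode Computability.encodeBool f ∧
    ∀ x, P.Yes x ↔ f x = true

/-- `CSP(ℬ)`: given an ABox `𝒜` over the signature of `ℬ`, decide whether `𝒜 → ℬ`. -/
def CSP (ℬ : Template) : Problem where
  Inst := {𝒜 : ABox // 𝒜.Over ℬ.sig}
  encode 𝒜 := 𝒜.1.encode
  Yes 𝒜 := 𝒜.1.HomTo ℬ.abox

/-- An ABox together with a tuple of `n` of its individual names. -/
structure QueryInstance (n : ℕ) : Type where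
  abox : ABox
  tuple : Fin n → Name
  mem : ∀ i, tuple i ∈ abox.Ind

def QueryInstance.encode {n : ℕ} (x : QueryInstance n) : List Sym :=
  ((List.ofFn x.tuple).flatMap fun a => Sym.answer :: encodeName a) ++ x.abox.encode

/-- The query evaluation problem for `(𝒯, q)`: given `𝒜` and a tuple `a` of individual names of
`𝒜`, decide whether `𝒯, 𝒜 ⊨ q(a)`. -/
def queryEvaluation (𝒯 : TBox) {n : ℕ} (q : PEQ n) : Problem where
  Inst := QueryInstance n
  encode := QueryInstance.encode
  Yes x := CertainAnswer 𝒯 x.abox q x.tuple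

end DL

namespace DL

/-! ### Structured programs over stacks -/

/-! The TBox hides the choice of a homomorphism behind a universal quantifier. Take fresh role names
R, S and a fresh colour C_d for each individual d of the template, and let H_d = ∃R.∀S.C_d
(`hidden`). The TBox puts every element that occurs in a Σ-assertion into some H_d and forbids
combinations of H_d with Σ-atoms that the template does not contain. A model of an ABox therefore
yields a homomorphism from its Σ-part to the template (`exists_sigHom`).

Positive queries do not see the choice, because the TBox also gives every R-successor an S-successor
carrying all colours. The forced and visible part, `universal`, is the ABox with an R-S-path to such
a fully coloured point attached to each active individual. It maps into every model
(`answers_of_universal`). Conversely, given a homomorphism h, add below the R-successor of a an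
S-successor with the single colour of h(a): this falsifies H_d for d ≠ h(a), so a model results
(`modelsTBox_modelFacts`). The new point folds onto the fully coloured one, so no positive query is
gained (`universal_of_modelFacts`). ABoxes may themselves use R; the R-successors that they provide
get one fully coloured and one uncoloured S-successor, so that they make no H_d true.

Hence a tuple is a certain answer iff it is an answer in the universal model or the Σ-part has no
homomorphism (`certainAnswer_iff`). This gives materializability, and item 1 with a fresh name for
M. For item 2, evaluate q in the universal model in polynomial time. On success output a fixed ABox
that does not map to the template, otherwise output the Σ-part.

Polynomial time is established for actual machines. Structured stack programs are compiled to
`Turing.TM2` with exact step counts, and `Poly` is a class of word functions closed under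
composition, branching, prefix tests and concatenation over all suffixes of a word
(`Poly.forSuffix`). Each required algorithm is a fixed nesting of these operations. -/

abbrev Word : Type := List Sym

abbrev Store : Type := ℕ → Word

/-- A numbering from which decidable equality and finiteness are read off. The codes below `2` are
exactly the bits, which later separates names from tagged names. -/
def Sym.code : Sym → ℕ
  | .bit b => cond b 0 1
  | .delim => 2
  | .top => 3
  | .bot => 4
  | .atom => 5
  | .inter => 6
  | .union => 7
  | .neg => 8
  | .ex => 9
  | .all => 10
  | .incl => 11
  | .conceptAssertion => 12
  | .roleAssertion => 13
  | .conceptName => 14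
  | .roleName => 15
  | .answer => 16

theorem Sym.code_injective : Function.Injective Sym.code := by
  intro a b h
  rcases a with (_ | _) | _ <;> rcases b with (_ | _) | _ <;> simp_all [Sym.code]

instance : DecidableEq Sym := fun a b =>
  decidable_of_iff (a.code = b.code) Sym.code_injective.eq_iff

instance : Finite Sym := by
  refine Finite.of_injective (fun a : Sym => (⟨a.code, ?_⟩ : Fin 17)) ?_
  · cases a <;> simp [Sym.code]
    rename_i b; cases b <;> simp
  · intro a b h
    exact Sym.code_injective (by simpa using h)

noncomputable instance : Fintype Sym := Fintype.ofFinite _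

/-- Structured programs operating on stacks that are indexed by natural numbers. -/
inductive Prog : Type
  | nop : Prog
  | push (k : ℕ) (c : Sym) : Prog
  | pop (k : ℕ) : Prog
  | seq (p q : Prog) : Prog
  | case (k : ℕ) (f : Option Sym → Prog) : Prog
  | loop (k : ℕ) (P : Sym → Bool) (p : Prog) : Prog

/-- `Runs p s s' t`: started in `s`, the program `p` ends in `s'` after `t` steps. -/
inductive Runs : Prog → Store → Store → ℕ → Prop
  | nop (s) : Runs .nop s s 1
  | push (k c s) : Runs (.push k c) s (Function.update s k (c :: s k)) 1
  | pop (k s) : Runs (.pop k) s (Function.update s k (s k).tail) 1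
  | seq {p q s s' s'' t t'} : Runs p s s' t → Runs q s' s'' t' → Runs (.seq p q) s s'' (t + t')
  | case {k f s s' t} : Runs (f (s k).head?) s s' t → Runs (.case k f) s s' (1 + t)
  | loop_done {k P p s} : (s k).head?.any P = false → Runs (.loop k P p) s s 1
  | loop_step {k P p s s' s'' t t'} : (s k).head?.any P = true → Runs p s s' t →
      Runs (.loop k P p) s' s'' t' → Runs (.loop k P p) s s'' (1 + t + t')

namespace Prog

/-- The control locations of a program. -/
def Lab : Prog → Type
  | .nop => Unit
  | .push _ _ => Unit
  | .pop _ => Unit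
  | .seq p q => p.Lab ⊕ q.Lab
  | .case _ f => Option (Σ o, (f o).Lab)
  | .loop _ _ p => Option p.Lab

theorem finite_lab (p : Prog) : Finite p.Lab := by
  induction p with
  | nop => exact inferInstanceAs (Finite Unit)
  | push => exact inferInstanceAs (Finite Unit)
  | pop => exact inferInstanceAs (Finite Unit)
  | seq p q hp hq => exact inferInstanceAs (Finite (p.Lab ⊕ q.Lab))
  | case k f h => exact inferInstanceAs (Finite (Option (Σ o, (f o).Lab)))
  | loop k P p h => exact inferInstanceAs (Finite (Option p.Lab))

def entry : (p : Prog) → p.Lab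
  | .nop => ()
  | .push _ _ => ()
  | .pop _ => ()
  | .seq p _ => Sum.inl p.entry
  | .case _ _ => none
  | .loop _ _ _ => none

/-- All stacks used by the program have an index at most `B`. -/
def Bdd (B : ℕ) : Prog → Prop
  | .nop => True
  | .push k _ => k ≤ B
  | .pop k => k ≤ B
  | .seq p q => p.Bdd B ∧ q.Bdd B
  | .case k f => k ≤ B ∧ ∀ o, (f o).Bdd B
  | .loop k _ p => k ≤ B ∧ p.Bdd B

theorem Bdd.mono {B C : ℕ} (h : B ≤ C) {p : Prog} (hp : p.Bdd B) : p.Bdd C := by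
  induction p with
  | nop => trivial
  | push => exact le_trans hp h
  | pop => exact le_trans hp h
  | seq p q ihp ihq => exact ⟨ihp hp.1, ihq hp.2⟩
  | case k f ih => exact ⟨hp.1.trans h, fun o => ih o (hp.2 o)⟩
  | loop k P p ih => exact ⟨hp.1.trans h, ih hp.2⟩

/-- The branches of a `case` are indexed by the finite type `Option Sym`, so their bounds have a
common upper bound. A machine with finitely many stacks therefore suffices. -/
theorem exists_bdd (p : Prog) : ∃ B, p.Bdd B := by
  induction p with
  | nop => exact ⟨0, trivial⟩
  | push k => exact ⟨k, le_refl k⟩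
  | pop k => exact ⟨k, le_refl k⟩
  | seq p q ihp ihq =>
    obtain ⟨B, hB⟩ := ihp
    obtain ⟨C, hC⟩ := ihq
    exact ⟨max B C, hB.mono (le_max_left _ _), hC.mono (le_max_right _ _)⟩
  | case k f ih =>
    choose B hB using ih
    obtain ⟨C, hC⟩ := (Set.finite_range B).bddAbove
    exact ⟨max k C, le_max_left _ _,
      fun o => (hB o).mono ((hC ⟨o, rfl⟩).trans (le_max_right _ _))⟩
  | loop k P p ih =>
    obtain ⟨B, hB⟩ := ih
    exact ⟨max k B, le_max_left _ _, hB.mono (le_max_right _ _)⟩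

/-- Stack alphabets: one output stack over `Γ₁`, and `B + 1` stacks over `Sym`. -/
abbrev Alph (Γ₁ : Type) (B : ℕ) : Option (Fin (B + 1)) → Type
  | none => Γ₁
  | some _ => Sym

/-- The output stack is kept apart because its alphabet may differ from `Sym`; programs never touch
it. -/
def stk {Γ₁ : Type} {B : ℕ} (s : Store) (o : List Γ₁) : ∀ k, List (Alph Γ₁ B k)
  | none => o
  | some i => s i

open Turing.TM2 in
/-- Translation of a program into statements of a stack machine. -/
def code {Γ₁ : Type} {B : ℕ} {Λ : Type} :
    (p : Prog) → (p.Lab → Λ) → Λ → p.Lab → Stmt (Alph Γ₁ B) Λ (Option Sym)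
  | .nop, _, ex, _ => .goto fun _ => ex
  | .push k c, _, ex, _ =>
    .push (some (Fin.ofNat (B + 1) k)) (fun _ => c) (.goto fun _ => ex)
  | .pop k, _, ex, _ =>
    .pop (some (Fin.ofNat (B + 1) k)) (fun v _ => v) (.goto fun _ => ex)
  | .seq p q, emb, _, .inl l => code p (fun l => emb (.inl l)) (emb (.inr q.entry)) l
  | .seq _ q, emb, ex, .inr l => code q (fun l => emb (.inr l)) ex l
  | .case k f, emb, _, none =>
    .peek (some (Fin.ofNat (B + 1) k)) (fun _ o => o) (.goto fun o => emb (some ⟨o, (f o).entry⟩))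
  | .case _ f, emb, ex, some ⟨o, l⟩ => code (f o) (fun l => emb (some ⟨o, l⟩)) ex l
  | .loop k P p, emb, ex, none =>
    .peek (some (Fin.ofNat (B + 1) k)) (fun _ o => o)
      (.goto fun o => bif o.any P then emb (some p.entry) else ex)
  | .loop _ _ p, emb, _, some l => code p (fun l => emb (some l)) (emb none) l

/-! ### Correctness of the translation into stack machines -/

theorem update_stk {Γ₁ : Type} {B k : ℕ} (hk : k ≤ B) (s : Store) (o : List Γ₁) (w : Word) :
    Function.update (stk (B := B) s o) (some (Fin.ofNat (B + 1) k)) w =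
      stk (Function.update s k w) o := by
  funext i
  rcases i with _ | i
  · rw [Function.update_of_ne (by simp)]; rfl
  · have hki : (Fin.ofNat (B + 1) k).val = k := Nat.mod_eq_of_lt (by omega)
    by_cases h : i = Fin.ofNat (B + 1) k
    · subst h
      rw [Function.update_self]
      change w = Function.update s k w (Fin.ofNat (B + 1) k).val
      rw [hki, Function.update_self]
    · rw [Function.update_of_ne (by simpa using h)]
      change s i = Function.update s k w i
      rw [Function.update_of_ne]
      intro h'
      exact h (Fin.ext (by rw [h', hki]))

/-- `Fin.ofNat` reduces modulo `B + 1`; the bound on `k` makes this reduction harmless. -/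
theorem stk_ofNat {Γ₁ : Type} {B k : ℕ} (hk : k ≤ B) (s : Store) (o : List Γ₁) :
    stk (B := B) s o (some (Fin.ofNat (B + 1) k)) = s k := by
  have hki : (Fin.ofNat (B + 1) k).val = k := Nat.mod_eq_of_lt (by omega)
  change s (Fin.ofNat (B + 1) k).val = s k
  rw [hki]

theorem iterate_bind_add {σ : Type*} {f : σ → Option σ} {a b : σ} {c : Option σ} {m n : ℕ}
    (h₁ : (flip bind f)^[m] (some a) = some b) (h₂ : (flip bind f)^[n] (some b) = c) :
    (flip bind f)^[m + n] (some a) = c := by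
  rw [add_comm, Function.iterate_add_apply, h₁, h₂]

theorem iterate_step {Γ₁ : Type} {B : ℕ} {Λ : Type}
    (m : Λ → Turing.TM2.Stmt (Alph Γ₁ B) Λ (Option Sym)) {l : Λ}
    {q : Turing.TM2.Stmt (Alph Γ₁ B) Λ (Option Sym)} (h : m l = q) (v : Option Sym)
    (S : ∀ k, List (Alph Γ₁ B k)) {c : Turing.TM2.Cfg (Alph Γ₁ B) Λ (Option Sym)}
    (hc : Turing.TM2.stepAux q v S = c) :
    (flip bind (Turing.TM2.step m))^[1] (some ⟨some l, v, S⟩) = some c := by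
  subst hc h
  rfl

-- The machine simulates the program in lockstep, so the step counts agree exactly. The embedding of
-- the labels is arbitrary so that the induction applies to subprograms inside a larger machine. The
-- internal state is arbitrary at the start and unspecified at the end, since every test peeks
-- afresh.
open Turing.TM2 in
theorem code_correct {Γ₁ : Type} {B : ℕ} {Λ : Type}
    (m : Λ → Stmt (Alph Γ₁ B) Λ (Option Sym)) {p : Prog} {s s' : Store} {t : ℕ}
    (h : Runs p s s' t) : p.Bdd B → ∀ (emb : p.Lab → Λ) (ex : Λ),
      (∀ l, m (emb l) = code p emb ex l) → ∀ v o, ∃ v',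
        (flip bind (step m))^[t] (some ⟨some (emb p.entry), v, stk s o⟩) =
          some ⟨some ex, v', stk s' o⟩ := by
  induction h with
  | nop s =>
    intro _ emb ex hm v o
    exact ⟨v, iterate_step m (hm _) v _ rfl⟩
  | push k c s =>
    intro hB emb ex hm v o
    refine ⟨v, iterate_step m (q := .push (some (Fin.ofNat (B + 1) k)) (fun _ => c) (.goto fun _ => ex)) (hm _) v _ ?_⟩
    rw [stepAux, stepAux, stk_ofNat hB, update_stk hB]
  | pop k s =>
    intro hB emb ex hm v o
    refine ⟨v, iterate_step m (q := .pop (some (Fin.ofNat (B + 1) k)) (fun v _ => v) (.goto fun _ => ex)) (hm _) v _ ?_⟩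
    rw [stepAux, stepAux, stk_ofNat hB, update_stk hB]
  | @seq p q s s' s'' t t' _ _ ih₁ ih₂ =>
    intro hB emb ex hm v o
    obtain ⟨v₁, h₁⟩ := ih₁ hB.1 (fun l => emb (.inl l)) (emb (.inr q.entry))
      (fun l => hm (.inl l)) v o
    obtain ⟨v₂, h₂⟩ := ih₂ hB.2 (fun l => emb (.inr l)) ex (fun l => hm (.inr l)) v₁ o
    exact ⟨v₂, iterate_bind_add h₁ h₂⟩
  | @case k f s s' t _ ih =>
    intro hB emb ex hm v o
    obtain ⟨v₁, h₁⟩ := ih (hB.2 _) (fun l => emb (some ⟨_, l⟩)) ex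
      (fun l => hm (some ⟨_, l⟩)) (s k).head? o
    refine ⟨v₁, iterate_bind_add (iterate_step m (q := .peek (some (Fin.ofNat (B + 1) k)) (fun _ o => o)
      (.goto fun o => emb (some ⟨o, (f o).entry⟩))) (hm none) v _ ?_) h₁⟩
    rw [stepAux, stepAux, stk_ofNat hB.1]
  | @loop_done k P p s hd =>
    intro hB emb ex hm v o
    refine ⟨(s k).head?, iterate_step m (q := .peek (some (Fin.ofNat (B + 1) k)) (fun _ o => o)
      (.goto fun o => bif o.any P then emb (some p.entry) else ex)) (hm none) v _ ?_⟩
    rw [stepAux, stepAux, stk_ofNat hB.1, hd]; rfl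
  | @loop_step k P p s s' s'' t t' hd _ _ ih₁ ih₂ =>
    intro hB emb ex hm v o
    obtain ⟨v₁, h₁⟩ := ih₁ hB.2 (fun l => emb (some l)) (emb none)
      (fun l => hm (some l)) (s k).head? o
    obtain ⟨v₂, h₂⟩ := ih₂ hB emb ex hm v₁ o
    refine ⟨v₂, iterate_bind_add (iterate_bind_add (iterate_step m (q := .peek (some (Fin.ofNat (B + 1) k)) (fun _ o => o)
      (.goto fun o => bif o.any P then emb (some p.entry) else ex)) (hm none) v _ ?_) h₁) h₂⟩
    rw [stepAux, stepAux, stk_ofNat hB.1, hd]; rfl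

/-! ### Complete machines with an output phase -/

variable {Γ₁ : Type}

/-- Control of the machine that runs `p` and then moves stack `1` to the output stack. -/
def machineCode (g : Sym → Γ₁) (p : Prog) (B : ℕ) :
    Option p.Lab → Turing.TM2.Stmt (Alph Γ₁ B) (Option p.Lab) (Option Sym)
  | some l => code p some none l
  | none => .pop (some (Fin.ofNat (B + 1) 1)) (fun _ o => o)
      (.branch Option.isSome (.push none (fun v => g (v.getD .delim)) (.goto fun _ => none))
        (.load (fun _ => none) .halt))

noncomputable def machine (g : Sym → Γ₁) (p : Prog) (B : ℕ) : Turing.FinTM2 where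
  K := Option (Fin (B + 1))
  k₀ := some 0
  k₁ := none
  Γ := Alph Γ₁ B
  Λ := Option p.Lab
  main := some p.entry
  ΛFin := @Fintype.ofFinite _ (@instFiniteOption _ p.finite_lab)
  σ := Option Sym
  initialState := none
  Γk₀Fin := inferInstanceAs (Fintype Sym)
  m := machineCode g p B

theorem update_stk_none {B : ℕ} (s : Store) (o o' : List Γ₁) :
    Function.update (stk (B := B) s o) none o' = stk s o' := by
  funext i
  rcases i with _ | i
  · rw [Function.update_self]; rfl
  · rw [Function.update_of_ne (by simp)]; rfl

-- One step per symbol and one more to notice that stack `1` is empty. Popping reverses the word,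
-- which is why programs are asked to leave their result reversed.
open Turing.TM2 in
theorem machine_output (g : Sym → Γ₁) (p : Prog) {B : ℕ} (hB : 1 ≤ B) (w : Word) :
    ∀ (s : Store) (v : Option Sym) (o : List Γ₁), s 1 = w →
      (flip bind (step (machineCode g p B)))^[w.length + 1] (some ⟨some none, v, stk s o⟩) =
          some ⟨none, none, stk (Function.update s 1 []) (w.reverse.map g ++ o)⟩ := by
  induction w with
  | nil =>
    intro s v o hs
    refine iterate_step (machineCode g p B) (machineCode.eq_2 g p B) v _ ?_
    rw [stepAux, stepAux, stk_ofNat hB, update_stk hB, hs]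
    rfl
  | cons c w ih =>
    intro s v o hs
    have hstep : (flip bind (step (machineCode g p B)))^[1] (some ⟨some none, v, stk s o⟩) =
        some ⟨some none, some c, stk (Function.update s 1 w) (g c :: o)⟩ := by
      refine iterate_step (machineCode g p B) (machineCode.eq_2 g p B) v _ ?_
      rw [stepAux, stepAux, stk_ofNat hB, update_stk hB, hs, List.head?_cons, Option.isSome_some,
        cond_true, stepAux, stepAux, update_stk_none]
      rfl
    have h := iterate_bind_add hstep (ih (Function.update s 1 w) (some c) (g c :: o) (by simp))
    rw [List.length_cons, Nat.add_comm (w.length + 1) 1, h]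
    simp

/-- All stacks except stack `1` must end up empty, because a halting configuration contains nothing
but the output. The program accounts for `P` steps and the output phase for at most `P + 1`, whence
the time `2 * P + 1`. -/
theorem polyTimeComputable {α β : Type} {ea : α → Word} {eb : β → List Γ₁} {f : α → β}
    (g : Sym → Γ₁) (p : Prog) (F : Word → Word) (hF : ∀ x, (F (ea x)).map g = eb (f x))
    (P : Polynomial ℕ)
    (hp : ∀ w, ∃ t ≤ P.eval w.length, Runs p (fun k => if k = 0 then w else [])
      (fun k => if k = 1 then (F w).reverse else []) t ∧ (F w).length ≤ P.eval w.length) :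
    PolyTimeComputable ea eb f := by
  obtain ⟨B', hB'⟩ := p.exists_bdd
  obtain ⟨B, hB, hB1⟩ : ∃ B, p.Bdd B ∧ 1 ≤ B :=
    ⟨max B' 1, hB'.mono (le_max_left _ _), le_max_right _ _⟩
  have key : ∀ x, ∃ n ≤ (2 * P + 1).eval (ea x).length,
      (flip bind (Turing.TM2.step (machineCode g p B)))^[n]
        (some ⟨some (some p.entry), none, stk (fun k => if k = 0 then ea x else []) []⟩) =
      some ⟨none, none, stk (fun _ => []) (eb (f x))⟩ := by
    intro x
    obtain ⟨t, ht, hr, hl⟩ := hp (ea x)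
    obtain ⟨v, hv⟩ := code_correct (machineCode g p B) hr hB some none (fun l => rfl) none []
    have ho := machine_output g p hB1 (F (ea x)).reverse
      (fun k => if k = 1 then (F (ea x)).reverse else []) v [] (if_pos rfl)
    refine ⟨t + ((F (ea x)).reverse.length + 1), ?_, ?_⟩
    · simp only [Polynomial.eval_add, Polynomial.eval_mul, Polynomial.eval_ofNat,
        Polynomial.eval_one, List.length_reverse]
      omega
    · rw [iterate_bind_add hv ho, List.reverse_reverse, hF, List.append_nil]
      congr
      funext k
      by_cases hk : k = 1
      · simp [hk]
      · simp [hk]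
  refine ⟨{
    tm := machine g p B
    inputAlphabet := Equiv.refl _
    outputAlphabet := Equiv.refl _
    time := 2 * P + 1
    outputsFun := fun x => Classical.choice ?_ }⟩
  obtain ⟨n, hn, h⟩ := key x
  refine ⟨⟨⟨n, ?_⟩, hn⟩⟩
  have h₁ : Turing.initList (machine g p B) (List.map (Equiv.refl Sym).invFun (ea x)) =
      ⟨some (some p.entry), none, stk (fun k => if k = 0 then ea x else []) []⟩ := by
    refine congrArg (Turing.TM2.Cfg.mk (Γ := Alph Γ₁ B) _ _) (funext fun k => ?_)
    rcases k with _ | k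
    · rfl
    · by_cases hk : k = 0
      · subst hk
        simp [machine, stk]
        rfl
      · have : k.val ≠ 0 := fun h => hk (Fin.ext h)
        simp [machine, stk, hk, this]
  have h₂ : Turing.haltList (machine g p B) (List.map (Equiv.refl Γ₁).invFun (eb (f x))) =
      ⟨none, none, stk (fun _ => []) (eb (f x))⟩ := by
    refine congrArg (Turing.TM2.Cfg.mk (Γ := Alph Γ₁ B) _ _) (funext fun k => ?_)
    rcases k with _ | k
    · simp [machine, stk]
      rfl
    · simp [machine, stk]
  exact ((congrArg _ (congrArg some h₁)).trans h).trans (congrArg some h₂).symm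

end Prog

end DL


namespace DL

/-! ### A calculus of polynomial time functions on words -/

/-- `p` leads from `s` to `s'` in at most `T` steps. -/
def Does (p : Prog) (s s' : Store) (T : ℕ) : Prop := ∃ t ≤ T, Runs p s s' t

namespace Does

theorem mono {p : Prog} {s s' : Store} {T T' : ℕ} (h : Does p s s' T) (hT : T ≤ T') :
    Does p s s' T' := by
  obtain ⟨t, ht, hr⟩ := h
  exact ⟨t, ht.trans hT, hr⟩

theorem conv {p : Prog} {s s' s'' : Store} {T T' : ℕ} (h : Does p s s' T) (hs : s'' = s')
    (hT : T ≤ T') : Does p s s'' T' := hs ▸ h.mono hT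

theorem nop (s : Store) : Does .nop s s 1 := ⟨1, le_rfl, .nop s⟩

theorem push (k : ℕ) (c : Sym) (s : Store) :
    Does (.push k c) s (Function.update s k (c :: s k)) 1 := ⟨1, le_rfl, .push k c s⟩

theorem pop (k : ℕ) (s : Store) :
    Does (.pop k) s (Function.update s k (s k).tail) 1 := ⟨1, le_rfl, .pop k s⟩

theorem seq {p q : Prog} {s s' s'' : Store} {T T' : ℕ} (h : Does p s s' T)
    (h' : Does q s' s'' T') : Does (.seq p q) s s'' (T + T') := by
  obtain ⟨t, ht, hr⟩ := h
  obtain ⟨t', ht', hr'⟩ := h'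
  exact ⟨t + t', by omega, .seq hr hr'⟩

theorem case {k : ℕ} {f : Option Sym → Prog} {s s' : Store} {T : ℕ} (o : Option Sym)
    (ho : (s k).head? = o) (h : Does (f o) s s' T) : Does (.case k f) s s' (1 + T) := by
  subst ho
  obtain ⟨t, ht, hr⟩ := h
  exact ⟨1 + t, by omega, .case hr⟩

theorem loop_done {k : ℕ} {P : Sym → Bool} {p : Prog} {s : Store}
    (h : (s k).head?.any P = false) : Does (.loop k P p) s s 1 := ⟨1, le_rfl, .loop_done h⟩

theorem loop_step {k : ℕ} {P : Sym → Bool} {p : Prog} {s s' s'' : Store} {T T' : ℕ}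
    (h : (s k).head?.any P = true) (h₁ : Does p s s' T) (h₂ : Does (.loop k P p) s' s'' T') :
    Does (.loop k P p) s s'' (1 + T + T') := by
  obtain ⟨t, ht, hr⟩ := h₁
  obtain ⟨t', ht', hr'⟩ := h₂
  exact ⟨1 + t + t', by omega, .loop_step h hr hr'⟩

end Does

/-! ### Moving, duplicating and clearing stacks -/

namespace Prog

/-- Move the longest prefix of stack `i` satisfying `P` to stack `j`, in reverse order. -/
def mvWhile (P : Sym → Bool) (i j : ℕ) : Prog :=
  .loop i P (.case i fun o => o.elim .nop fun c => .seq (.pop i) (.push j c))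

def mv (i j : ℕ) : Prog := mvWhile (fun _ => true) i j

/-- Move stack `i` to both of the stacks `j` and `k`, in reverse order. -/
def dup (i j k : ℕ) : Prog :=
  .loop i (fun _ => true)
    (.case i fun o => o.elim .nop fun c => .seq (.pop i) (.seq (.push j c) (.push k c)))

/-- Remove the longest prefix of stack `i` satisfying `P`. -/
def drop (P : Sym → Bool) (i : ℕ) : Prog := .loop i P (.pop i)

def clear (i : ℕ) : Prog := drop (fun _ => true) i

/-- Each moved symbol costs four steps (loop test, case distinction, pop, push), and the final
failing test costs one. -/
theorem mvWhile_does (P : Sym → Bool) {i j : ℕ} (hij : i ≠ j) (w : Word) :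
    ∀ s : Store, s i = w → Does (mvWhile P i j) s
      (Function.update (Function.update s i (w.dropWhile P)) j ((w.takeWhile P).reverse ++ s j))
      (4 * w.length + 1) := by
  induction w with
  | nil =>
    intro s hs
    refine (Does.loop_done (by simp [hs])).conv ?_ (by simp)
    funext k
    by_cases hk : k = j
    · subst hk; simp
    · by_cases hk' : k = i
      · subst hk'; simp [hk, hs]
      · simp [hk, hk']
  | cons c w ih =>
    intro s hs
    by_cases hc : P c = true
    · have h := ih (Function.update (Function.update s i w) j (c :: s j)) (by simp [hij])
      have h₁ : Does (.case i fun o => o.elim .nop fun c => .seq (.pop i) (.push j c)) s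
          (Function.update (Function.update s i w) j (c :: s j)) (1 + (1 + 1)) := by
        refine Does.case (some c) (by simp [hs]) ?_
        refine (Does.pop i s).seq ?_
        convert Does.push j c _ using 2
        · simp [hs]
        · simp [hij.symm]
      refine (Does.loop_step (by simp [hs, hc]) h₁ h).conv ?_ (by simp; omega)
      funext k
      by_cases hk : k = j
      · subst hk; simp [hc]
      · by_cases hk' : k = i
        · subst hk'; simp [hk, hc]
        · simp [hk, hk']
    · have hc' : P c = false := by simpa using hc
      refine (Does.loop_done (by simp [hs, hc'])).conv ?_ (by simp)
      funext k
      by_cases hk : k = j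
      · subst hk; simp [hc']
      · by_cases hk' : k = i
        · subst hk'; simp [hk, hs, hc']
        · simp [hk, hk']

theorem mv_does {i j : ℕ} (hij : i ≠ j) (s : Store) : Does (mv i j) s
      (Function.update (Function.update s i []) j ((s i).reverse ++ s j))
      (4 * (s i).length + 1) := by
  have h := mvWhile_does (fun _ => true) hij (s i) s rfl
  have h₁ : (s i).dropWhile (fun _ => true) = [] := by simp
  have h₂ : (s i).takeWhile (fun _ => true) = s i := by simp
  rwa [h₁, h₂] at h

theorem dup_does {i j k : ℕ} (hij : i ≠ j) (hik : i ≠ k) (hjk : j ≠ k) (w : Word) :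
    ∀ s : Store, s i = w → Does (dup i j k) s
      (Function.update (Function.update (Function.update s i []) j (w.reverse ++ s j))
        k (w.reverse ++ s k)) (5 * w.length + 1) := by
  induction w with
  | nil =>
    intro s hs
    refine (Does.loop_done (by simp [hs])).conv ?_ (by simp)
    funext l
    simp only [List.reverse_nil, List.nil_append, Function.update_apply]
    grind
  | cons c w ih =>
    intro s hs
    have h := ih (Function.update (Function.update (Function.update s i w) j (c :: s j))
      k (c :: s k)) (by simp [hij, hik])
    have h₁ : Does (.case i fun o => o.elim .nop fun c =>
        .seq (.pop i) (.seq (.push j c) (.push k c))) s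
        (Function.update (Function.update (Function.update s i w) j (c :: s j))
          k (c :: s k)) (1 + (1 + (1 + 1))) := by
      refine Does.case (some c) (by simp [hs]) ?_
      refine (Does.pop i s).seq ((Does.push j c _).seq ?_)
      convert Does.push k c _ using 2
      · simp [hs, hij.symm]
      · simp [hik.symm, hjk.symm]
    refine (Does.loop_step (by simp [hs]) h₁ h).conv ?_ (by simp; omega)
    funext l
    simp only [Function.update_apply]
    grind

theorem drop_does (P : Sym → Bool) (i : ℕ) (w : Word) :
    ∀ s : Store, s i = w → Does (drop P i) s (Function.update s i (w.dropWhile P))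
      (2 * w.length + 1) := by
  induction w with
  | nil =>
    intro s hs
    refine (Does.loop_done (by simp [hs])).conv ?_ (by simp)
    simp [← hs]
  | cons c w ih =>
    intro s hs
    by_cases hc : P c = true
    · have h := ih (Function.update s i w) (by simp)
      have h₁ := Does.pop i s
      rw [hs, List.tail_cons] at h₁
      refine (Does.loop_step (by simp [hs, hc]) h₁ h).conv ?_ (by simp; omega)
      simp [hc]
    · have hc' : P c = false := by simpa using hc
      refine (Does.loop_done (by simp [hs, hc'])).conv ?_ (by simp)
      rw [List.dropWhile_cons_of_neg hc, ← hs, Function.update_eq_self]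

theorem clear_does (i : ℕ) (s : Store) :
    Does (clear i) s (Function.update s i []) (2 * (s i).length + 1) := by
  have h := drop_does (fun _ => true) i (s i) s rfl
  have h₁ : (s i).dropWhile (fun _ => true) = [] := by simp
  rwa [h₁] at h

end Prog

/-- The store in which the stacks `0, 1, …` hold the words of the list, the others being empty. -/
def st (env : List Word) : Store := fun i => env.getD i []

/-! ### Stores with three working stacks above an environment -/

section Store

variable (env : List Word) (a b c w : Word)

/-- Empty stacks at the end of the list are invisible, so working stacks can be brought in and
dropped again without any computation. -/
theorem st_append_nil : st (env ++ [[]]) = st env := by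
  funext i
  simp only [st, List.getD_eq_getElem?_getD]
  rcases lt_trichotomy i env.length with h | h | h
  · rw [List.getElem?_append_left h]
  · subst h; simp
  · rw [List.getElem?_eq_none (by simp; omega), List.getElem?_eq_none (by omega)]

theorem st_one : st (env ++ [a]) = st (env ++ [a, [], []]) := by
  have h₁ := st_append_nil (env ++ [a])
  have h₂ := st_append_nil (env ++ [a] ++ [[]])
  rw [← h₁, ← h₂]
  simp

theorem st_two : st (env ++ [a, b]) = st (env ++ [a, b, []]) := by
  rw [← st_append_nil (env ++ [a, b])]
  simp

theorem st_at_zero : st (env ++ [a, b, c]) env.length = a := by simp [st]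

theorem st_at_one : st (env ++ [a, b, c]) (env.length + 1) = b := by
  simp [st, List.getD_eq_getElem?_getD]

theorem st_at_two : st (env ++ [a, b, c]) (env.length + 2) = c := by
  simp [st, List.getD_eq_getElem?_getD]

theorem st_apply (i : ℕ) : st (env ++ [a, b, c]) i =
    if i < env.length then env.getD i [] else if i = env.length then a else
      if i = env.length + 1 then b else if i = env.length + 2 then c else [] := by
  split_ifs with h h h h
  · simp [st, List.getD_eq_getElem?_getD, List.getElem?_append_left h]
  · subst h; exact st_at_zero ..
  · subst h; exact st_at_one ..
  · subst h; exact st_at_two ..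
  · simp only [st, List.getD_eq_getElem?_getD]
    rw [List.getElem?_eq_none (by simp; omega)]
    rfl

theorem update_st_zero :
    Function.update (st (env ++ [a, b, c])) env.length w = st (env ++ [w, b, c]) := by
  funext i
  simp only [Function.update_apply, st_apply]
  grind

theorem update_st_one :
    Function.update (st (env ++ [a, b, c])) (env.length + 1) w = st (env ++ [a, w, c]) := by
  funext i
  simp only [Function.update_apply, st_apply]
  grind

theorem update_st_two :
    Function.update (st (env ++ [a, b, c])) (env.length + 2) w = st (env ++ [a, b, w]) := by
  funext i
  simp only [Function.update_apply, st_apply]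
  grind

theorem mv_one_two : Does (.mv (env.length + 1) (env.length + 2)) (st (env ++ [a, b, c]))
    (st (env ++ [a, [], b.reverse ++ c])) (4 * b.length + 1) := by
  have h := Prog.mv_does (i := env.length + 1) (j := env.length + 2) (by omega)
    (st (env ++ [a, b, c]))
  rwa [st_at_one, st_at_two, update_st_one, update_st_two] at h

theorem mv_two_one : Does (.mv (env.length + 2) (env.length + 1)) (st (env ++ [a, b, c]))
    (st (env ++ [a, c.reverse ++ b, []])) (4 * c.length + 1) := by
  have h := Prog.mv_does (i := env.length + 2) (j := env.length + 1) (by omega)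
    (st (env ++ [a, b, c]))
  rwa [st_at_one, st_at_two, update_st_two, update_st_one] at h

theorem mv_zero_two : Does (.mv env.length (env.length + 2)) (st (env ++ [a, b, c]))
    (st (env ++ [[], b, a.reverse ++ c])) (4 * a.length + 1) := by
  have h := Prog.mv_does (i := env.length) (j := env.length + 2) (by omega)
    (st (env ++ [a, b, c]))
  rwa [st_at_zero, st_at_two, update_st_zero, update_st_two] at h

theorem mv_two_zero : Does (.mv (env.length + 2) env.length) (st (env ++ [a, b, c]))
    (st (env ++ [c.reverse ++ a, b, []])) (4 * c.length + 1) := by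
  have h := Prog.mv_does (i := env.length + 2) (j := env.length) (by omega)
    (st (env ++ [a, b, c]))
  rwa [st_at_zero, st_at_two, update_st_two, update_st_zero] at h

theorem mv_one_zero : Does (.mv (env.length + 1) env.length) (st (env ++ [a, b, c]))
    (st (env ++ [b.reverse ++ a, [], c])) (4 * b.length + 1) := by
  have h := Prog.mv_does (i := env.length + 1) (j := env.length) (by omega)
    (st (env ++ [a, b, c]))
  rwa [st_at_zero, st_at_one, update_st_one, update_st_zero] at h

theorem clear_zero : Does (.clear env.length) (st (env ++ [a, b, c]))
    (st (env ++ [[], b, c])) (2 * a.length + 1) := by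
  have h := Prog.clear_does env.length (st (env ++ [a, b, c]))
  rwa [st_at_zero, update_st_zero] at h

theorem clear_one : Does (.clear (env.length + 1)) (st (env ++ [a, b, c]))
    (st (env ++ [a, [], c])) (2 * b.length + 1) := by
  have h := Prog.clear_does (env.length + 1) (st (env ++ [a, b, c]))
  rwa [st_at_one, update_st_one] at h

theorem clear_two : Does (.clear (env.length + 2)) (st (env ++ [a, b, c]))
    (st (env ++ [a, b, []])) (2 * c.length + 1) := by
  have h := Prog.clear_does (env.length + 2) (st (env ++ [a, b, c]))
  rwa [st_at_two, update_st_two] at h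

end Store

/-- Copy stack `i` to stack `N`, using stack `N + 1`. -/
def Prog.copy (i N : ℕ) : Prog := .seq (.mv i (N + 1)) (.dup (N + 1) i N)

/-- The move reverses the word and the duplication reverses both copies back. The costs are `4` and
`5` steps per symbol. -/
theorem copy_does (env : List Word) {i : ℕ} (hi : i < env.length) :
    Does (.copy i env.length) (st env) (st (env ++ [env.getD i []]))
      (9 * (env.getD i []).length + 2) := by
  have h₁ := Prog.mv_does (i := i) (j := env.length + 1) (by omega) (st env)
  have h₂ := Prog.dup_does (i := env.length + 1) (j := i) (k := env.length) (by omega) (by omega)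
    (by omega) _ (Function.update (Function.update (st env) i []) (env.length + 1)
      ((st env i).reverse ++ st env (env.length + 1))) (Function.update_self ..)
  have hn : st env (env.length + 1) = [] := by simp [st]
  refine (h₁.seq h₂).conv ?_ ?_
  · rw [st_one]
    funext l
    simp only [st_apply, Function.update_apply, hn, List.append_nil, List.reverse_reverse]
    have hN : st env env.length = [] := by simp [st]
    have hl : env.length ≤ l → st env l = [] := fun h => by simp [st, h]
    have hl' : st env l = env.getD l [] := rfl
    have hi' : st env i = env.getD i [] := rfl
    grind
  · rw [hn]; simp [st]; omega

/-- Types of tuples of words. -/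
class Ctx (α : Type) where
  vars : List (α → Word)

instance : Ctx Word := ⟨[id]⟩

/-- Nested pairs serve as contexts: the last component is the most recently bound variable. -/
instance {α : Type} [Ctx α] : Ctx (α × Word) :=
  ⟨(Ctx.vars.map fun X : α → Word => fun v => X v.1) ++ [Prod.snd]⟩

/-! ### Tuples of words and the places where they are stored -/

namespace Ctx

variable {α : Type} [Ctx α]

def size (v : α) : ℕ := ((vars (α := α)).map fun X => (X v).length).sum

theorem size_snoc (v : α) (w : Word) : size (v, w) = size v + w.length := by
  simp [size, vars, Function.comp_def]

theorem length_le_size {X : α → Word} (hX : X ∈ vars) (v : α) : (X v).length ≤ size v :=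
  List.single_le_sum (by simp) _ (List.mem_map.2 ⟨X, hX, rfl⟩)

/-- The components of `v` are stored at the places `ρ` of `env`. -/
def Agrees (env : List Word) (ρ : List ℕ) (v : α) : Prop :=
  List.Forall₂ (fun (X : α → Word) i => i < env.length ∧ env.getD i [] = X v) vars ρ

theorem Agrees.append {env : List Word} {ρ : List ℕ} {v : α} (h : Agrees env ρ v)
    (l : List Word) : Agrees (env ++ l) ρ v := by
  refine List.Forall₂.imp (fun X i hi => ⟨?_, ?_⟩) h
  · have := hi.1
    simp; omega
  · rw [← hi.2]
    simp [List.getD_eq_getElem?_getD, List.getElem?_append_left hi.1]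

theorem Agrees.snoc {env : List Word} {ρ : List ℕ} {v : α} (h : Agrees env ρ v) {i : ℕ}
    (hi : i < env.length) : Agrees env (ρ ++ [i]) (v, env.getD i []) := by
  refine List.rel_append ?_ (List.Forall₂.cons ⟨hi, rfl⟩ .nil)
  rw [List.forall₂_map_left_iff]
  exact h

theorem Agrees.init {env : List Word} {ρ : List ℕ} {v : α} {w : Word}
    (h : Agrees env ρ (v, w)) : Agrees env ρ.dropLast v := by
  have h' := List.forall₂_iff_get.1 h
  refine List.forall₂_iff_get.2 ⟨?_, fun i h₁ h₂ => ?_⟩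
  · have := h'.1
    simp [vars] at this ⊢
    omega
  · have := h'.2 i (by simp [vars]; omega) (by simp at h₂; omega)
    simpa [vars, List.getElem_append_left, h₁] using this

end Ctx

/-- Monotone because the coefficients are natural numbers; this lets bounds for intermediate results
be substituted into time bounds. -/
theorem eval_mono (P : Polynomial ℕ) {m n : ℕ} (h : m ≤ n) : P.eval m ≤ P.eval n := by
  rw [Polynomial.eval_eq_sum_range, Polynomial.eval_eq_sum_range]
  exact Finset.sum_le_sum fun i _ => Nat.mul_le_mul_left _ (Nat.pow_le_pow_left h i)

open Ctx

/-- Functions from tuples of words to words that can be computed in polynomial time by a program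
that leaves its arguments in place and writes the value on the next stack. -/
def Poly {α : Type} [Ctx α] (f : α → Word) : Prop :=
  ∃ P : Polynomial ℕ, (∀ v, (f v).length ≤ P.eval (size v)) ∧
    ∀ N ρ, ∃ p, ∀ env v, env.length = N → Agrees env ρ v →
      Does p (st env) (st (env ++ [f v])) (P.eval (size v))

/-! ### Basic functions and composition -/

namespace Poly

variable {α : Type} [Ctx α]

theorem var {X : α → Word} (hX : X ∈ Ctx.vars) : Poly X := by
  refine ⟨9 * Polynomial.X + 2, fun v => ?_, fun N ρ => ?_⟩
  · have := length_le_size hX v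
    simp; omega
  · obtain ⟨k, hk, rfl⟩ := List.mem_iff_getElem.1 hX
    refine ⟨.copy (ρ.getD k 0) N, ?_⟩
    rintro env v rfl h
    have h' := List.forall₂_iff_get.1 h
    have hk' : k < ρ.length := h'.1 ▸ hk
    have h'' := h'.2 k hk hk'
    have hg : ρ.getD k 0 = ρ[k] := by simp [hk']
    simp only [List.get_eq_getElem] at h''
    rw [hg, ← h''.2]
    refine (copy_does env h''.1).mono ?_
    rw [h''.2]
    have := length_le_size hX v
    simp; omega

theorem arg : Poly (fun v : Word => v) := var (X := fun v : Word => v) (by simp [Ctx.vars]; rfl)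

theorem last : Poly (fun v : α × Word => v.2) := var (by simp [Ctx.vars])

theorem weaken {f : α → Word} (hf : Poly f) : Poly (fun v : α × Word => f v.1) := by
  obtain ⟨P, hl, hp⟩ := hf
  refine ⟨P, fun v => (hl v.1).trans (eval_mono _ ?_), fun N ρ => ?_⟩
  · obtain ⟨v, w⟩ := v
    rw [size_snoc]; exact Nat.le_add_right _ _
  · obtain ⟨p, hp⟩ := hp N ρ.dropLast
    refine ⟨p, fun env v hN h => (hp env v.1 hN (Agrees.init (w := v.2) h)).mono (eval_mono _ ?_)⟩
    obtain ⟨v, w⟩ := v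
    rw [size_snoc]; exact Nat.le_add_right _ _

/-- Write the value of `f` on stack `N` as an additional argument, compute `g` on stack `N + 1`, and
clear stack `N`. Two moves then bring the result to stack `N` in the original order. The length
bound on `f` is what keeps the running time of `g` polynomial in the original size. -/
theorem bind {f : α → Word} {g : α → Word → Word} (hf : Poly f)
    (hg : Poly (fun v : α × Word => g v.1 v.2)) : Poly (fun v => g v (f v)) := by
  obtain ⟨P, hl, hp⟩ := hf
  obtain ⟨Q, hl', hq⟩ := hg
  have hQ : ∀ v : α, Q.eval (size (v, f v)) ≤ Q.eval (size v + P.eval (size v)) := fun v =>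
    eval_mono _ (by rw [size_snoc]; have := hl v; omega)
  refine ⟨3 * P + 9 * Q.comp (Polynomial.X + P) + 3, fun v => ?_, fun N ρ => ?_⟩
  · have h₁ : (g v (f v)).length ≤ _ := hl' (v, f v)
    have h₂ := hQ v
    simp only [Polynomial.eval_add, Polynomial.eval_mul, Polynomial.eval_comp,
      Polynomial.eval_X, Polynomial.eval_ofNat] at *
    omega
  · obtain ⟨p, hp⟩ := hp N ρ
    obtain ⟨q, hq⟩ := hq (N + 1) (ρ ++ [N])
    refine ⟨.seq p (.seq q (.seq (.clear N) (.seq (.mv (N + 1) (N + 2)) (.mv (N + 2) N)))), ?_⟩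
    rintro env v rfl h
    have h₁ := hp env v rfl h
    have ha : Agrees (env ++ [f v]) (ρ ++ [env.length]) (v, f v) := by
      have := (h.append [f v]).snoc (i := env.length) (by simp)
      simpa using this
    have h₂ := hq (env ++ [f v]) (v, f v) (by simp) ha
    have h₃ := clear_zero env (f v) (g v (f v)) []
    have h₄ := mv_one_two env [] (g v (f v)) []
    have h₅ := mv_two_zero env [] [] (g v (f v)).reverse
    simp only [List.append_nil, List.reverse_reverse] at h₄ h₅
    rw [List.append_assoc, List.singleton_append, st_two] at h₂
    rw [st_one env (g v (f v))]
    refine (h₁.seq (h₂.seq (h₃.seq (h₄.seq h₅)))).mono ?_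
    have h₁ : (g v (f v)).length ≤ _ := hl' (v, f v)
    have h₂ := hQ v
    have h₃ := hl v
    simp only [Polynomial.eval_add, Polynomial.eval_mul, Polynomial.eval_comp,
      Polynomial.eval_X, Polynomial.eval_ofNat, List.length_reverse] at *
    omega

theorem nil : Poly (fun _ : α => []) := by
  refine ⟨1, by simp, fun N ρ => ⟨.nop, fun env v _ _ => ?_⟩⟩
  rw [st_append_nil]
  exact (Does.nop _).mono (by simp)

/-- For operations that rewrite the top word in linear time; a single constant `C` covers both the
growth in length and the running time. -/
theorem unary {f : α → Word} (hf : Poly f) {op : Word → Word} (C : ℕ)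
    (hl : ∀ a, (op a).length ≤ a.length + C) (q : ℕ → Prog)
    (hq : ∀ env a, Does (q env.length) (st (env ++ [a])) (st (env ++ [op a]))
      (C * a.length + C)) : Poly (fun v => op (f v)) := by
  obtain ⟨P, hl', hp⟩ := hf
  refine ⟨(C + 1 : ℕ) * P + (C : ℕ), fun v => ?_, fun N ρ => ?_⟩
  · have h₁ := hl (f v)
    have h₂ := hl' v
    simp only [Polynomial.eval_add, Polynomial.eval_mul, Polynomial.eval_natCast, Nat.cast_id]
    nlinarith
  · obtain ⟨p, hp⟩ := hp N ρ
    refine ⟨.seq p (q N), ?_⟩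
    rintro env v rfl h
    refine ((hp env v rfl h).seq (hq env (f v))).mono ?_
    have h₂ := hl' v
    simp only [Polynomial.eval_add, Polynomial.eval_mul, Polynomial.eval_natCast, Nat.cast_id]
    nlinarith

theorem binary {f g : α → Word} (hf : Poly f) (hg : Poly g) {op : Word → Word → Word} (C : ℕ)
    (hl : ∀ a b, (op a b).length ≤ a.length + b.length + C) (q : ℕ → Prog)
    (hq : ∀ env a b, Does (q env.length) (st (env ++ [a, b])) (st (env ++ [op a b]))
      (C * (a.length + b.length) + C)) : Poly (fun v => op (f v) (g v)) := by
  obtain ⟨P, hl₁, hp⟩ := hf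
  obtain ⟨Q, hl₂, hq'⟩ := hg
  refine ⟨(C + 1 : ℕ) * (P + Q) + (C : ℕ), fun v => ?_, fun N ρ => ?_⟩
  · have h₁ := hl (f v) (g v)
    have h₂ := hl₁ v
    have h₃ := hl₂ v
    simp only [Polynomial.eval_add, Polynomial.eval_mul, Polynomial.eval_natCast, Nat.cast_id]
    nlinarith
  · obtain ⟨p, hp⟩ := hp N ρ
    obtain ⟨p', hp'⟩ := hq' (N + 1) ρ
    refine ⟨.seq p (.seq p' (q N)), ?_⟩
    rintro env v rfl h
    have h₁ := hp' (env ++ [f v]) v (by simp) (h.append _)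
    rw [List.append_assoc, List.singleton_append] at h₁
    refine ((hp env v rfl h).seq (h₁.seq (hq env (f v) (g v)))).mono ?_
    have h₂ := hl₁ v
    have h₃ := hl₂ v
    simp only [Polynomial.eval_add, Polynomial.eval_mul, Polynomial.eval_natCast, Nat.cast_id]
    nlinarith

theorem cons (c : Sym) {f : α → Word} (hf : Poly f) : Poly (fun v => c :: f v) := by
  refine unary hf (op := fun a => c :: a) 1 (by simp) (fun N => .push N c) fun env a => ?_
  have h := Does.push env.length c (st (env ++ [a, [], []]))
  rw [st_at_zero, update_st_zero] at h
  rw [st_one, st_one env (c :: a)]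
  exact h.mono (by omega)

theorem tail {f : α → Word} (hf : Poly f) : Poly (fun v => (f v).tail) := by
  refine unary hf (op := List.tail) 1 (by simp; omega) (fun N => .pop N) fun env a => ?_
  have h := Does.pop env.length (st (env ++ [a, [], []]))
  rw [st_at_zero, update_st_zero] at h
  rw [st_one, st_one env a.tail]
  exact h.mono (by omega)

theorem dropWhile (P : Sym → Bool) {f : α → Word} (hf : Poly f) :
    Poly (fun v => (f v).dropWhile P) := by
  refine unary hf (op := List.dropWhile P) 2
    (fun a => (List.dropWhile_suffix P).length_le.trans (by omega)) (fun N => .drop P N)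
    fun env a => ?_
  have h := Prog.drop_does P env.length a (st (env ++ [a, [], []])) (st_at_zero ..)
  rw [update_st_zero] at h
  rw [st_one, st_one env (List.dropWhile P a)]
  exact h.mono (by omega)

theorem takeWhile (P : Sym → Bool) {f : α → Word} (hf : Poly f) :
    Poly (fun v => (f v).takeWhile P) := by
  have hlen : ∀ a : Word, (List.takeWhile P a).length ≤ a.length :=
    fun a => (List.takeWhile_prefix P).length_le
  refine unary hf (op := List.takeWhile P) 10 (fun a => (hlen a).trans (by omega))
    (fun N => .seq (.mvWhile P N (N + 1)) (.seq (.clear N) (.mv (N + 1) N)))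
    fun env a => ?_
  have h₁ := Prog.mvWhile_does P (i := env.length) (j := env.length + 1) (by omega) a
    (st (env ++ [a, [], []])) (st_at_zero ..)
  rw [update_st_zero, st_at_one, update_st_one, List.append_nil] at h₁
  have h₂ := clear_zero env (List.dropWhile P a) (List.takeWhile P a).reverse []
  have h₃ := mv_one_zero env [] (List.takeWhile P a).reverse []
  rw [List.reverse_reverse, List.append_nil] at h₃
  rw [st_one, st_one env (List.takeWhile P a)]
  refine (h₁.seq (h₂.seq h₃)).mono ?_
  have := hlen a
  have := (List.dropWhile_suffix P (l := a)).length_le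
  simp only [List.length_reverse]
  omega

theorem append {f g : α → Word} (hf : Poly f) (hg : Poly g) : Poly (fun v => f v ++ g v) := by
  refine binary hf hg (op := fun a b => a ++ b) 20 (by simp)
    (fun N => .seq (.mv N (N + 2)) (.seq (.mv (N + 2) (N + 1))
      (.seq (.mv (N + 1) (N + 2)) (.mv (N + 2) N)))) fun env a b => ?_
  have h₁ := mv_zero_two env a b []
  have h₂ := mv_two_one env [] b a.reverse
  have h₃ := mv_one_two env [] (a ++ b) []
  have h₄ := mv_two_zero env [] [] (a ++ b).reverse
  simp only [List.append_nil, List.reverse_reverse] at h₁ h₂ h₃ h₄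
  rw [st_two, st_one env (a ++ b)]
  refine (h₁.seq (h₂.seq (h₃.seq h₄))).mono ?_
  simp only [List.length_reverse, List.length_append]
  omega

theorem const (w : Word) : Poly (fun _ : α => w) := by
  induction w with
  | nil => exact nil
  | cons c w ih => exact cons c ih

end Poly

/-- The truth value of a proposition as a word. -/
noncomputable def flag (p : Prop) : Word := open Classical in if p then [.top] else []

/-- Compare stacks `N` and `N + 1`, and mark stack `N + 2` if the first is not a prefix of the
second. -/
def Prog.compare (N : ℕ) : Prog :=
  .loop N (fun _ => true) (.case N fun o => o.elim .nop fun c => .seq (.pop N)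
    (.case (N + 1) fun o' => if o' = some c then .pop (N + 1) else .push (N + 2) .top))

/-- The loop always runs until the first word is used up, even after a mismatch. Marks are never
removed, so what happens once the words are out of step is irrelevant. The leftovers `b'` and `m'`
need only length bounds, because they are cleared afterwards. -/
theorem compare_does (env : List Word) (a : Word) : ∀ b m : Word, ∃ b' m' : Word,
    b'.length ≤ b.length ∧ m'.length ≤ m.length + a.length ∧ (m' = [] ↔ m = [] ∧ a <+: b) ∧
    Does (.compare env.length) (st (env ++ [a, b, m])) (st (env ++ [[], b', m']))
      (5 * a.length + 1) := by
  induction a with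
  | nil =>
    intro b m
    exact ⟨b, m, le_rfl, by simp, by simp, (Does.loop_done (by rw [st_at_zero]; rfl)).mono (by simp)⟩
  | cons c a ih =>
    intro b m
    have hpop := Does.pop env.length (st (env ++ [c :: a, b, m]))
    rw [st_at_zero, update_st_zero, List.tail_cons] at hpop
    by_cases hb : b.head? = some c
    · obtain ⟨b, rfl⟩ : ∃ b', b = c :: b' := by
        rcases b with _ | ⟨d, b⟩ <;> simp_all
      obtain ⟨b', m', h₁, h₂, h₃, h₄⟩ := ih b m
      have hs : Does (if (some c) = some c then .pop (env.length + 1)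
          else .push (env.length + 2) .top) (st (env ++ [a, c :: b, m])) (st (env ++ [a, b, m])) 1 := by
        have h := Does.pop (env.length + 1) (st (env ++ [a, c :: b, m]))
        rw [st_at_one, update_st_one, List.tail_cons] at h
        simpa using h
      refine ⟨b', m', by simp; omega, by simp; omega, by simp [h₃], ?_⟩
      refine (Does.loop_step (by rw [st_at_zero]; rfl) (Does.case (some c) (by rw [st_at_zero]; rfl)
        (hpop.seq (Does.case (some c) (by rw [st_at_one]; rfl) hs))) h₄).mono ?_
      simp; omega
    · obtain ⟨b', m', h₁, h₂, h₃, h₄⟩ := ih b (.top :: m)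
      have hs : Does (if b.head? = some c then .pop (env.length + 1)
          else .push (env.length + 2) .top) (st (env ++ [a, b, m]))
          (st (env ++ [a, b, .top :: m])) 1 := by
        have h := Does.push (env.length + 2) .top (st (env ++ [a, b, m]))
        rw [st_at_two, update_st_two] at h
        simpa [hb] using h
      refine ⟨b', m', h₁, by simp at h₂ ⊢; omega, ?_, ?_⟩
      · have : ¬ (c :: a <+: b) := by
          intro h
          obtain ⟨t, rfl⟩ := h
          simp at hb
        simp [h₃, this]
      · refine (Does.loop_step (by rw [st_at_zero]; rfl) (Does.case (some c)
          (by rw [st_at_zero]; rfl) (hpop.seq (Does.case b.head? (by rw [st_at_one]) hs))) h₄).mono ?_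
        simp; omega

/-- The concatenation of the values of `f` at the nonempty suffixes of a word. -/
def forSuffix (f : Word → Word) : Word → Word
  | [] => []
  | c :: w => f (c :: w) ++ forSuffix f w

/-! ### Prefix tests, branching and iteration over suffixes -/

namespace Poly

variable {α : Type} [Ctx α]

theorem isPrefix {f g : α → Word} (hf : Poly f) (hg : Poly g) :
    Poly (fun v => flag (f v <+: g v)) := by
  refine binary hf hg (op := fun a b => flag (a <+: b)) 20 (fun a b => by
      unfold flag; split_ifs <;> simp)
    (fun N => .seq (.compare N) (.seq (.clear (N + 1)) (.seq
      (.case (N + 2) fun o => o.elim (.push N .top) fun _ => .nop) (.clear (N + 2)))))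
    fun env a b => ?_
  obtain ⟨b', m', h₁, h₂, h₃, h₄⟩ := compare_does env a b []
  have h₅ := clear_one env [] b' m'
  have h₆ : Does (.case (env.length + 2) fun o => o.elim (.push env.length .top) fun _ => .nop)
      (st (env ++ [[], [], m'])) (st (env ++ [flag (a <+: b), [], m'])) (1 + 1) := by
    refine Does.case _ rfl ?_
    rw [st_at_two]
    rcases m' with _ | ⟨c, m'⟩
    · have h := Does.push env.length .top (st (env ++ [[], [], []]))
      rw [st_at_zero, update_st_zero] at h
      have : a <+: b := by simpa using h₃
      simpa [flag, this] using h
    · have : ¬ (a <+: b) := by simpa using h₃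
      simpa [flag, this] using Does.nop _
  have h₇ := clear_two env (flag (a <+: b)) [] m'
  rw [st_two, st_one env (flag (a <+: b))]
  refine (h₄.seq (h₅.seq (h₆.seq h₇))).mono ?_
  simp at h₂
  omega

/-- The machine branches on the top symbol first and then clears the tested word, so either branch
starts in the original environment. -/
theorem ite_head (o : Option Sym) {f g h : α → Word} (hf : Poly f) (hg : Poly g) (hh : Poly h) :
    Poly (fun v => if (f v).head? = o then g v else h v) := by
  obtain ⟨P, hlP, hp⟩ := hf
  obtain ⟨Q, hlQ, hq⟩ := hg
  obtain ⟨R, hlR, hr⟩ := hh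
  refine ⟨3 * P + Q + R + 2, fun v => ?_, fun N ρ => ?_⟩
  · have h₁ := hlQ v
    have h₂ := hlR v
    simp only [Polynomial.eval_add, Polynomial.eval_mul, Polynomial.eval_ofNat]
    split_ifs <;> omega
  · obtain ⟨p, hp⟩ := hp N ρ
    obtain ⟨q, hq⟩ := hq N ρ
    obtain ⟨r, hr⟩ := hr N ρ
    refine ⟨.seq p (.case N fun o' => .seq (.clear N) (if o' = o then q else r)), ?_⟩
    rintro env v rfl ha
    have h₁ := hp env v rfl ha
    have h₂ := hq env v rfl ha
    have h₃ := hr env v rfl ha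
    have h₄ := clear_zero env (f v) [] []
    rw [← st_one, ← st_one, st_append_nil] at h₄
    have hhead : (st (env ++ [f v]) env.length).head? = (f v).head? := by
      rw [st_one, st_at_zero]
    have h₅ : Does (if (f v).head? = o then q else r) (st env)
        (st (env ++ [if (f v).head? = o then g v else h v]))
        (Q.eval (size v) + R.eval (size v)) := by
      split_ifs
      · exact h₂.mono (by omega)
      · exact h₃.mono (by omega)
    refine (h₁.seq (Does.case _ hhead (h₄.seq h₅))).mono ?_
    have := hlP v
    simp only [Polynomial.eval_add, Polynomial.eval_mul, Polynomial.eval_ofNat]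
    omega

/-- Stack `N` holds the remaining suffix, stack `N + 1` the reversed output so far, and `g` is
computed on stack `N + 2`. The output is never an argument of `g`, so every round costs at most a
fixed polynomial and there are at most `P` rounds. -/
theorem forSuffix {f : α → Word} {g : α → Word → Word} (hf : Poly f)
    (hg : Poly (fun v : α × Word => g v.1 v.2)) : Poly (fun v => forSuffix (g v) (f v)) := by
  obtain ⟨P, hlP, hp⟩ := hf
  obtain ⟨Q, hlQ, hq⟩ := hg
  have hQ : ∀ (v : α) (w : Word), w.length ≤ P.eval (size v) →
      Q.eval (size (v, w)) ≤ Q.eval (size v + P.eval (size v)) := fun v w h =>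
    eval_mono _ (by rw [size_snoc]; omega)
  have hlen : ∀ (v : α) (w : Word), w.length ≤ P.eval (size v) →
      (DL.forSuffix (g v) w).length ≤ w.length * Q.eval (size v + P.eval (size v)) := by
    intro v w
    induction w with
    | nil => simp [DL.forSuffix]
    | cons c w ih =>
      intro h
      have h₁ : (g v (c :: w)).length ≤ _ := hlQ (v, c :: w)
      have h₂ := hQ v (c :: w) h
      have h₃ := ih (by simp at h; omega)
      simp only [DL.forSuffix, List.length_append, List.length_cons]
      rw [Nat.add_one_mul w.length]
      omega
  refine ⟨P + P * (9 * Q.comp (Polynomial.X + P) + 3) + 2, fun v => ?_, fun N ρ => ?_⟩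
  · have h₁ := hlen v (f v) (hlP v)
    have h₂ := Nat.mul_le_mul_right (Q.eval (size v + P.eval (size v))) (hlP v)
    simp only [Polynomial.eval_add, Polynomial.eval_mul, Polynomial.eval_comp,
      Polynomial.eval_X, Polynomial.eval_ofNat]
    nlinarith
  · obtain ⟨p, hp⟩ := hp N ρ
    obtain ⟨q, hq⟩ := hq (N + 2) (ρ ++ [N])
    refine ⟨.seq p (.seq (.loop N (fun _ => true)
      (.seq q (.seq (.mv (N + 2) (N + 1)) (.pop N)))) (.mv (N + 1) N)), ?_⟩
    rintro env v rfl ha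
    have h₁ := hp env v rfl ha
    have hloop : ∀ w acc : Word, w.length ≤ P.eval (size v) →
        Does (.loop env.length (fun _ => true)
          (.seq q (.seq (.mv (env.length + 2) (env.length + 1)) (.pop env.length))))
          (st (env ++ [w, acc, []])) (st (env ++ [[], (DL.forSuffix (g v) w).reverse ++ acc, []]))
          (w.length * (5 * Q.eval (size v + P.eval (size v)) + 3) + 1) := by
      intro w
      induction w with
      | nil =>
        intro acc _
        exact (Does.loop_done (by rw [st_at_zero]; rfl)).mono (by simp)
      | cons c w ih =>
        intro acc h
        have ha' : Agrees (env ++ [c :: w, acc]) (ρ ++ [env.length]) (v, c :: w) := by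
          have := (ha.append [c :: w, acc]).snoc (i := env.length) (by simp)
          simpa using this
        have h₂ := hq (env ++ [c :: w, acc]) (v, c :: w) (by simp) ha'
        rw [List.append_assoc, List.cons_append, List.singleton_append, st_two] at h₂
        have h₃ := mv_two_one env (c :: w) acc (g v (c :: w))
        have h₄ := Does.pop env.length (st (env ++ [c :: w, (g v (c :: w)).reverse ++ acc, []]))
        rw [st_at_zero, update_st_zero, List.tail_cons] at h₄
        have h₅ := ih ((g v (c :: w)).reverse ++ acc) (by simp at h; omega)
        rw [← List.append_assoc, ← List.reverse_append] at h₅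
        refine (Does.loop_step (by rw [st_at_zero]; rfl) (h₂.seq (h₃.seq h₄)) h₅).mono ?_
        have h₆ : (g v (c :: w)).length ≤ _ := hlQ (v, c :: w)
        have h₇ := hQ v (c :: w) h
        rw [List.length_cons, Nat.add_one_mul w.length]
        omega
    have h₂ := hloop (f v) [] (hlP v)
    have h₃ := mv_one_zero env [] (DL.forSuffix (g v) (f v)).reverse []
    rw [List.reverse_reverse, List.append_nil] at h₃
    rw [List.append_nil] at h₂
    rw [st_one] at h₁
    rw [st_one env (DL.forSuffix (g v) (f v))]
    refine (h₁.seq (h₂.seq h₃)).mono ?_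
    have h₄ := hlen v (f v) (hlP v)
    have h₅ := Nat.mul_le_mul_right (Q.eval (size v + P.eval (size v))) (hlP v)
    have h₆ := hlP v
    simp only [Polynomial.eval_add, Polynomial.eval_mul, Polynomial.eval_comp,
      Polynomial.eval_X, Polynomial.eval_ofNat, List.length_reverse]
    nlinarith

theorem polyTimeComputable {β γ Γ₁ : Type} {ea : β → Word} {eb : γ → List Γ₁} {f : β → γ}
    {F : Word → Word} (hF : Poly F) (k : Sym → Γ₁) (h : ∀ x, (F (ea x)).map k = eb (f x)) :
    PolyTimeComputable ea eb f := by
  obtain ⟨P, hl, hp⟩ := hF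
  obtain ⟨p, hp⟩ := hp 1 [0]
  -- Three moves amount to one reversal and leave the result reversed on stack `1`, as the output
  -- phase expects.
  refine Prog.polyTimeComputable k
    (.seq p (.seq (.clear 0) (.seq (.mv 1 2) (.seq (.mv 2 3) (.mv 3 1))))) F h
    (13 * P + 2 * Polynomial.X + 4) fun w => ?_
  have hsize : size w = w.length := by simp [size, Ctx.vars]
  have h₁ := hp [w] w rfl (List.Forall₂.cons ⟨by simp, rfl⟩ .nil)
  have h₂ := clear_zero [] w (F w) []
  have h₃ := mv_one_two [] [] (F w) []
  have h₄ := Prog.mv_does (i := 2) (j := 3) (by omega) (st [[], [], (F w).reverse])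
  have h₅ := Prog.mv_does (i := 3) (j := 1) (by omega) (st [[], [], [], F w])
  simp only [List.nil_append, List.append_nil, List.length_nil, zero_add] at h₂ h₃
  have e₁ : st ([w] ++ [F w]) = st [w, F w, []] := st_two [] w (F w)
  have e₀ : st [w] = fun k => if k = 0 then w else [] := by
    funext k; rcases k with _ | k <;> simp [st]
  have e₂ : Function.update (Function.update (st [[], [], (F w).reverse]) 2 []) 3
      ((st [[], [], (F w).reverse] 2).reverse ++ st [[], [], (F w).reverse] 3) =
      st [[], [], [], F w] := by
    funext k
    rcases k with _ | _ | _ | _ | k <;> simp [st]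
  have e₃ : Function.update (Function.update (st [[], [], [], F w]) 3 []) 1
      ((st [[], [], [], F w] 3).reverse ++ st [[], [], [], F w] 1) =
      fun k => if k = 1 then (F w).reverse else [] := by
    funext k
    rcases k with _ | _ | _ | _ | k <;> simp [st]
  rw [e₂] at h₄
  rw [e₃] at h₅
  rw [e₁, e₀] at h₁
  obtain ⟨t, ht, hr⟩ := h₁.seq (h₂.seq (h₃.seq (h₄.seq h₅)))
  have hw := hl w
  rw [hsize] at *
  refine ⟨t, ht.trans ?_, hr, ?_⟩
  · simp [st] at *
    omega
  · simp at *
    omega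

end Poly

end DL


namespace DL

/-! ### The TBox of a template -/

def Assertion.indList : Assertion → List Name
  | .concept _ a => [a]
  | .role _ a b => [a, b]

namespace Template

variable (ℬ : Template)

/-- The individual names of the template. -/
def inds : List Name := ℬ.abox.assertions.flatMap Assertion.indList

/-- A name that is longer than all names of the signature. -/
def fresh : Name := List.replicate ℬ.encode.length true

/-- The word `fresh` serves both as this role name and as the concept name M; concept and role names
cannot clash. -/
def roleR : Name := ℬ.fresh

def roleS : Name := true :: ℬ.fresh

/-- Longer than `fresh`, and injective in `d` since the prefix has a fixed length. -/
def color (d : Name) : Name := true :: (ℬ.fresh ++ d)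

/-- The elements that are mapped to `d`. -/
def hidden (d : Name) : Concept := .ex ℬ.roleR (.all ℬ.roleS (.atom (ℬ.color d)))

def cov : Concept := ℬ.inds.foldr (fun d C => .union (ℬ.hidden d) C) .bot

def allColors : Concept := ℬ.inds.foldr (fun d C => .inter (.atom (ℬ.color d)) C) .top

-- The first three groups force an image for every element that takes part in a Σ-atom. The fourth
-- makes the chosen image invisible to positive queries. The last two force the images to respect
-- the template.
open Classical in
noncomputable def tbox : TBox :=
  ℬ.sig.concepts.map (fun A => ⟨.atom A, ℬ.cov⟩) ++
  (ℬ.sig.roles.map (fun R => ⟨.ex R .top, ℬ.cov⟩) ++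
  (ℬ.sig.roles.map (fun R => ⟨.top, .all R ℬ.cov⟩) ++
  ([⟨.top, .all ℬ.roleR (.ex ℬ.roleS ℬ.allColors)⟩] ++
  (ℬ.sig.concepts.flatMap (fun A => ℬ.inds.flatMap fun d =>
    if .concept A d ∈ ℬ.abox then [] else [⟨.inter (.atom A) (ℬ.hidden d), .bot⟩]) ++
  ℬ.sig.roles.flatMap (fun R => ℬ.inds.flatMap fun d => ℬ.inds.flatMap fun e =>
    if .role R d e ∈ ℬ.abox then [] else
      [⟨.inter (ℬ.hidden d) (.ex R (ℬ.hidden e)), .bot⟩])))))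

variable {ℬ}

theorem mem_inds_of_concept {A d : Name} (h : Assertion.concept A d ∈ ℬ.abox) : d ∈ ℬ.inds :=
  List.mem_flatMap.2 ⟨_, h, by simp [Assertion.indList]⟩

theorem mem_inds_of_role_left {r d e : Name} (h : Assertion.role r d e ∈ ℬ.abox) : d ∈ ℬ.inds :=
  List.mem_flatMap.2 ⟨_, h, by simp [Assertion.indList]⟩

theorem mem_inds_of_role_right {r d e : Name} (h : Assertion.role r d e ∈ ℬ.abox) : e ∈ ℬ.inds :=
  List.mem_flatMap.2 ⟨_, h, by simp [Assertion.indList]⟩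

theorem mem_ext_cov (I : Interpretation) (x : I.Dom) :
    x ∈ I.ext ℬ.cov ↔ ∃ d ∈ ℬ.inds, x ∈ I.ext (ℬ.hidden d) := by
  unfold cov
  induction ℬ.inds with
  | nil => simp [Interpretation.ext]
  | cons d l ih => simp [Interpretation.ext, ih]

theorem mem_ext_allColors (I : Interpretation) (x : I.Dom) :
    x ∈ I.ext ℬ.allColors ↔ ∀ d ∈ ℬ.inds, x ∈ I.concept (ℬ.color d) := by
  unfold allColors
  induction ℬ.inds with
  | nil => simp [Interpretation.ext]
  | cons d l ih => simp [Interpretation.ext, ih]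

variable (ℬ) in
/-- The conditions imposed by the TBox on an interpretation. -/
structure IsModel (I : Interpretation) : Prop where
  concept_cov : ∀ A ∈ ℬ.sig.concepts, ∀ x ∈ I.concept A, x ∈ I.ext ℬ.cov
  role_cov_left : ∀ r ∈ ℬ.sig.roles, ∀ x y, I.role r x y → x ∈ I.ext ℬ.cov
  role_cov_right : ∀ r ∈ ℬ.sig.roles, ∀ x y, I.role r x y → y ∈ I.ext ℬ.cov
  succ : ∀ x y, I.role ℬ.roleR x y → ∃ z, I.role ℬ.roleS y z ∧ z ∈ I.ext ℬ.allColors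
  concept_mem : ∀ A ∈ ℬ.sig.concepts, ∀ d ∈ ℬ.inds, ∀ x ∈ I.concept A, x ∈ I.ext (ℬ.hidden d) →
    .concept A d ∈ ℬ.abox
  role_mem : ∀ r ∈ ℬ.sig.roles, ∀ d ∈ ℬ.inds, ∀ e ∈ ℬ.inds, ∀ x y, I.role r x y →
    x ∈ I.ext (ℬ.hidden d) → y ∈ I.ext (ℬ.hidden e) → .role r d e ∈ ℬ.abox

theorem modelsTBox_iff (I : Interpretation) : I.ModelsTBox ℬ.tbox ↔ ℬ.IsModel I := by
  have hbot : ∀ C D : Concept, I.ext (.inter C D) ⊆ I.ext .bot ↔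
      ∀ x ∈ I.ext C, x ∉ I.ext D := by
    intro C D
    simp only [Interpretation.ext, Set.subset_empty_iff, Set.eq_empty_iff_forall_notMem,
      Set.mem_inter_iff, not_and]
  unfold Interpretation.ModelsTBox tbox
  simp only [List.forall_mem_append, List.forall_mem_map, List.forall_mem_flatMap,
    List.forall_mem_singleton]
  constructor
  · rintro ⟨h₁, h₂, h₃, h₄, h₅, h₆⟩
    refine ⟨h₁, fun r hr x y h => h₂ r hr ⟨y, h, trivial⟩,
      fun r hr x y h => h₃ r hr (show x ∈ Set.univ from trivial) y h,
      fun x y h => h₄ (show x ∈ Set.univ from trivial) y h, ?_, ?_⟩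
    · intro A hA d hd x hx hx'
      by_contra hn
      have := h₅ A hA d hd
      simp only [hn, if_false, List.forall_mem_singleton, hbot] at this
      exact this x hx hx'
    · intro r hr d hd e he x y hxy hx hy
      by_contra hn
      have := h₆ r hr d hd e he
      simp only [hn, if_false, List.forall_mem_singleton, hbot] at this
      exact this x hx ⟨y, hxy, hy⟩
  · intro h
    refine ⟨h.concept_cov, ?_, fun r hr x _ y hxy => h.role_cov_right r hr x y hxy,
      fun x _ y hxy => h.succ x y hxy, ?_, ?_⟩
    · rintro r hr x ⟨y, hxy, _⟩
      exact h.role_cov_left r hr x y hxy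
    · intro A hA d hd
      split_ifs with hn
      · simp
      · simp only [List.forall_mem_singleton, hbot]
        exact fun x hx hx' => hn (h.concept_mem A hA d hd x hx hx')
    · intro r hr d hd e he
      split_ifs with hn
      · simp
      · simp only [List.forall_mem_singleton, hbot]
        rintro x hx ⟨y, hxy, hy⟩
        exact hn (h.role_mem r hr d hd e he x y hxy hx hy)

/-- The name is a block of the encoding of the template together with a marker and a delimiter, so
it is strictly shorter than the whole. -/
theorem length_lt_of_mem_concepts {A : Name} (h : A ∈ ℬ.sig.concepts) :
    A.length < ℬ.encode.length := by
  have : (Sym.conceptName :: encodeName A).Sublist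
      (ℬ.sig.concepts.flatMap fun A => Sym.conceptName :: encodeName A) := by
    rw [List.flatMap_def]
    exact List.sublist_flatten_of_mem (List.mem_map.2 ⟨A, h, rfl⟩)
  have := this.length_le
  simp only [Template.encode, Signature.encode, List.length_append]
  simp [encodeName] at this
  simp [encodeName]
  omega

theorem length_lt_of_mem_roles {r : Name} (h : r ∈ ℬ.sig.roles) :
    r.length < ℬ.encode.length := by
  have : (Sym.roleName :: encodeName r).Sublist
      (ℬ.sig.roles.flatMap fun A => Sym.roleName :: encodeName A) := by
    rw [List.flatMap_def]
    exact List.sublist_flatten_of_mem (List.mem_map.2 ⟨r, h, rfl⟩)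
  have := this.length_le
  simp only [Template.encode, Signature.encode, List.length_append]
  simp [encodeName] at this
  simp [encodeName]
  omega

theorem fresh_notMem : ℬ.fresh ∉ ℬ.sig.concepts := fun h => by
  simpa [fresh] using length_lt_of_mem_concepts h

theorem color_notMem (d : Name) : ℬ.color d ∉ ℬ.sig.concepts := fun h => by
  have := length_lt_of_mem_concepts h
  simp [color, fresh] at this
  omega

theorem roleR_notMem : ℬ.roleR ∉ ℬ.sig.roles := fun h => by
  simpa [roleR, fresh] using length_lt_of_mem_roles h

theorem roleS_notMem : ℬ.roleS ∉ ℬ.sig.roles := fun h => by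
  have := length_lt_of_mem_roles h
  simp [roleS, fresh] at this

theorem roleR_ne_roleS : ℬ.roleR ≠ ℬ.roleS := fun h => by
  simpa [roleR, roleS] using congrArg List.length h

theorem color_injective : Function.Injective ℬ.color := fun d e h => by
  simpa [color] using h

theorem fresh_ne_color (d : Name) : ℬ.fresh ≠ ℬ.color d := fun h => by
  have := congrArg List.length h
  simp [color] at this
  omega

end Template

/-! ### Homomorphisms of interpretations -/

namespace Interpretation

theorem Holds.map {I J : Interpretation} (g : I.Dom → J.Dom)
    (hc : ∀ A x, x ∈ I.concept A → g x ∈ J.concept A)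
    (hr : ∀ r x y, I.role r x y → J.role r (g x) (g y)) {n : ℕ} {q : PEQ n} {π : Fin n → I.Dom}
    (h : I.Holds q π) : J.Holds q (g ∘ π) := by
  induction q with
  | concept A x => exact hc A _ h
  | role r x y => exact hr r _ _ h
  | and p q hp hq => exact ⟨hp h.1, hq h.2⟩
  | or p q hp hq => exact h.imp hp hq
  | ex q ih =>
    obtain ⟨d, hd⟩ := h
    refine ⟨g d, ?_⟩
    have := ih hd
    rwa [Fin.comp_snoc] at this

theorem Answers.map {I J : Interpretation} (g : I.Dom → J.Dom)
    (hc : ∀ A x, x ∈ I.concept A → g x ∈ J.concept A)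
    (hr : ∀ r x y, I.role r x y → J.role r (g x) (g y)) {n : ℕ} {q : PEQ n} {a : Fin n → Name}
    (hn : ∀ i d, I.name (a i) = some d → J.name (a i) = some (g d))
    (h : I.Answers q a) : J.Answers q a := by
  obtain ⟨π, hπ, hq⟩ := h
  exact ⟨g ∘ π, fun i => hn i _ (hπ i), hq.map g hc hr⟩

end Interpretation

/-! ### The universal model -/

/-- For an active individual `a`, `succ a` is its anonymous R-successor and `full a` the fully
coloured S-successor of that. For the target `a` of an R-assertion, `leaf a` is a fully coloured
S-successor. The elements `own a` and `blank a` occur only in the models built from a homomorphism,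
where they restrict the colours common to all S-successors. -/
inductive Elem : Type
  | ind (a : Name) : Elem
  | succ (a : Name) : Elem
  | full (a : Name) : Elem
  | leaf (a : Name) : Elem
  | own (a : Name) : Elem
  | blank (a : Name) : Elem

inductive Fact : Type
  | concept (A : Name) (x : Elem) : Fact
  | role (r : Name) (x y : Elem) : Fact

/-- The interpretation given by a set of facts. -/
def interp (F : Set Fact) : Interpretation where
  Dom := Elem
  nonempty := ⟨.ind []⟩
  concept A := {x | .concept A x ∈ F}
  role r x y := .role r x y ∈ F
  name a := some (.ind a)
  name_inj a b d ha hb := by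
    have := ha.trans hb.symm
    simpa using this

namespace Template

variable (ℬ : Template)

def colorFacts (x : Elem) : List Fact := ℬ.inds.map fun d => .concept (ℬ.color d) x

/-- The visible consequences of `cov` at `a`: whichever disjunct holds, there is an R-successor and
below it a fully coloured S-successor. -/
def tree (a : Name) : List Fact :=
  .role ℬ.roleR (.ind a) (.succ a) :: .role ℬ.roleS (.succ a) (.full a) :: ℬ.colorFacts (.full a)

/-- Needed because an ABox that is not over the signature may contain R-assertions, whose targets
are also R-successors. -/
def leaves (b : Name) : List Fact :=
  .role ℬ.roleS (.ind b) (.leaf b) :: ℬ.colorFacts (.leaf b)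

open Classical in
noncomputable def expand : Assertion → List Fact
  | .concept A a => .concept A (.ind a) :: if A ∈ ℬ.sig.concepts then ℬ.tree a else []
  | .role r a b => .role r (.ind a) (.ind b) ::
      ((if r ∈ ℬ.sig.roles then ℬ.tree a ++ ℬ.tree b else []) ++
        if r = ℬ.roleR then ℬ.leaves b else [])

/-- The facts of the universal model. -/
noncomputable def universal (𝒜 : ABox) : List Fact := 𝒜.assertions.flatMap ℬ.expand

/-- The individual occurs in an assertion over the signature. -/
def Active (𝒜 : ABox) (a : Name) : Prop :=
  (∃ A ∈ ℬ.sig.concepts, .concept A a ∈ 𝒜) ∨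
    ∃ r ∈ ℬ.sig.roles, ∃ b, .role r a b ∈ 𝒜 ∨ .role r b a ∈ 𝒜

/-- `h` is a homomorphism to the template from the part of `𝒜` over its signature. -/
def SigHom (𝒜 : ABox) (h : Name → Name) : Prop :=
  (∀ A ∈ ℬ.sig.concepts, ∀ a, .concept A a ∈ 𝒜 → .concept A (h a) ∈ ℬ.abox) ∧
    ∀ r ∈ ℬ.sig.roles, ∀ a b, .role r a b ∈ 𝒜 → .role r (h a) (h b) ∈ ℬ.abox

variable {ℬ} {𝒜 : ABox}

theorem SigHom.mem_inds {h : Name → Name} (hh : ℬ.SigHom 𝒜 h) {a : Name} (ha : ℬ.Active 𝒜 a) :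
    h a ∈ ℬ.inds := by
  rcases ha with ⟨A, hA, ha⟩ | ⟨r, hr, b, ha | ha⟩
  · exact mem_inds_of_concept (hh.1 A hA a ha)
  · exact mem_inds_of_role_left (hh.2 r hr a b ha)
  · exact mem_inds_of_role_right (hh.2 r hr b a ha)

theorem concept_mem_universal {A : Name} {x : Elem} : .concept A x ∈ ℬ.universal 𝒜 ↔
    (∃ a, x = .ind a ∧ .concept A a ∈ 𝒜) ∨
    (∃ a, ℬ.Active 𝒜 a ∧ x = .full a ∧ ∃ d ∈ ℬ.inds, A = ℬ.color d) ∨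
    ∃ a b, .role ℬ.roleR a b ∈ 𝒜 ∧ x = .leaf b ∧ ∃ d ∈ ℬ.inds, A = ℬ.color d := by
  constructor
  · intro h
    obtain ⟨α, hα, h⟩ := List.mem_flatMap.1 h
    rcases α with ⟨B, a⟩ | ⟨r, a, b⟩
    · simp only [expand, tree, colorFacts] at h
      split_ifs at h with hB
      · have : ℬ.Active 𝒜 a := .inl ⟨B, hB, hα⟩
        simp at h
        rcases h with ⟨rfl, rfl⟩ | ⟨d, hd, rfl, rfl⟩
        · exact .inl ⟨a, rfl, hα⟩
        · exact .inr (.inl ⟨a, this, rfl, d, hd, rfl⟩)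
      · simp at h
        obtain ⟨rfl, rfl⟩ := h
        exact .inl ⟨a, rfl, hα⟩
    · simp only [expand, tree, leaves, colorFacts] at h
      simp at h
      rcases h with h | ⟨rfl, h⟩
      · obtain ⟨hr, h⟩ := h
        have h₁ : ℬ.Active 𝒜 a := .inr ⟨r, hr, b, .inl hα⟩
        have h₂ : ℬ.Active 𝒜 b := .inr ⟨r, hr, a, .inr hα⟩
        rcases h with ⟨d, hd, rfl, rfl⟩ | ⟨d, hd, rfl, rfl⟩
        · exact .inr (.inl ⟨a, h₁, rfl, d, hd, rfl⟩)
        · exact .inr (.inl ⟨b, h₂, rfl, d, hd, rfl⟩)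
      · obtain ⟨d, hd, rfl, rfl⟩ := h
        exact .inr (.inr ⟨a, b, hα, rfl, d, hd, rfl⟩)
  · rintro (⟨a, rfl, h⟩ | ⟨a, ha, rfl, d, hd, rfl⟩ | ⟨a, b, h, rfl, d, hd, rfl⟩)
    · exact List.mem_flatMap.2 ⟨_, h, by simp [expand]⟩
    · rcases ha with ⟨A, hA, ha⟩ | ⟨r, hr, b, ha | ha⟩
      · exact List.mem_flatMap.2 ⟨_, ha, by simp [expand, hA, tree, colorFacts, color_injective.eq_iff, hd]⟩
      · exact List.mem_flatMap.2 ⟨_, ha, by simp [expand, hr, tree, colorFacts, color_injective.eq_iff, hd]⟩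
      · exact List.mem_flatMap.2 ⟨_, ha, by simp [expand, hr, tree, colorFacts, color_injective.eq_iff, hd]⟩
    · exact List.mem_flatMap.2 ⟨_, h, by simp [expand, leaves, colorFacts, color_injective.eq_iff, hd]⟩

theorem role_mem_universal {r : Name} {x y : Elem} : .role r x y ∈ ℬ.universal 𝒜 ↔
    (∃ a b, x = .ind a ∧ y = .ind b ∧ .role r a b ∈ 𝒜) ∨
    (∃ a, ℬ.Active 𝒜 a ∧ r = ℬ.roleR ∧ x = .ind a ∧ y = .succ a) ∨
    (∃ a, ℬ.Active 𝒜 a ∧ r = ℬ.roleS ∧ x = .succ a ∧ y = .full a) ∨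
    ∃ a b, .role ℬ.roleR a b ∈ 𝒜 ∧ r = ℬ.roleS ∧ x = .ind b ∧ y = .leaf b := by
  constructor
  · intro h
    obtain ⟨α, hα, h⟩ := List.mem_flatMap.1 h
    rcases α with ⟨B, a⟩ | ⟨s, a, b⟩
    · simp only [expand, tree, colorFacts] at h
      split_ifs at h with hB
      · have : ℬ.Active 𝒜 a := .inl ⟨B, hB, hα⟩
        simp at h
        grind
      · simp at h
    · simp only [expand, tree, leaves, colorFacts] at h
      simp at h
      rcases h with ⟨rfl, rfl, rfl⟩ | h | ⟨rfl, h⟩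
      · exact .inl ⟨a, b, rfl, rfl, hα⟩
      · obtain ⟨hr, h⟩ := h
        have h₁ : ℬ.Active 𝒜 a := .inr ⟨s, hr, b, .inl hα⟩
        have h₂ : ℬ.Active 𝒜 b := .inr ⟨s, hr, a, .inr hα⟩
        grind
      · obtain ⟨rfl, rfl, rfl⟩ := h
        exact .inr (.inr (.inr ⟨a, b, hα, rfl, rfl, rfl⟩))
  · rintro (⟨a, b, rfl, rfl, h⟩ | ⟨a, ha, rfl, rfl, rfl⟩ | ⟨a, ha, rfl, rfl, rfl⟩ |
      ⟨a, b, h, rfl, rfl, rfl⟩)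
    · exact List.mem_flatMap.2 ⟨_, h, by simp [expand]⟩
    · rcases ha with ⟨A, hA, ha⟩ | ⟨r, hr, b, ha | ha⟩
      · exact List.mem_flatMap.2 ⟨_, ha, by simp [expand, hA, tree]⟩
      · exact List.mem_flatMap.2 ⟨_, ha, by simp [expand, hr, tree]⟩
      · exact List.mem_flatMap.2 ⟨_, ha, by simp [expand, hr, tree]⟩
    · rcases ha with ⟨A, hA, ha⟩ | ⟨r, hr, b, ha | ha⟩
      · exact List.mem_flatMap.2 ⟨_, ha, by simp [expand, hA, tree]⟩
      · exact List.mem_flatMap.2 ⟨_, ha, by simp [expand, hr, tree]⟩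
      · exact List.mem_flatMap.2 ⟨_, ha, by simp [expand, hr, tree]⟩
    · exact List.mem_flatMap.2 ⟨_, h, by simp [expand, leaves]⟩

variable (ℬ 𝒜) in
/-- The universal model, extended by elements that make the concepts `hidden (h a)` true and the
other concepts `hidden d` false. -/
def modelFacts (h : Name → Name) : Set Fact :=
  {f | f ∈ ℬ.universal 𝒜 ∨
    (∃ a, ℬ.Active 𝒜 a ∧
      (f = .role ℬ.roleS (.succ a) (.own a) ∨ f = .concept (ℬ.color (h a)) (.own a))) ∨
    ∃ a b, .role ℬ.roleR a b ∈ 𝒜 ∧ f = .role ℬ.roleS (.ind b) (.blank b)}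

/-! ### The model given by a homomorphism -/

section Model

variable {h : Name → Name}

theorem mem_concept_of_mem_sig {A : Name} (hA : A ∈ ℬ.sig.concepts) {x : Elem}
    (hx : .concept A x ∈ ℬ.modelFacts 𝒜 h) : ∃ a, x = .ind a ∧ .concept A a ∈ 𝒜 := by
  rcases hx with hx | ⟨a, _, hx | hx⟩ | ⟨a, b, _, hx⟩
  · rcases concept_mem_universal.1 hx with hx | ⟨_, _, _, d, _, rfl⟩ | ⟨_, _, _, _, d, _, rfl⟩
    · exact hx
    · exact absurd hA (color_notMem d)
    · exact absurd hA (color_notMem d)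
  · simp at hx
  · simp at hx
    exact absurd (hx.1 ▸ hA) (color_notMem _)
  · simp at hx

theorem role_of_mem_sig {r : Name} (hr : r ∈ ℬ.sig.roles) {x y : Elem}
    (hx : .role r x y ∈ ℬ.modelFacts 𝒜 h) :
    ∃ a b, x = .ind a ∧ y = .ind b ∧ .role r a b ∈ 𝒜 := by
  rcases hx with hx | ⟨a, _, hx | hx⟩ | ⟨a, b, _, hx⟩
  · rcases role_mem_universal.1 hx with hx | ⟨_, _, rfl, _⟩ | ⟨_, _, rfl, _⟩ | ⟨_, _, _, rfl, _⟩
    · exact hx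
    · exact absurd hr roleR_notMem
    · exact absurd hr roleS_notMem
    · exact absurd hr roleS_notMem
  · simp at hx
    exact absurd (hx.1 ▸ hr) roleS_notMem
  · simp at hx
  · simp at hx
    exact absurd (hx.1 ▸ hr) roleS_notMem

theorem roleR_cases {x y : Elem} (hx : .role ℬ.roleR x y ∈ ℬ.modelFacts 𝒜 h) :
    (∃ a b, x = .ind a ∧ y = .ind b ∧ .role ℬ.roleR a b ∈ 𝒜) ∨
      ∃ a, ℬ.Active 𝒜 a ∧ x = .ind a ∧ y = .succ a := by
  rcases hx with hx | ⟨a, _, hx | hx⟩ | ⟨a, b, _, hx⟩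
  · rcases role_mem_universal.1 hx with hx | ⟨a, ha, _, hx⟩ | ⟨_, _, hx, _⟩ | ⟨_, _, _, hx, _⟩
    · exact .inl hx
    · exact .inr ⟨a, ha, hx⟩
    · exact absurd hx roleR_ne_roleS
    · exact absurd hx roleR_ne_roleS
  · simp at hx
    exact absurd hx.1 roleR_ne_roleS
  · simp at hx
  · simp at hx
    exact absurd hx.1 roleR_ne_roleS

/-- As `succ a` is not an individual, no assertion of the ABox can add S-successors to it. -/
theorem roleS_succ_cases {a : Name} {y : Elem}
    (hx : .role ℬ.roleS (.succ a) y ∈ ℬ.modelFacts 𝒜 h) :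
    ℬ.Active 𝒜 a ∧ (y = .full a ∨ y = .own a) := by
  rcases hx with hx | ⟨a, ha, hx | hx⟩ | ⟨a, b, _, hx⟩
  · rcases role_mem_universal.1 hx with hx | ⟨a, ha, _, hx⟩ | ⟨a, ha, _, hx⟩ | ⟨_, _, _, _, hx⟩
    · simp at hx
    · simp at hx
    · simp at hx
      obtain ⟨rfl, rfl⟩ := hx
      exact ⟨ha, .inl rfl⟩
    · simp at hx
  · simp at hx
    obtain ⟨rfl, rfl⟩ := hx
    exact ⟨ha, .inr rfl⟩
  · simp at hx
  · simp at hx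

theorem color_own {A : Name} {a : Name} (hx : .concept A (.own a) ∈ ℬ.modelFacts 𝒜 h) :
    A = ℬ.color (h a) := by
  rcases hx with hx | ⟨a, ha, hx | hx⟩ | ⟨a, b, _, hx⟩
  · have := concept_mem_universal.1 hx
    simp at this
  · simp at hx
  · simp at hx
    rw [hx.1, hx.2]
  · simp at hx

theorem not_color_blank {A b : Name} : .concept A (.blank b) ∉ ℬ.modelFacts 𝒜 h := by
  rintro (hx | ⟨a, ha, hx | hx⟩ | ⟨a, b, _, hx⟩)
  · have := concept_mem_universal.1 hx
    simp at this
  · simp at hx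
  · simp at hx
  · simp at hx

/-- An R-successor is either an individual, whose S-successor `blank b` has no colour, or `succ a`,
whose S-successor `own a` has only the colour of `h a`. Either way the colour of `d` is missing
somewhere. -/
theorem not_hidden_of_ne {x : Elem} {d : Name} (hd : ∀ a, x = .ind a → ℬ.Active 𝒜 a → d ≠ h a) :
    x ∉ (interp (ℬ.modelFacts 𝒜 h)).ext (ℬ.hidden d) := by
  rintro ⟨y, hxy, hy⟩
  rcases roleR_cases hxy with ⟨a, b, rfl, rfl, hab⟩ | ⟨a, ha, rfl, rfl⟩
  · have : .role ℬ.roleS (.ind b) (.blank b) ∈ ℬ.modelFacts 𝒜 h := .inr (.inr ⟨a, b, hab, rfl⟩)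
    exact not_color_blank (hy _ this)
  · have : .role ℬ.roleS (.succ a) (.own a) ∈ ℬ.modelFacts 𝒜 h := .inr (.inl ⟨a, ha, .inl rfl⟩)
    exact hd a rfl ha (color_injective (color_own (hy _ this)))

/-- The witness is `succ a`: its only S-successors are `full a` and `own a`, and both have the
colour of `h a`. -/
theorem mem_hidden (hh : ℬ.SigHom 𝒜 h) {a : Name} (ha : ℬ.Active 𝒜 a) :
    Elem.ind a ∈ (interp (ℬ.modelFacts 𝒜 h)).ext (ℬ.hidden (h a)) := by
  refine ⟨.succ a, .inl (role_mem_universal.2 (.inr (.inl ⟨a, ha, rfl, rfl, rfl⟩))), ?_⟩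
  intro z hz
  obtain ⟨_, rfl | rfl⟩ := roleS_succ_cases hz
  · exact .inl (concept_mem_universal.2 (.inr (.inl ⟨a, ha, rfl, _, hh.mem_inds ha, rfl⟩)))
  · exact .inr (.inl ⟨a, ha, .inr rfl⟩)

theorem eq_of_mem_hidden {a d : Name}
    (hd : Elem.ind a ∈ (interp (ℬ.modelFacts 𝒜 h)).ext (ℬ.hidden d)) : d = h a := by
  by_contra hn
  refine not_hidden_of_ne (fun b hb _ => ?_) hd
  obtain rfl : a = b := by simpa using hb
  exact hn

theorem modelsTBox_modelFacts (hh : ℬ.SigHom 𝒜 h) :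
    (interp (ℬ.modelFacts 𝒜 h)).ModelsTBox ℬ.tbox := by
  have hcov : ∀ a, ℬ.Active 𝒜 a → Elem.ind a ∈ (interp (ℬ.modelFacts 𝒜 h)).ext ℬ.cov :=
    fun a ha => (mem_ext_cov _ _).2 ⟨h a, hh.mem_inds ha, mem_hidden hh ha⟩
  refine (modelsTBox_iff _).2 ⟨?_, ?_, ?_, ?_, ?_, ?_⟩
  · intro A hA x hx
    obtain ⟨a, rfl, ha⟩ := mem_concept_of_mem_sig hA hx
    exact hcov a (.inl ⟨A, hA, ha⟩)
  · intro r hr x y hxy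
    obtain ⟨a, b, rfl, rfl, hab⟩ := role_of_mem_sig hr hxy
    exact hcov a (.inr ⟨r, hr, b, .inl hab⟩)
  · intro r hr x y hxy
    obtain ⟨a, b, rfl, rfl, hab⟩ := role_of_mem_sig hr hxy
    exact hcov b (.inr ⟨r, hr, a, .inr hab⟩)
  · intro x y hxy
    rcases roleR_cases hxy with ⟨a, b, rfl, rfl, hab⟩ | ⟨a, ha, rfl, rfl⟩
    · refine ⟨.leaf b, .inl (role_mem_universal.2 (.inr (.inr (.inr ⟨a, b, hab, rfl, rfl, rfl⟩)))),
        (mem_ext_allColors _ _).2 fun d hd => .inl (concept_mem_universal.2 ?_)⟩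
      exact .inr (.inr ⟨a, b, hab, rfl, d, hd, rfl⟩)
    · refine ⟨.full a, .inl (role_mem_universal.2 (.inr (.inr (.inl ⟨a, ha, rfl, rfl, rfl⟩)))),
        (mem_ext_allColors _ _).2 fun d hd => .inl (concept_mem_universal.2 ?_)⟩
      exact .inr (.inl ⟨a, ha, rfl, d, hd, rfl⟩)
  · intro A hA d hd x hx hx'
    obtain ⟨a, rfl, ha⟩ := mem_concept_of_mem_sig hA hx
    rw [eq_of_mem_hidden hx']
    exact hh.1 A hA a ha
  · intro r hr d hd e he x y hxy hx hy
    obtain ⟨a, b, rfl, rfl, hab⟩ := role_of_mem_sig hr hxy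
    rw [eq_of_mem_hidden hx, eq_of_mem_hidden hy]
    exact hh.2 r hr a b hab

theorem modelsABox_interp {F : Set Fact} (hF : ∀ f ∈ ℬ.universal 𝒜, f ∈ F) :
    (interp F).ModelsABox 𝒜 := by
  rintro (⟨A, a⟩ | ⟨r, a, b⟩) hα
  · exact ⟨_, rfl, hF _ (concept_mem_universal.2 (.inl ⟨a, rfl, hα⟩))⟩
  · exact ⟨_, _, rfl, rfl, hF _ (role_mem_universal.2 (.inl ⟨a, b, rfl, rfl, hα⟩))⟩

end Model

/-- The part of the ABox over the signature maps to the template if there is a model. -/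
theorem exists_sigHom {I : Interpretation} (hT : I.ModelsTBox ℬ.tbox) (hA : I.ModelsABox 𝒜) :
    ∃ h, ℬ.SigHom 𝒜 h := by
  have hT := (modelsTBox_iff I).1 hT
  -- An active individual lies in `cov`, so it satisfies some `hidden d`; any such `d` can be its
  -- image. The images of the other individuals are irrelevant.
  have key : ∀ a, ∃ d, ℬ.Active 𝒜 a → d ∈ ℬ.inds ∧
      ∀ x, I.name a = some x → x ∈ I.ext (ℬ.hidden d) := by
    intro a
    by_cases ha : ℬ.Active 𝒜 a
    · have : ∃ x, I.name a = some x ∧ x ∈ I.ext ℬ.cov := by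
        rcases ha with ⟨A, hA', ha⟩ | ⟨r, hr, b, ha | ha⟩
        · obtain ⟨x, hx, hx'⟩ := hA _ ha
          exact ⟨x, hx, hT.concept_cov A hA' x hx'⟩
        · obtain ⟨x, y, hx, hy, hxy⟩ := hA _ ha
          exact ⟨x, hx, hT.role_cov_left r hr x y hxy⟩
        · obtain ⟨x, y, hx, hy, hxy⟩ := hA _ ha
          exact ⟨y, hy, hT.role_cov_right r hr x y hxy⟩
      obtain ⟨x, hx, hx'⟩ := this
      obtain ⟨d, hd, hxd⟩ := (mem_ext_cov I x).1 hx'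
      refine ⟨d, fun _ => ⟨hd, fun y hy => ?_⟩⟩
      obtain rfl : x = y := by simpa [hx] using hy
      exact hxd
    · exact ⟨a, fun h => absurd h ha⟩
  choose h hh using key
  refine ⟨h, fun A hA' a ha => ?_, fun r hr a b hab => ?_⟩
  · obtain ⟨x, hx, hx'⟩ := hA _ ha
    have := hh a (.inl ⟨A, hA', ha⟩)
    exact hT.concept_mem A hA' _ this.1 x hx' (this.2 x hx)
  · obtain ⟨x, y, hx, hy, hxy⟩ := hA _ hab
    have h₁ := hh a (.inr ⟨r, hr, b, .inl hab⟩)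
    have h₂ := hh b (.inr ⟨r, hr, a, .inr hab⟩)
    exact hT.role_mem r hr _ h₁.1 _ h₂.1 x y hxy (h₁.2 x hx) (h₂.2 y hy)

/-- The universal model maps to every model. -/
theorem answers_of_universal {I : Interpretation} (hT : I.ModelsTBox ℬ.tbox)
    (hA : I.ModelsABox 𝒜) {n : ℕ} {q : PEQ n} {a : Fin n → Name} (ha : ∀ i, a i ∈ 𝒜.Ind)
    (hq : (interp {f | f ∈ ℬ.universal 𝒜}).Answers q a) : I.Answers q a := by
  have hT := (modelsTBox_iff I).1 hT
  obtain ⟨x₀⟩ := I.nonempty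
  have hc : ∀ A a, .concept A a ∈ 𝒜 → (I.name a).getD x₀ ∈ I.concept A := by
    intro A a h
    obtain ⟨x, hx, hx'⟩ := hA _ h
    simpa [hx] using hx'
  have hr : ∀ r a b, .role r a b ∈ 𝒜 → I.role r ((I.name a).getD x₀) ((I.name b).getD x₀) := by
    intro r a b h
    obtain ⟨x, y, hx, hy, hxy⟩ := hA _ h
    simpa [hx, hy] using hxy
  have hS : ∀ a, ∃ y, ℬ.Active 𝒜 a → I.role ℬ.roleR ((I.name a).getD x₀) y := by
    intro a
    by_cases h : ℬ.Active 𝒜 a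
    · have : (I.name a).getD x₀ ∈ I.ext ℬ.cov := by
        rcases h with ⟨A, hA', ha⟩ | ⟨r, hr', b, ha | ha⟩
        · exact hT.concept_cov A hA' _ (hc A a ha)
        · exact hT.role_cov_left r hr' _ _ (hr r a b ha)
        · exact hT.role_cov_right r hr' _ _ (hr r b a ha)
      obtain ⟨d, -, y, hy, -⟩ := (mem_ext_cov I _).1 this
      exact ⟨y, fun _ => hy⟩
    · exact ⟨x₀, fun h' => absurd h' h⟩
  choose S hS using hS
  -- The fully coloured S-successor is chosen for `y` alone, independently of the R-predecessor, so
  -- the same choice serves `full` and `leaf`.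
  have hU : ∀ y, ∃ z, ∀ x, I.role ℬ.roleR x y → I.role ℬ.roleS y z ∧ z ∈ I.ext ℬ.allColors := by
    intro y
    by_cases h : ∃ x, I.role ℬ.roleR x y
    · obtain ⟨x, hx⟩ := h
      obtain ⟨z, hz⟩ := hT.succ x y hx
      exact ⟨z, fun _ _ => hz⟩
    · exact ⟨x₀, fun x hx => absurd ⟨x, hx⟩ h⟩
  choose U hU using hU
  let g : Elem → I.Dom := fun
    | .ind a => (I.name a).getD x₀
    | .succ a => S a
    | .full a => U (S a)
    | .leaf a => U ((I.name a).getD x₀)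
    | .own _ => x₀
    | .blank _ => x₀
  refine hq.map g ?_ ?_ ?_
  · intro A x hx
    rcases concept_mem_universal.1 hx with ⟨a, rfl, h⟩ | ⟨a, h, rfl, d, hd, rfl⟩ |
      ⟨a, b, h, rfl, d, hd, rfl⟩
    · exact hc A a h
    · exact (mem_ext_allColors I _).1 (hU _ _ (hS a h)).2 d hd
    · exact (mem_ext_allColors I _).1 (hU _ _ (hr _ a b h)).2 d hd
  · intro r x y hxy
    rcases role_mem_universal.1 hxy with ⟨a, b, rfl, rfl, h⟩ | ⟨a, h, rfl, rfl, rfl⟩ |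
      ⟨a, h, rfl, rfl, rfl⟩ | ⟨a, b, h, rfl, rfl, rfl⟩
    · exact hr r a b h
    · exact hS a h
    · exact (hU _ _ (hS a h)).1
    · exact (hU _ _ (hr _ a b h)).1
  · intro i d hd
    obtain rfl : Elem.ind (a i) = d := Option.some.inj hd
    obtain ⟨α, hα, hi⟩ := ha i
    have : ∃ x, I.name (a i) = some x := by
      have := hA α hα
      rcases α with ⟨A, b⟩ | ⟨r, b, c⟩
      · obtain rfl : a i = b := hi
        exact ⟨_, this.choose_spec.1⟩
      · obtain ⟨x, y, hx, hy, -⟩ := this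
        rcases hi with hi | hi
        · exact ⟨x, hi ▸ hx⟩
        · exact ⟨y, (show a i = c from hi) ▸ hy⟩
    obtain ⟨x, hx⟩ := this
    simp [g, hx]

/-- The model given by a homomorphism maps to the universal model. -/
theorem universal_of_modelFacts {h : Name → Name} (hh : ℬ.SigHom 𝒜 h) {n : ℕ} {q : PEQ n}
    {a : Fin n → Name} (hq : (interp (ℬ.modelFacts 𝒜 h)).Answers q a) :
    (interp {f | f ∈ ℬ.universal 𝒜}).Answers q a := by
  -- Folding onto the fully coloured points loses no fact: they have the same incoming S-edges and
  -- every colour of the template.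
  let g : Elem → Elem := fun
    | .own a => .full a
    | .blank a => .leaf a
    | x => x
  refine hq.map (J := interp {f | f ∈ ℬ.universal 𝒜}) g ?_ ?_ ?_
  · rintro A (x : Elem) (hx | ⟨a, ha, hx | hx⟩ | ⟨a, b, _, hx⟩)
    · have : g x = x := by
        rcases concept_mem_universal.1 hx with ⟨a, rfl, _⟩ | ⟨a, _, rfl, _⟩ | ⟨a, b, _, rfl, _⟩ <;> rfl
      rw [this]
      exact hx
    · simp at hx
    · simp at hx
      obtain ⟨rfl, rfl⟩ := hx
      exact concept_mem_universal.2 (.inr (.inl ⟨a, ha, rfl, _, hh.mem_inds ha, rfl⟩))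
    · simp at hx
  · rintro r (x : Elem) (y : Elem) (hx | ⟨a, ha, hx | hx⟩ | ⟨a, b, hab, hx⟩)
    · have : g x = x ∧ g y = y := by
        rcases role_mem_universal.1 hx with ⟨a, b, rfl, rfl, h⟩ | ⟨a, h, rfl, rfl, rfl⟩ |
          ⟨a, h, rfl, rfl, rfl⟩ | ⟨a, b, h, rfl, rfl, rfl⟩ <;> exact ⟨rfl, rfl⟩
      rw [this.1, this.2]
      exact hx
    · simp at hx
      obtain ⟨rfl, rfl, rfl⟩ := hx
      exact role_mem_universal.2 (.inr (.inr (.inl ⟨a, ha, rfl, rfl, rfl⟩)))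
    · simp at hx
    · simp at hx
      obtain ⟨rfl, rfl, rfl⟩ := hx
      exact role_mem_universal.2 (.inr (.inr (.inr ⟨a, b, hab, rfl, rfl, rfl⟩)))
  · intro i d hd
    obtain rfl : Elem.ind (a i) = d := Option.some.inj hd
    rfl

/-! ### Consistency, certain answers and materializability -/

theorem consistent_iff : Consistent ℬ.tbox 𝒜 ↔ ∃ h, ℬ.SigHom 𝒜 h := by
  constructor
  · rintro ⟨I, hT, hA⟩
    exact exists_sigHom hT hA
  · rintro ⟨h, hh⟩
    exact ⟨_, modelsTBox_modelFacts hh, modelsABox_interp fun f hf => .inl hf⟩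

theorem certainAnswer_iff_of_sigHom {h : Name → Name} (hh : ℬ.SigHom 𝒜 h) {n : ℕ} {q : PEQ n}
    {a : Fin n → Name} (ha : ∀ i, a i ∈ 𝒜.Ind) :
    CertainAnswer ℬ.tbox 𝒜 q a ↔ (interp {f | f ∈ ℬ.universal 𝒜}).Answers q a := by
  constructor
  · intro hq
    exact universal_of_modelFacts hh
      (hq _ (modelsTBox_modelFacts hh) (modelsABox_interp fun f hf => .inl hf))
  · intro hq I hT hA
    exact answers_of_universal hT hA ha hq

/-- If there is no homomorphism, there is no common model and every tuple is a certain answer. -/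
theorem certainAnswer_iff {n : ℕ} {q : PEQ n} {a : Fin n → Name} (ha : ∀ i, a i ∈ 𝒜.Ind) :
    CertainAnswer ℬ.tbox 𝒜 q a ↔
      (interp {f | f ∈ ℬ.universal 𝒜}).Answers q a ∨ ¬ ∃ h, ℬ.SigHom 𝒜 h := by
  by_cases hh : ∃ h, ℬ.SigHom 𝒜 h
  · obtain ⟨h, hh⟩ := hh
    rw [certainAnswer_iff_of_sigHom hh ha]
    exact ⟨.inl, fun h' => h'.resolve_right fun hn => hn ⟨h, hh⟩⟩
  · simp only [hh, not_false_eq_true, or_true, iff_true]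
    exact fun I hT hA => absurd (exists_sigHom hT hA) hh

/-- The model obtained from any single homomorphism is a materialization, since its answers over the
ABox already hold in the universal model. -/
theorem materializable : Materializable ℬ.tbox := by
  intro 𝒜 hcons
  obtain ⟨h, hh⟩ := consistent_iff.1 hcons
  refine ⟨_, modelsTBox_modelFacts hh, modelsABox_interp fun f hf => .inl hf, fun n q a ha => ?_⟩
  constructor
  · intro hq
    exact (certainAnswer_iff_of_sigHom hh ha).2 (universal_of_modelFacts hh hq)
  · intro hq
    exact hq _ (modelsTBox_modelFacts hh) (modelsABox_interp fun f hf => .inl hf)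

theorem homTo_iff_of_over (h𝒜 : 𝒜.Over ℬ.sig) : 𝒜.HomTo ℬ.abox ↔ ∃ h, ℬ.SigHom 𝒜 h := by
  constructor
  · rintro ⟨h, hc, hr⟩
    exact ⟨h, fun A _ a ha => hc A a ha, fun r _ a b hab => hr r a b hab⟩
  · rintro ⟨h, hc, hr⟩
    exact ⟨h, fun A a ha => hc A (h𝒜 _ ha) a ha, fun r a b hab => hr r (h𝒜 _ hab) a b hab⟩

/-- The name `fresh` is neither in the signature nor a colour. Hence the query fails in the
universal model of an ABox over the signature, and it is certain only when no homomorphism exists.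
-/
theorem homTo_iff (h𝒜 : 𝒜.Over ℬ.sig) : 𝒜.HomTo ℬ.abox ↔
    ¬ CertainAnswer ℬ.tbox 𝒜 (PEQ.someInstance ℬ.fresh) Fin.elim0 := by
  rw [homTo_iff_of_over h𝒜, certainAnswer_iff (fun i => i.elim0), not_or, not_not]
  refine (and_iff_right ?_).symm
  rintro ⟨π, -, x, hx⟩
  rcases concept_mem_universal.1 hx with ⟨a, _, h⟩ | ⟨_, _, _, d, _, h⟩ | ⟨_, _, _, _, d, _, h⟩
  · exact fresh_notMem (h𝒜 _ h)
  · exact fresh_ne_color d h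
  · exact fresh_ne_color d h

end Template

end DL


namespace DL

open Ctx

/-! ### Renaming of variables and simultaneous substitution -/

namespace Ctx

variable {α : Type} [Ctx α]

theorem fst_mem_vars {X : α → Word} (hX : X ∈ vars) : (fun v : α × Word => X v.1) ∈ vars :=
  List.mem_append_left _ (List.mem_map.2 ⟨X, hX, rfl⟩)

theorem snd_mem_vars : (fun v : α × Word => v.2) ∈ vars :=
  List.mem_append_right _ (List.mem_singleton.2 rfl)

theorem mem_vars_snoc {X : α × Word → Word} :
    X ∈ vars ↔ (∃ Y ∈ vars, X = fun v => Y v.1) ∨ X = fun v => v.2 := by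
  constructor
  · intro h
    rcases List.mem_append.1 h with h | h
    · obtain ⟨Y, hY, rfl⟩ := List.mem_map.1 h
      exact .inl ⟨Y, hY, rfl⟩
    · exact .inr (List.mem_singleton.1 h)
  · rintro (⟨Y, hY, rfl⟩ | rfl)
    · exact fst_mem_vars hY
    · exact snd_mem_vars

end Ctx

namespace Poly

variable {α β : Type} [Ctx α] [Ctx β]

/-- Renaming of variables. -/
theorem rename {f : α → Word} (hf : Poly f) (φ : β → α)
    (hφ : ∀ X ∈ vars (α := α), (fun v => X (φ v)) ∈ vars (α := β)) : Poly (fun v => f (φ v)) := by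
  obtain ⟨P, hl, hp⟩ := hf
  -- The factor is needed because `φ` may repeat a component.
  have hsize : ∀ v, size (φ v) ≤ (vars (α := α)).length * size v := by
    intro v
    unfold size
    refine (List.sum_le_card_nsmul _ (size v) ?_).trans (by simp [size])
    intro n hn
    obtain ⟨X, hX, rfl⟩ := List.mem_map.1 hn
    exact length_le_size (hφ X hX) v
  have hP : ∀ v, P.eval (size (φ v)) ≤
      (P.comp (((vars (α := α)).length : Polynomial ℕ) * Polynomial.X)).eval (size v) := by
    intro v
    rw [Polynomial.eval_comp]
    refine eval_mono _ ((hsize v).trans ?_)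
    simp
  refine ⟨_, fun v => (hl (φ v)).trans (hP v), fun N ρ => ?_⟩
  classical
  let idx : (α → Word) → ℕ := fun X => (vars (α := β)).findIdx (fun Y => decide (Y = fun v => X (φ v)))
  -- The program for `f` is reused; it only reads its arguments from other places.
  obtain ⟨p, hp⟩ := hp N ((vars (α := α)).map fun X => ρ.getD (idx X) 0)
  refine ⟨p, fun env v hN h => (hp env (φ v) hN ?_).mono (hP v)⟩
  unfold Agrees
  rw [List.forall₂_map_right_iff, List.forall₂_same]
  intro X hX
  have h' := List.forall₂_iff_get.1 h
  have hi : idx X < (vars (α := β)).length :=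
    List.findIdx_lt_length_of_exists ⟨_, hφ X hX, by simp⟩
  have hY : (vars (α := β))[idx X] = fun v => X (φ v) := by
    simpa using List.findIdx_getElem (w := hi)
  have h'' := h'.2 (idx X) hi (h'.1 ▸ hi)
  simp only [List.get_eq_getElem] at h''
  rw [hY] at h''
  have hρ : idx X < ρ.length := h'.1 ▸ hi
  rwa [show ρ.getD (idx X) 0 = ρ[idx X] by simp [hρ]]

theorem bind₂ {f₁ f₂ : α → Word} {g : α → Word → Word → Word} (h₁ : Poly f₁) (h₂ : Poly f₂)
    (hg : Poly (fun v : (α × Word) × Word => g v.1.1 v.1.2 v.2)) :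
    Poly (fun v => g v (f₁ v) (f₂ v)) :=
  bind (g := fun v x => g v x (f₂ v)) h₁ (bind (g := fun u y => g u.1 u.2 y) h₂.weaken hg)

theorem bind₃ {f₁ f₂ f₃ : α → Word} {g : α → Word → Word → Word → Word} (h₁ : Poly f₁)
    (h₂ : Poly f₂) (h₃ : Poly f₃)
    (hg : Poly (fun v : ((α × Word) × Word) × Word => g v.1.1.1 v.1.1.2 v.1.2 v.2)) :
    Poly (fun v => g v (f₁ v) (f₂ v) (f₃ v)) :=
  bind (g := fun v x => g v x (f₂ v) (f₃ v)) h₁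
    (bind₂ (g := fun u y z => g u.1 u.2 y z) h₂.weaken h₃.weaken hg)

/-- The list is fixed, so this is a bounded number of concatenations built into the program and not
a loop over the input. -/
theorem flatMap_const {ι : Type} (l : List ι) {f : ι → α → Word} (hf : ∀ i, Poly (f i)) :
    Poly (fun v => l.flatMap fun i => f i v) := by
  induction l with
  | nil => exact nil
  | cons i l ih => exact append (hf i) ih

end Poly

/-! ### Words with fields -/

/-- The initial segment of a word up to the first delimiter. -/
def field (w : Word) : Word := w.takeWhile (fun c => decide (c ≠ .delim))

/-- The part of a word after the first delimiter. -/
def rest (w : Word) : Word := (w.dropWhile (fun c => decide (c ≠ .delim))).tail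

/-- The symbols that occur in the names of individuals and of elements of the universal model. -/
def Sym.plain : Sym → Prop
  | .bit _ => True
  | .top => True
  | .bot => True
  | .atom => True
  | .inter => True
  | .union => True
  | _ => False

def Plain (w : Word) : Prop := ∀ c ∈ w, c.plain

def bits (a : Name) : Word := a.map Sym.bit

theorem encodeName_eq (a : Name) : encodeName a = bits a ++ [.delim] := rfl

theorem plain_bits (a : Name) : Plain (bits a) := by
  intro c hc
  obtain ⟨b, -, rfl⟩ := List.mem_map.1 hc
  trivial

theorem bits_injective : Function.Injective bits :=
  List.map_injective_iff.2 fun a b h => by simpa using h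

theorem Plain.notMem {w : Word} (hw : Plain w) {c : Sym} (hc : ¬ c.plain) : c ∉ w :=
  fun h => hc (hw c h)

theorem field_append {x : Word} (hx : Plain x) (w : Word) : field (x ++ .delim :: w) = x := by
  unfold field
  rw [List.takeWhile_append_of_pos]
  · simp
  · intro c hc
    have := hx c hc
    rcases c <;> simp_all [Sym.plain]

theorem rest_append {x : Word} (hx : Plain x) (w : Word) : rest (x ++ .delim :: w) = w := by
  unfold rest
  rw [List.dropWhile_append_of_pos]
  · simp
  · intro c hc
    have := hx c hc
    rcases c <;> simp_all [Sym.plain]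

def entry (c : Sym) (x : Word) : Word := c :: (x ++ [.delim])

def rawConcept (A x : Word) : Word := .conceptAssertion :: (A ++ .delim :: (x ++ [.delim]))

def rawRole (r x y : Word) : Word :=
  .roleAssertion :: (r ++ .delim :: (x ++ .delim :: (y ++ [.delim])))

theorem forSuffix_skip {f : Word → Word} {u : Word} (hu : ∀ c ∈ u, ∀ w, f (c :: w) = [])
    (w : Word) : forSuffix f (u ++ w) = forSuffix f w := by
  induction u with
  | nil => rfl
  | cons c u ih =>
    rw [List.cons_append, forSuffix, hu c (by simp), List.nil_append,
      ih fun c hc => hu c (by simp [hc])]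

/-- Apply `f` to the fields after the occurrences of `c`. -/
def forEntry (c : Sym) (f : Word → Word) (w : Word) : Word :=
  forSuffix (fun s => if s.head? = some c then f (field s.tail) else []) w

theorem forEntry_skip {c : Sym} {f : Word → Word} {u : Word} (hu : c ∉ u) (w : Word) :
    forEntry c f (u ++ w) = forEntry c f w := by
  refine forSuffix_skip (fun d hd w => ?_) w
  have : d ≠ c := fun h => hu (h ▸ hd)
  simp [this]

theorem forEntry_nil (c : Sym) (f : Word → Word) : forEntry c f [] = [] := rfl

/-- The marker `c` does not occur inside the entry, so the suffixes that begin there contribute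
nothing. -/
theorem forEntry_entry {c : Sym} (hc : ¬ c.plain) (hc' : c ≠ .delim) {f : Word → Word} {x : Word}
    (hx : Plain x) (w : Word) : forEntry c f (entry c x ++ w) = f x ++ forEntry c f w := by
  have h : forEntry c f (c :: (x ++ [.delim] ++ w)) =
      (if (c :: (x ++ [.delim] ++ w)).head? = some c then f (field (x ++ [.delim] ++ w)) else []) ++
        forEntry c f (x ++ [.delim] ++ w) := rfl
  rw [entry, List.cons_append, h, forEntry_skip (by simp [hx.notMem hc, hc'])]
  simp [field_append hx]

theorem forEntry_flatMap {c : Sym} (hc : ¬ c.plain) (hc' : c ≠ .delim) {f : Word → Word}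
    {ι : Type} {l : List ι} {x : ι → Word} (hx : ∀ i, Plain (x i)) (w : Word) :
    forEntry c f ((l.flatMap fun i => entry c (x i)) ++ w) =
      (l.flatMap fun i => f (x i)) ++ forEntry c f w := by
  induction l with
  | nil => rfl
  | cons i l ih =>
    rw [List.flatMap_cons, List.flatMap_cons, List.append_assoc, forEntry_entry hc hc' (hx i), ih,
      List.append_assoc]

/-- Apply `f` and `g` to the fields of concept and role assertions. -/
def forAssertion (f : Word → Word → Word) (g : Word → Word → Word → Word) (w : Word) : Word :=
  forSuffix (fun s => if s.head? = some .conceptAssertion then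
      f (field s.tail) (field (rest s.tail))
    else if s.head? = some .roleAssertion then
      g (field s.tail) (field (rest s.tail)) (field (rest (rest s.tail)))
    else []) w

section

variable {f : Word → Word → Word} {g : Word → Word → Word → Word}

theorem forAssertion_skip {u : Word} (h₁ : Sym.conceptAssertion ∉ u)
    (h₂ : Sym.roleAssertion ∉ u) (w : Word) :
    forAssertion f g (u ++ w) = forAssertion f g w := by
  refine forSuffix_skip (fun d hd w => ?_) w
  have h₁ : d ≠ .conceptAssertion := fun h => h₁ (h ▸ hd)
  have h₂ : d ≠ .roleAssertion := fun h => h₂ (h ▸ hd)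
  simp [h₁, h₂]

theorem forAssertion_rawConcept {A x : Word} (hA : Plain A) (hx : Plain x) (w : Word) :
    forAssertion f g (rawConcept A x ++ w) = f A x ++ forAssertion f g w := by
  have h : forAssertion f g (rawConcept A x ++ w) =
      f (field (A ++ .delim :: (x ++ [.delim]) ++ w))
        (field (rest (A ++ .delim :: (x ++ [.delim]) ++ w))) ++
      forAssertion f g (A ++ .delim :: (x ++ [.delim]) ++ w) := rfl
  rw [h, forAssertion_skip]
  · simp [field_append hA, rest_append hA, field_append hx]
  · simp [hA.notMem (c := .conceptAssertion) id, hx.notMem (c := .conceptAssertion) id]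
  · simp [hA.notMem (c := .roleAssertion) id, hx.notMem (c := .roleAssertion) id]

theorem forAssertion_rawRole {r x y : Word} (hr : Plain r) (hx : Plain x) (hy : Plain y)
    (w : Word) : forAssertion f g (rawRole r x y ++ w) = g r x y ++ forAssertion f g w := by
  have h : forAssertion f g (rawRole r x y ++ w) =
      g (field (r ++ .delim :: (x ++ .delim :: (y ++ [.delim])) ++ w))
        (field (rest (r ++ .delim :: (x ++ .delim :: (y ++ [.delim])) ++ w)))
        (field (rest (rest (r ++ .delim :: (x ++ .delim :: (y ++ [.delim])) ++ w)))) ++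
      forAssertion f g (r ++ .delim :: (x ++ .delim :: (y ++ [.delim])) ++ w) := rfl
  rw [h, forAssertion_skip]
  · simp [field_append hr, rest_append hr, field_append hx, rest_append hx, field_append hy]
  · simp [hr.notMem (c := .conceptAssertion) id, hx.notMem (c := .conceptAssertion) id,
      hy.notMem (c := .conceptAssertion) id]
  · simp [hr.notMem (c := .roleAssertion) id, hx.notMem (c := .roleAssertion) id,
      hy.notMem (c := .roleAssertion) id]

theorem Assertion.encode_concept (A a : Name) :
    (Assertion.concept A a).encode = rawConcept (bits A) (bits a) := by
  simp [Assertion.encode, rawConcept, encodeName_eq]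

theorem Assertion.encode_role (r a b : Name) :
    (Assertion.role r a b).encode = rawRole (bits r) (bits a) (bits b) := by
  simp [Assertion.encode, rawRole, encodeName_eq]

theorem forAssertion_encode (l : List Assertion) :
    forAssertion f g (l.flatMap Assertion.encode) = l.flatMap fun
      | .concept A a => f (bits A) (bits a)
      | .role r a b => g (bits r) (bits a) (bits b) := by
  induction l with
  | nil => rfl
  | cons α l ih =>
    rw [List.flatMap_cons, List.flatMap_cons]
    rcases α with ⟨A, a⟩ | ⟨r, a, b⟩
    · rw [Assertion.encode_concept,
        forAssertion_rawConcept (plain_bits A) (plain_bits a), ih]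
    · rw [Assertion.encode_role,
        forAssertion_rawRole (plain_bits r) (plain_bits a) (plain_bits b), ih]

end

/-- A nonempty word if `p` occurs in `w`, and the empty word otherwise. -/
noncomputable def occurs (p w : Word) : Word := forSuffix (fun s => flag (p <+: s)) w

theorem flag_ne_nil {p : Prop} : flag p ≠ [] ↔ p := by
  unfold flag; split_ifs <;> simp_all

theorem occurs_skip {c : Sym} {p u : Word} (hu : c ∉ u) (w : Word) :
    occurs (c :: p) (u ++ w) = occurs (c :: p) w := by
  refine forSuffix_skip (fun d hd w => ?_) w
  have : c ≠ d := fun h => hu (h ▸ hd)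
  by_contra h
  exact this (List.cons_prefix_cons.1 (flag_ne_nil.1 h)).1

/-- A match must start with `c`, which does not occur in `u`; it therefore starts at `d` or inside
`w`. -/
theorem occurs_cons {c d : Sym} {p u w : Word} (hu : c ∉ u) :
    occurs (c :: p) (d :: u ++ w) ≠ [] ↔
      (c = d ∧ p <+: u ++ w) ∨ occurs (c :: p) w ≠ [] := by
  have h : occurs (c :: p) (d :: u ++ w) =
    flag (c :: p <+: d :: (u ++ w)) ++ occurs (c :: p) (u ++ w) := rfl
  rw [h, occurs_skip hu, Ne, List.append_eq_nil_iff, not_and_or]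
  exact or_congr (flag_ne_nil.trans List.cons_prefix_cons) Iff.rfl

/-- The delimiter ends a field, so a prefix test on delimited fields is a test for equality. This
turns the search for a word into the search for an assertion. -/
theorem prefix_field {x y : Word} (hx : Plain x) (hy : Plain y) {u w : Word} :
    x ++ .delim :: u <+: y ++ .delim :: w ↔ x = y ∧ u <+: w := by
  constructor
  · rintro ⟨t, ht⟩
    have h₁ := congrArg field ht
    have h₂ := congrArg rest ht
    rw [List.append_assoc, List.cons_append, field_append hx, field_append hy] at h₁
    rw [List.append_assoc, List.cons_append, rest_append hx, rest_append hy] at h₂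
    exact ⟨h₁, t, h₂⟩
  · rintro ⟨rfl, t, rfl⟩
    exact ⟨t, by simp⟩

theorem occurs_rawConcept {A x B y : Word} (hA : Plain A) (hx : Plain x) (hB : Plain B)
    (hy : Plain y) (w : Word) : occurs (rawConcept A x) (rawConcept B y ++ w) ≠ [] ↔
      (A = B ∧ x = y) ∨ occurs (rawConcept A x) w ≠ [] := by
  unfold rawConcept
  rw [occurs_cons]
  · simp only [List.append_assoc, List.cons_append, List.nil_append, true_and]
    rw [prefix_field hA hB, prefix_field hx hy]
    simp
  · simp [hB.notMem (c := .conceptAssertion) id, hy.notMem (c := .conceptAssertion) id]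

theorem occurs_rawConcept_rawRole {A x r y z : Word} (hr : Plain r) (hy : Plain y)
    (hz : Plain z) (w : Word) : occurs (rawConcept A x) (rawRole r y z ++ w) =
      occurs (rawConcept A x) w := by
  unfold rawConcept rawRole
  exact occurs_skip (by simp [hr.notMem (c := .conceptAssertion) id,
    hy.notMem (c := .conceptAssertion) id, hz.notMem (c := .conceptAssertion) id]) w

theorem occurs_rawRole {r x y s z t : Word} (hr : Plain r) (hx : Plain x) (hy : Plain y)
    (hs : Plain s) (hz : Plain z) (ht : Plain t) (w : Word) :
    occurs (rawRole r x y) (rawRole s z t ++ w) ≠ [] ↔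
      (r = s ∧ x = z ∧ y = t) ∨ occurs (rawRole r x y) w ≠ [] := by
  unfold rawRole
  rw [occurs_cons]
  · simp only [List.append_assoc, List.cons_append, List.nil_append, true_and]
    rw [prefix_field hr hs, prefix_field hx hz, prefix_field hy ht]
    simp
  · simp [hs.notMem (c := .roleAssertion) id, hz.notMem (c := .roleAssertion) id,
      ht.notMem (c := .roleAssertion) id]

theorem occurs_rawRole_rawConcept {r x y A z : Word} (hA : Plain A) (hz : Plain z) (w : Word) :
    occurs (rawRole r x y) (rawConcept A z ++ w) = occurs (rawRole r x y) w := by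
  unfold rawConcept rawRole
  exact occurs_skip (by simp [hA.notMem (c := .roleAssertion) id,
    hz.notMem (c := .roleAssertion) id]) w

/-- A nonempty word if `x` is the encoding of a member of `l`. -/
noncomputable def memWord (l : List Name) (x : Word) : Word :=
  l.flatMap fun c => flag (x ++ [.delim] <+: bits c ++ [.delim])

theorem memWord_bits {l : List Name} {a : Name} : (memWord l (bits a)).head? = none ↔ a ∉ l := by
  rw [List.head?_eq_none_iff, ← not_iff_not, not_not, memWord]
  simp only [List.flatMap_eq_nil_iff, not_forall]
  constructor
  · rintro ⟨c, hc, h⟩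
    have := ((prefix_field (plain_bits a) (plain_bits c)).1 (flag_ne_nil.1 h)).1
    rwa [bits_injective this]
  · intro h
    refine ⟨a, h, flag_ne_nil.2 List.prefix_rfl⟩

/-! ### Operations on fields in polynomial time -/

namespace Poly

variable {α : Type} [Ctx α]

theorem field {f : α → Word} (hf : Poly f) : Poly (fun v => field (f v)) := hf.takeWhile _

theorem rest {f : α → Word} (hf : Poly f) : Poly (fun v => rest (f v)) := (hf.dropWhile _).tail

theorem entry (c : Sym) {f : α → Word} (hf : Poly f) : Poly (fun v => entry c (f v)) :=
  (hf.append (const [.delim])).cons c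

theorem rawConcept {f g : α → Word} (hf : Poly f) (hg : Poly g) :
    Poly (fun v => rawConcept (f v) (g v)) :=
  (hf.append ((hg.append (const [.delim])).cons .delim)).cons .conceptAssertion

theorem rawRole {f g h : α → Word} (hf : Poly f) (hg : Poly g) (hh : Poly h) :
    Poly (fun v => rawRole (f v) (g v) (h v)) :=
  (hf.append ((hg.append ((hh.append (const [.delim])).cons .delim)).cons .delim)).cons
    .roleAssertion

theorem forEntry (c : Sym) {f : α → Word} {g : α → Word → Word} (hf : Poly f)
    (hg : Poly (fun v : α × Word => g v.1 v.2)) : Poly (fun v => forEntry c (g v) (f v)) := by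
  refine forSuffix (g := fun v s => if s.head? = some c then g v (DL.field s.tail) else []) hf
    (ite_head _ last ?_ nil)
  refine bind (f := fun v : α × Word => DL.field v.2.tail) (g := fun v x => g v.1 x)
    last.tail.field ?_
  refine hg.rename (fun u : (α × Word) × Word => (u.1.1, u.2)) fun X hX => ?_
  rcases mem_vars_snoc.1 hX with ⟨Y, hY, rfl⟩ | rfl
  · exact fst_mem_vars (fst_mem_vars hY)
  · exact snd_mem_vars

theorem forAssertion {f : α → Word} {g : α → Word → Word → Word}
    {h : α → Word → Word → Word → Word} (hf : Poly f)
    (hg : Poly (fun v : (α × Word) × Word => g v.1.1 v.1.2 v.2))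
    (hh : Poly (fun v : ((α × Word) × Word) × Word => h v.1.1.1 v.1.1.2 v.1.2 v.2)) :
    Poly (fun v => forAssertion (g v) (h v) (f v)) := by
  refine forSuffix (g := fun v s => if s.head? = some .conceptAssertion then
      g v (DL.field s.tail) (DL.field (DL.rest s.tail))
    else if s.head? = some .roleAssertion then
      h v (DL.field s.tail) (DL.field (DL.rest s.tail)) (DL.field (DL.rest (DL.rest s.tail)))
    else []) hf (ite_head _ last ?_ (ite_head _ last ?_ nil))
  · refine bind₂ (g := fun (v : α × Word) x y => g v.1 x y) last.tail.field last.tail.rest.field ?_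
    refine hg.rename (fun u : ((α × Word) × Word) × Word => ((u.1.1.1, u.1.2), u.2)) fun X hX => ?_
    rcases mem_vars_snoc.1 hX with ⟨Y, hY, rfl⟩ | rfl
    · rcases mem_vars_snoc.1 hY with ⟨Z, hZ, rfl⟩ | rfl
      · exact fst_mem_vars (fst_mem_vars (fst_mem_vars hZ))
      · exact fst_mem_vars snd_mem_vars
    · exact snd_mem_vars
  · refine bind₃ (g := fun (v : α × Word) x y z => h v.1 x y z) last.tail.field
      last.tail.rest.field last.tail.rest.rest.field ?_
    refine hh.rename (fun u : (((α × Word) × Word) × Word) × Word =>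
      (((u.1.1.1.1, u.1.1.2), u.1.2), u.2)) fun X hX => ?_
    rcases mem_vars_snoc.1 hX with ⟨Y, hY, rfl⟩ | rfl
    · rcases mem_vars_snoc.1 hY with ⟨Z, hZ, rfl⟩ | rfl
      · rcases mem_vars_snoc.1 hZ with ⟨T, hT, rfl⟩ | rfl
        · exact fst_mem_vars (fst_mem_vars (fst_mem_vars (fst_mem_vars hT)))
        · exact fst_mem_vars (fst_mem_vars snd_mem_vars)
      · exact fst_mem_vars snd_mem_vars
    · exact snd_mem_vars

theorem occurs {f g : α → Word} (hf : Poly f) (hg : Poly g) :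
    Poly (fun v => occurs (f v) (g v)) :=
  forSuffix (g := fun v s => flag (f v <+: s)) hg (hf.weaken.isPrefix last)

theorem memWord (l : List Name) {f : α → Word} (hf : Poly f) :
    Poly (fun v => memWord l (f v)) :=
  flatMap_const l fun _ => (hf.append (const _)).isPrefix (const _)

end Poly

/-! ### Computing the universal model -/

/-- The tags are plain symbols other than bits: they may occur inside a field, yet no two elements
receive the same word. -/
def Elem.word : Elem → Word
  | .ind a => bits a
  | .succ a => bits a ++ [.top]
  | .full a => bits a ++ [.bot]
  | .leaf a => bits a ++ [.atom]
  | .own a => bits a ++ [.inter]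
  | .blank a => bits a ++ [.union]

theorem Elem.plain_word (x : Elem) : Plain x.word := by
  have key : ∀ (a : Name) (c : Sym), c.plain → Plain (bits a ++ [c]) := by
    intro a c hc d hd
    rcases List.mem_append.1 hd with hd | hd
    · exact plain_bits a d hd
    · rw [List.mem_singleton.1 hd]; exact hc
  cases x
  · exact plain_bits _
  all_goals exact key _ _ trivial

theorem Elem.word_injective : Function.Injective Elem.word := by
  have h₁ : ∀ (a b : Name) (c : Sym), 2 ≤ c.code → bits a ≠ bits b ++ [c] := by
    intro a b c hc h
    have : c ∈ bits a := by rw [h]; simp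
    obtain ⟨i, -, rfl⟩ := List.mem_map.1 this
    cases i <;> simp [Sym.code] at hc
  have h₂ : ∀ (a b : Name) (c d : Sym), bits a ++ [c] = bits b ++ [d] → a = b ∧ c = d := by
    intro a b c d h
    obtain ⟨h, h'⟩ := List.append_inj' h rfl
    exact ⟨bits_injective h, by simpa using h'⟩
  intro x y h
  cases x <;> cases y <;> simp only [Elem.word] at h <;>
    first
    | rw [bits_injective h]
    | rw [(h₂ _ _ _ _ h).1]; done
    | exact absurd (h₂ _ _ _ _ h).2 (by simp)
    | exact absurd h (h₁ _ _ _ (by simp [Sym.code]))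
    | exact absurd h.symm (h₁ _ _ _ (by simp [Sym.code]))

def Fact.encode : Fact → Word
  | .concept A x => rawConcept (bits A) x.word
  | .role r x y => rawRole (bits r) x.word y.word

theorem occurs_encode_concept {l : List Fact} {A : Name} {x : Elem} :
    occurs (rawConcept (bits A) x.word) (l.flatMap Fact.encode) ≠ [] ↔ .concept A x ∈ l := by
  induction l with
  | nil => simp [occurs, forSuffix]
  | cons f l ih =>
    rw [List.flatMap_cons]
    rcases f with ⟨B, y⟩ | ⟨r, y, z⟩
    · rw [Fact.encode, occurs_rawConcept (plain_bits _) x.plain_word (plain_bits _) y.plain_word,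
        ih, bits_injective.eq_iff, Elem.word_injective.eq_iff]
      simp
    · rw [Fact.encode, occurs_rawConcept_rawRole (plain_bits _) y.plain_word z.plain_word, ih]
      simp

theorem occurs_encode_role {l : List Fact} {r : Name} {x y : Elem} :
    occurs (rawRole (bits r) x.word y.word) (l.flatMap Fact.encode) ≠ [] ↔ .role r x y ∈ l := by
  induction l with
  | nil => simp [occurs, forSuffix]
  | cons f l ih =>
    rw [List.flatMap_cons]
    rcases f with ⟨B, z⟩ | ⟨s, z, t⟩
    · rw [Fact.encode, occurs_rawRole_rawConcept (plain_bits _) z.plain_word, ih]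
      simp
    · rw [Fact.encode, occurs_rawRole (plain_bits _) x.plain_word y.plain_word (plain_bits _)
        z.plain_word t.plain_word, ih, bits_injective.eq_iff, Elem.word_injective.eq_iff,
        Elem.word_injective.eq_iff]
      simp

def Fact.elems : Fact → List Elem
  | .concept _ x => [x]
  | .role _ x y => [x, y]

/-- The elements occurring in a list of encoded facts. -/
def elemsWord (w : Word) : Word :=
  forAssertion (fun _ x => entry .answer x) (fun _ x y => entry .answer x ++ entry .answer y) w

theorem elemsWord_encode (l : List Fact) : elemsWord (l.flatMap Fact.encode) =
    (l.flatMap Fact.elems).flatMap fun x => entry .answer x.word := by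
  unfold elemsWord
  induction l with
  | nil => rfl
  | cons f l ih =>
    rw [List.flatMap_cons, List.flatMap_cons, List.flatMap_append]
    rcases f with ⟨B, x⟩ | ⟨s, x, y⟩
    · rw [Fact.encode, forAssertion_rawConcept (plain_bits _) x.plain_word, ih]
      simp [Fact.elems]
    · rw [Fact.encode, forAssertion_rawRole (plain_bits _) x.plain_word y.plain_word, ih]
      simp [Fact.elems]

namespace Template

variable (ℬ : Template)

def colorWord (x : Word) : Word := ℬ.inds.flatMap fun d => rawConcept (bits (ℬ.color d)) x

def treeWord (a : Word) : Word :=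
  rawRole (bits ℬ.roleR) a (a ++ [.top]) ++
    (rawRole (bits ℬ.roleS) (a ++ [.top]) (a ++ [.bot]) ++ ℬ.colorWord (a ++ [.bot]))

def leavesWord (b : Word) : Word :=
  rawRole (bits ℬ.roleS) b (b ++ [.atom]) ++ ℬ.colorWord (b ++ [.atom])

noncomputable def universalWord (w : Word) : Word :=
  forAssertion
    (fun A a => rawConcept A a ++
      if (memWord ℬ.sig.concepts A).head? = none then [] else ℬ.treeWord a)
    (fun r a b => rawRole r a b ++
      ((if (memWord ℬ.sig.roles r).head? = none then [] else ℬ.treeWord a ++ ℬ.treeWord b) ++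
        if (memWord [ℬ.roleR] r).head? = none then [] else ℬ.leavesWord b)) w

theorem flatMap_colorFacts (x : Elem) :
    (ℬ.colorFacts x).flatMap Fact.encode = ℬ.colorWord x.word := by
  simp [colorFacts, colorWord, List.flatMap_map, Fact.encode]

theorem flatMap_tree (a : Name) : (ℬ.tree a).flatMap Fact.encode = ℬ.treeWord (bits a) := by
  simp [tree, treeWord, flatMap_colorFacts, Fact.encode, Elem.word]

theorem flatMap_leaves (b : Name) : (ℬ.leaves b).flatMap Fact.encode = ℬ.leavesWord (bits b) := by
  simp [leaves, leavesWord, flatMap_colorFacts, Fact.encode, Elem.word]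

/-- The prefix `u` stands for the encoded answer tuple of a query instance, which contains no
assertion markers and is skipped. -/
theorem universalWord_encode (𝒜 : ABox) {u : Word} (h₁ : Sym.conceptAssertion ∉ u)
    (h₂ : Sym.roleAssertion ∉ u) :
    ℬ.universalWord (u ++ 𝒜.encode) = (ℬ.universal 𝒜).flatMap Fact.encode := by
  rw [universalWord, forAssertion_skip h₁ h₂, ABox.encode, forAssertion_encode, universal,
    List.flatMap_assoc]
  congr 1
  funext α
  rcases α with ⟨A, a⟩ | ⟨r, a, b⟩
  · simp only [expand, memWord_bits, List.flatMap_cons, Fact.encode, Elem.word]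
    by_cases hA : A ∈ ℬ.sig.concepts <;> simp [hA, flatMap_tree]
  · simp only [expand, memWord_bits, List.flatMap_cons, Fact.encode, Elem.word,
      List.flatMap_append]
    by_cases hr' : r = ℬ.roleR
    · subst hr'
      by_cases hr : ℬ.roleR ∈ ℬ.sig.roles <;> simp [hr, flatMap_tree, flatMap_leaves]
    · by_cases hr : r ∈ ℬ.sig.roles <;> simp [hr, hr', flatMap_tree]

end Template

namespace Poly

variable {α : Type} [Ctx α]

theorem elemsWord {f : α → Word} (hf : Poly f) : Poly (fun v => elemsWord (f v)) :=
  forAssertion (g := fun _ _ x => DL.entry .answer x)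
    (h := fun _ _ x y => DL.entry .answer x ++ DL.entry .answer y) hf (last.entry _)
    ((last.weaken.entry _).append (last.entry _))

theorem colorWord (ℬ : Template) {f : α → Word} (hf : Poly f) :
    Poly (fun v => ℬ.colorWord (f v)) :=
  flatMap_const _ fun _ => (const _).rawConcept hf

theorem treeWord (ℬ : Template) {f : α → Word} (hf : Poly f) :
    Poly (fun v => ℬ.treeWord (f v)) :=
  ((const _).rawRole hf (hf.append (const _))).append
    (((const _).rawRole (hf.append (const _)) (hf.append (const _))).append
      ((hf.append (const _)).colorWord ℬ))

theorem leavesWord (ℬ : Template) {f : α → Word} (hf : Poly f) :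
    Poly (fun v => ℬ.leavesWord (f v)) :=
  ((const _).rawRole hf (hf.append (const _))).append ((hf.append (const _)).colorWord ℬ)

theorem universalWord (ℬ : Template) {f : α → Word} (hf : Poly f) :
    Poly (fun v => ℬ.universalWord (f v)) :=
  forAssertion
    (g := fun _ A a => DL.rawConcept A a ++
      if (DL.memWord ℬ.sig.concepts A).head? = none then [] else ℬ.treeWord a)
    (h := fun _ r a b => DL.rawRole r a b ++
      ((if (DL.memWord ℬ.sig.roles r).head? = none then [] else ℬ.treeWord a ++ ℬ.treeWord b) ++
        if (DL.memWord [ℬ.roleR] r).head? = none then [] else ℬ.leavesWord b))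
    hf
    ((last.weaken.rawConcept last).append
      (ite_head _ (last.weaken.memWord _) nil (last.treeWord ℬ)))
    ((last.weaken.weaken.rawRole last.weaken last).append
      ((ite_head _ (last.weaken.weaken.memWord _) nil
          ((last.weaken.treeWord ℬ).append (last.treeWord ℬ))).append
        (ite_head _ (last.weaken.weaken.memWord _) nil (last.leavesWord ℬ))))

end Poly

/-! ### Evaluating queries -/

/-- Evaluation of a query in a list `F` of encoded facts with the list `E` of elements; the value is
nonempty if the query holds. -/
noncomputable def evalWord (F E : Word) : {n : ℕ} → PEQ n → (Fin n → Word) → Word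
  | _, .concept A x, xs => occurs (rawConcept (bits A) (xs x)) F
  | _, .role r x y, xs => occurs (rawRole (bits r) (xs x) (xs y)) F
  | _, .and p q, xs => if (evalWord F E p xs).head? = none then [] else evalWord F E q xs
  | _, .or p q, xs => evalWord F E p xs ++ evalWord F E q xs
  | _, .ex q, xs => forEntry .answer (fun x => evalWord F E q (Fin.snoc xs x)) E

/-- The context is quantified inside the induction because each quantifier of the query adds a
variable. The query is fixed, so the nesting depth of the loops is fixed too. -/
theorem Poly.evalWord {n : ℕ} (q : PEQ n) : ∀ {α : Type} [Ctx α] {F E : α → Word}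
    {xs : α → Fin n → Word}, Poly F → Poly E → (∀ i, Poly (fun v => xs v i)) →
      Poly (fun v => evalWord (F v) (E v) q (xs v)) := by
  induction q with
  | concept A x =>
    intro α _ F E xs hF hE hx
    exact ((const _).rawConcept (hx x)).occurs hF
  | role r x y =>
    intro α _ F E xs hF hE hx
    exact ((const _).rawRole (hx x) (hx y)).occurs hF
  | and p q hp hq =>
    intro α _ F E xs hF hE hx
    exact ite_head _ (hp hF hE hx) nil (hq hF hE hx)
  | or p q hp hq =>
    intro α _ F E xs hF hE hx
    exact (hp hF hE hx).append (hq hF hE hx)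
  | @ex n q ih =>
    intro α _ F E xs hF hE hx
    refine forEntry _ (g := fun v x => DL.evalWord (F v) (E v) q (Fin.snoc (xs v) x)) hE ?_
    refine ih (xs := fun v : α × Word => Fin.snoc (xs v.1) v.2) hF.weaken hE.weaken fun i => ?_
    refine Fin.lastCases ?_ (fun i => ?_) i
    · simpa using last
    · simpa using (hx i).weaken

/-- Nonempty words stand for truth, so concatenation computes disjunctions and existential
quantifiers. Quantifiers range only over elements that occur in facts; this is enough because the
whole domain retracts onto these elements. -/
theorem evalWord_iff {l : List Fact} (hl : l ≠ []) {n : ℕ} (q : PEQ n) :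
    ∀ π : Fin n → Elem, (∀ i, π i ∈ l.flatMap Fact.elems) →
      (evalWord (l.flatMap Fact.encode) (elemsWord (l.flatMap Fact.encode)) q
        (fun i => (π i).word) ≠ [] ↔ (interp {f | f ∈ l}).Holds q π) := by
  induction q with
  | concept A x => exact fun π _ => occurs_encode_concept
  | role r x y => exact fun π _ => occurs_encode_role
  | and p q hp hq =>
    intro π hπ
    change _ ↔ (interp {f | f ∈ l}).Holds p π ∧ (interp {f | f ∈ l}).Holds q π
    rw [evalWord, ← hp π hπ, ← hq π hπ]
    simp only [List.head?_eq_none_iff]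
    split_ifs with h <;> simp [h]
  | or p q hp hq =>
    intro π hπ
    change _ ↔ (interp {f | f ∈ l}).Holds p π ∨ (interp {f | f ∈ l}).Holds q π
    rw [evalWord, ← hp π hπ, ← hq π hπ, Ne, List.append_eq_nil_iff,
      not_and_or]
  | @ex n q ih =>
    intro π hπ
    have hword : ∀ x : Elem, (Fin.snoc (fun i => (π i).word) x.word : Fin (n + 1) → Word) =
        fun i => ((Fin.snoc π x : Fin (n + 1) → Elem) i).word := by
      intro x
      funext i
      refine Fin.lastCases ?_ (fun i => ?_) i <;> simp
    have hE := forEntry_flatMap (c := .answer) id (by simp) (f := fun x =>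
      evalWord (l.flatMap Fact.encode) (elemsWord (l.flatMap Fact.encode)) q
        (Fin.snoc (fun i => (π i).word) x)) (l := l.flatMap Fact.elems) Elem.plain_word []
    rw [List.append_nil, forEntry_nil, List.append_nil] at hE
    have hmem : ∀ x ∈ l.flatMap Fact.elems, ∀ i,
        (Fin.snoc π x : Fin (n + 1) → Elem) i ∈ l.flatMap Fact.elems := by
      intro x hx i
      refine Fin.lastCases ?_ (fun i => ?_) i
      · simpa using hx
      · simpa using hπ i
    have hiff : evalWord (l.flatMap Fact.encode) (elemsWord (l.flatMap Fact.encode)) (.ex q)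
        (fun i => (π i).word) ≠ [] ↔
        ∃ x ∈ l.flatMap Fact.elems, (interp {f | f ∈ l}).Holds q (Fin.snoc π x) := by
      rw [evalWord, show elemsWord (l.flatMap Fact.encode) = _ from elemsWord_encode l] at *
      rw [hE]
      simp only [ne_eq, List.flatMap_eq_nil_iff, not_forall, exists_prop]
      refine exists_congr fun x => and_congr_right fun hx => ?_
      rw [hword x]
      exact ih _ (hmem x hx)
    rw [hiff]
    constructor
    · rintro ⟨x, -, hx⟩
      exact ⟨x, hx⟩
    · rintro ⟨(x : Elem), hx⟩
      obtain ⟨x₀, hx₀⟩ : ∃ x₀, x₀ ∈ l.flatMap Fact.elems := by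
        obtain ⟨f, l, rfl⟩ := List.exists_cons_of_ne_nil hl
        rcases f with ⟨A, y⟩ | ⟨r, y, z⟩ <;> exact ⟨y, by simp [Fact.elems]⟩
      classical
      -- A witness that occurs in no fact is replaced by `x₀`. The map preserves facts because it
      -- fixes every element that occurs in one.
      let g : Elem → Elem := fun y => if y ∈ l.flatMap Fact.elems then y else x₀
      have hg : ∀ y ∈ l.flatMap Fact.elems, g y = y := fun y hy => if_pos hy
      have hgx : g x ∈ l.flatMap Fact.elems := by
        by_cases h : x ∈ l.flatMap Fact.elems
        · rwa [hg x h]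
        · rwa [show g x = x₀ from if_neg h]
      refine ⟨g x, hgx, ?_⟩
      have := Interpretation.Holds.map (J := interp {f | f ∈ l}) g ?_ ?_ hx
      · have hcomp : g ∘ (Fin.snoc π x : Fin (n + 1) → Elem) = Fin.snoc π (g x) := by
          rw [Fin.comp_snoc]
          congr 1
          funext i
          exact hg _ (hπ i)
        exact hcomp ▸ this
      · intro A (y : Elem) hy
        rw [hg y (List.mem_flatMap.2 ⟨.concept A y, hy, by simp [Fact.elems]⟩)]
        exact hy
      · intro r (y : Elem) (z : Elem) hyz
        rw [hg y (List.mem_flatMap.2 ⟨.role r y z, hyz, by simp [Fact.elems]⟩),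
          hg z (List.mem_flatMap.2 ⟨.role r y z, hyz, by simp [Fact.elems]⟩)]
        exact hyz

end DL


namespace DL

/-! ### Computing the TBox -/

/-- A block of ones of the same length as `w`. -/
def freshWord (w : Word) : Word := forSuffix (fun _ => [.bit true]) w

theorem freshWord_eq (w : Word) : freshWord w = bits (List.replicate w.length true) := by
  induction w with
  | nil => rfl
  | cons c w ih =>
    rw [List.length_cons, List.replicate_succ]
    exact congrArg (Sym.bit true :: ·) ih

def colorNameWord (P d : Word) : Word := .atom :: .bit true :: (P ++ (d ++ [.delim]))

def hiddenWord (P d : Word) : Word :=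
  .ex :: (P ++ .delim :: .all :: .bit true :: (P ++ .delim :: colorNameWord P d))

/-- Concepts are encoded in prefix notation, so an iterated union is a concatenation of blocks
closed by the innermost `bot`. -/
def covWord (P D : Word) : Word := forEntry .answer (fun d => .union :: hiddenWord P d) D ++ [.bot]

def allColorsWord (P D : Word) : Word :=
  forEntry .answer (fun d => .inter :: colorNameWord P d) D ++ [.top]

noncomputable def conceptAxiomsWord (P D w : Word) : Word :=
  forEntry .conceptName (fun A => forEntry .answer (fun d =>
    if (occurs (rawConcept A d) w).head? = none then
      .incl :: .inter :: .atom :: (A ++ .delim :: (hiddenWord P d ++ [.bot]))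
    else []) D) w

noncomputable def roleAxiomsWord (P D w : Word) : Word :=
  forEntry .roleName (fun r => forEntry .answer (fun d => forEntry .answer (fun e =>
    if (occurs (rawRole r d e) w).head? = none then
      .incl :: .inter :: (hiddenWord P d ++ .ex :: (r ++ .delim :: (hiddenWord P e ++ [.bot])))
    else []) D) D) w

noncomputable def tboxWord (P D w : Word) : Word :=
  forEntry .conceptName (fun A => .incl :: .atom :: (A ++ .delim :: covWord P D)) w ++
  (forEntry .roleName (fun r => .incl :: .ex :: (r ++ .delim :: .top :: covWord P D)) w ++
  (forEntry .roleName (fun r => .incl :: .top :: .all :: (r ++ .delim :: covWord P D)) w ++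
  (.incl :: .top :: .all :: (P ++ .delim :: .ex :: .bit true :: (P ++ .delim :: allColorsWord P D)) ++
  (conceptAxiomsWord P D w ++ roleAxiomsWord P D w))))

noncomputable def constructWord (w : Word) : Word :=
  freshWord w ++ .delim :: tboxWord (freshWord w) (elemsWord w) w

namespace Poly

variable {α : Type} [Ctx α]

theorem freshWord {f : α → Word} (hf : Poly f) : Poly (fun v => freshWord (f v)) :=
  forSuffix (g := fun _ _ => [.bit true]) hf (const _)

theorem colorNameWord {P d : α → Word} (hP : Poly P) (hd : Poly d) :
    Poly (fun v => colorNameWord (P v) (d v)) :=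
  ((hP.append (hd.append (const _))).cons _).cons _

theorem hiddenWord {P d : α → Word} (hP : Poly P) (hd : Poly d) :
    Poly (fun v => hiddenWord (P v) (d v)) :=
  (hP.append ((((hP.append ((hP.colorNameWord hd).cons _)).cons _).cons _).cons _)).cons _

theorem covWord {P D : α → Word} (hP : Poly P) (hD : Poly D) :
    Poly (fun v => covWord (P v) (D v)) :=
  (forEntry _ (g := fun v d => .union :: DL.hiddenWord (P v) d) hD
    ((hP.weaken.hiddenWord last).cons _)).append (const _)

theorem allColorsWord {P D : α → Word} (hP : Poly P) (hD : Poly D) :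
    Poly (fun v => allColorsWord (P v) (D v)) :=
  (forEntry _ (g := fun v d => .inter :: DL.colorNameWord (P v) d) hD
    ((hP.weaken.colorNameWord last).cons _)).append (const _)

theorem conceptAxiomsWord {P D w : α → Word} (hP : Poly P) (hD : Poly D) (hw : Poly w) :
    Poly (fun v => conceptAxiomsWord (P v) (D v) (w v)) := by
  refine forEntry _ (g := fun v A => DL.forEntry .answer (fun d =>
    if (DL.occurs (DL.rawConcept A d) (w v)).head? = none then
      .incl :: .inter :: .atom :: (A ++ .delim :: (DL.hiddenWord (P v) d ++ [.bot]))
    else []) (D v)) hw ?_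
  refine forEntry _ (g := fun (v : α × Word) d =>
    if (DL.occurs (DL.rawConcept v.2 d) (w v.1)).head? = none then
      .incl :: .inter :: .atom :: (v.2 ++ .delim :: (DL.hiddenWord (P v.1) d ++ [.bot]))
    else []) hD.weaken ?_
  exact ite_head _ ((last.weaken.rawConcept last).occurs hw.weaken.weaken)
    (((((last.weaken.append (((hP.weaken.weaken.hiddenWord last).append (const _)).cons _)).cons
      _)).cons _).cons _) nil

theorem roleAxiomsWord {P D w : α → Word} (hP : Poly P) (hD : Poly D) (hw : Poly w) :
    Poly (fun v => roleAxiomsWord (P v) (D v) (w v)) := by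
  refine forEntry _ (g := fun v r => DL.forEntry .answer (fun d => DL.forEntry .answer (fun e =>
    if (DL.occurs (DL.rawRole r d e) (w v)).head? = none then
      .incl :: .inter :: (DL.hiddenWord (P v) d ++
        .ex :: (r ++ .delim :: (DL.hiddenWord (P v) e ++ [.bot])))
    else []) (D v)) (D v)) hw ?_
  refine forEntry _ (g := fun (v : α × Word) d => DL.forEntry .answer (fun e =>
    if (DL.occurs (DL.rawRole v.2 d e) (w v.1)).head? = none then
      .incl :: .inter :: (DL.hiddenWord (P v.1) d ++
        .ex :: (v.2 ++ .delim :: (DL.hiddenWord (P v.1) e ++ [.bot])))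
    else []) (D v.1)) hD.weaken ?_
  refine forEntry _ (g := fun (v : (α × Word) × Word) e =>
    if (DL.occurs (DL.rawRole v.1.2 v.2 e) (w v.1.1)).head? = none then
      .incl :: .inter :: (DL.hiddenWord (P v.1.1) v.2 ++
        .ex :: (v.1.2 ++ .delim :: (DL.hiddenWord (P v.1.1) e ++ [.bot])))
    else []) hD.weaken.weaken ?_
  have hP' := hP.weaken.weaken.weaken
  exact ite_head _ ((last.weaken.weaken.rawRole last.weaken last).occurs hw.weaken.weaken.weaken)
    ((((hP'.hiddenWord last.weaken).append ((last.weaken.weaken.append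
      (((hP'.hiddenWord last).append (const _)).cons _)).cons _)).cons _).cons _) nil

theorem tboxWord {P D w : α → Word} (hP : Poly P) (hD : Poly D) (hw : Poly w) :
    Poly (fun v => tboxWord (P v) (D v) (w v)) := by
  have hcov := (hP.covWord hD).weaken
  refine append (forEntry _ (g := fun v A => .incl :: .atom ::
    (A ++ .delim :: DL.covWord (P v) (D v))) hw ?_) (append (forEntry _ (g := fun v r =>
    .incl :: .ex :: (r ++ .delim :: .top :: DL.covWord (P v) (D v))) hw ?_) (append
    (forEntry _ (g := fun v r => .incl :: .top :: .all ::
      (r ++ .delim :: DL.covWord (P v) (D v))) hw ?_) (append ?_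
    ((hP.conceptAxiomsWord hD hw).append (hP.roleAxiomsWord hD hw)))))
  · exact ((last.append (hcov.cons _)).cons _).cons _
  · exact ((last.append ((hcov.cons _).cons _)).cons _).cons _
  · exact (((last.append (hcov.cons _)).cons _).cons _).cons _
  · exact (((hP.append ((((hP.append ((hP.allColorsWord hD).cons _)).cons _).cons _).cons
      _)).cons _).cons _).cons _

theorem constructWord {f : α → Word} (hf : Poly f) : Poly (fun v => constructWord (f v)) :=
  hf.freshWord.append ((hf.freshWord.tboxWord hf.elemsWord hf).cons _)

end Poly

theorem notMem_encodeName {c : Sym} (hc : ¬ c.plain) (hc' : c ≠ .delim) (a : Name) :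
    c ∉ encodeName a := by
  simp [encodeName_eq, (plain_bits a).notMem hc, hc']

theorem notMem_abox_encode {c : Sym} (hc : ¬ c.plain) (h₁ : c ≠ .delim)
    (h₂ : c ≠ .conceptAssertion) (h₃ : c ≠ .roleAssertion) (𝒜 : ABox) : c ∉ 𝒜.encode := by
  intro h
  obtain ⟨α, -, h⟩ := List.mem_flatMap.1 h
  rcases α with ⟨A, a⟩ | ⟨r, a, b⟩ <;>
    simp [Assertion.encode, h₂, h₃, notMem_encodeName hc h₁] at h

theorem notMem_flatMap_encodeName {c d : Sym} (hc : ¬ c.plain) (h₁ : c ≠ .delim) (h₂ : c ≠ d)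
    (l : List Name) : c ∉ l.flatMap fun A => d :: encodeName A := by
  simp [h₂, notMem_encodeName hc h₁]

/-! ### Correctness of the computed TBox -/

namespace Template

variable (ℬ : Template)

theorem forEntry_conceptName (f : Word → Word) :
    forEntry .conceptName f ℬ.encode = ℬ.sig.concepts.flatMap fun A => f (bits A) := by
  have h := forEntry_flatMap (c := .conceptName) id (by simp) (f := f) (l := ℬ.sig.concepts)
    plain_bits ((ℬ.sig.roles.flatMap fun r => .roleName :: encodeName r) ++ ℬ.abox.encode)
  have h' := forEntry_skip (c := .conceptName) (f := f)
    (u := (ℬ.sig.roles.flatMap fun r => .roleName :: encodeName r) ++ ℬ.abox.encode)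
    (by
      rw [List.mem_append, not_or]
      exact ⟨notMem_flatMap_encodeName id (by simp) (by simp) _,
        notMem_abox_encode id (by simp) (by simp) (by simp) _⟩) []
  rw [List.append_nil, forEntry_nil] at h'
  rw [h', List.append_nil] at h
  rw [encode, Signature.encode, List.append_assoc]
  exact h

theorem forEntry_roleName (f : Word → Word) :
    forEntry .roleName f ℬ.encode = ℬ.sig.roles.flatMap fun r => f (bits r) := by
  have h := forEntry_flatMap (c := .roleName) id (by simp) (f := f) (l := ℬ.sig.roles)
    plain_bits ℬ.abox.encode
  have h' := forEntry_skip (c := .roleName) (f := f) (u := ℬ.abox.encode)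
    (notMem_abox_encode id (by simp) (by simp) (by simp) _) []
  rw [List.append_nil, forEntry_nil] at h'
  rw [h', List.append_nil] at h
  rw [encode, Signature.encode, List.append_assoc,
    forEntry_skip (notMem_flatMap_encodeName id (by simp) (by simp) _)]
  exact h

theorem notMem_sig_encode {c : Sym} (hc : ¬ c.plain) (h₁ : c ≠ .delim) (h₂ : c ≠ .conceptName)
    (h₃ : c ≠ .roleName) : c ∉ ℬ.sig.encode := by
  rw [Signature.encode, List.mem_append, not_or]
  exact ⟨notMem_flatMap_encodeName hc h₁ h₂ _, notMem_flatMap_encodeName hc h₁ h₃ _⟩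

theorem elemsWord_encode :
    elemsWord ℬ.encode = ℬ.inds.flatMap fun d => entry .answer (bits d) := by
  rw [elemsWord, encode, forAssertion_skip (ℬ.notMem_sig_encode id (by simp) (by simp) (by simp))
    (ℬ.notMem_sig_encode id (by simp) (by simp) (by simp)), ABox.encode, forAssertion_encode, inds,
    List.flatMap_assoc]
  congr 1
  funext α
  rcases α with ⟨A, a⟩ | ⟨r, a, b⟩ <;> simp [Assertion.indList]

theorem forEntry_elemsWord (f : Word → Word) :
    forEntry .answer f (elemsWord ℬ.encode) = ℬ.inds.flatMap fun d => f (bits d) := by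
  have h := forEntry_flatMap (c := .answer) id (by simp) (f := f) (l := ℬ.inds) plain_bits []
  rwa [List.append_nil, forEntry_nil, List.append_nil, ← elemsWord_encode] at h

theorem occurs_assertions_concept {A a : Name} (l : List Assertion) :
    occurs (rawConcept (bits A) (bits a)) (l.flatMap Assertion.encode) ≠ [] ↔
      .concept A a ∈ l := by
  induction l with
  | nil => simp [occurs, forSuffix]
  | cons α l ih =>
    rw [List.flatMap_cons]
    rcases α with ⟨B, b⟩ | ⟨r, b, c⟩
    · rw [Assertion.encode_concept, occurs_rawConcept (plain_bits _) (plain_bits _) (plain_bits _)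
        (plain_bits _), ih, bits_injective.eq_iff, bits_injective.eq_iff]
      simp
    · rw [Assertion.encode_role, occurs_rawConcept_rawRole (plain_bits _) (plain_bits _)
        (plain_bits _), ih]
      simp

theorem occurs_assertions_role {r a b : Name} (l : List Assertion) :
    occurs (rawRole (bits r) (bits a) (bits b)) (l.flatMap Assertion.encode) ≠ [] ↔
      .role r a b ∈ l := by
  induction l with
  | nil => simp [occurs, forSuffix]
  | cons α l ih =>
    rw [List.flatMap_cons]
    rcases α with ⟨B, c⟩ | ⟨s, c, d⟩
    · rw [Assertion.encode_concept, occurs_rawRole_rawConcept (plain_bits _) (plain_bits _), ih]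
      simp
    · rw [Assertion.encode_role, occurs_rawRole (plain_bits _) (plain_bits _) (plain_bits _)
        (plain_bits _) (plain_bits _) (plain_bits _), ih, bits_injective.eq_iff,
        bits_injective.eq_iff, bits_injective.eq_iff]
      simp

theorem occurs_concept {A a : Name} :
    (occurs (rawConcept (bits A) (bits a)) ℬ.encode).head? = none ↔ .concept A a ∉ ℬ.abox := by
  rw [List.head?_eq_none_iff, ← not_iff_not, not_not]
  refine Iff.trans ?_ (occurs_assertions_concept ℬ.abox.assertions)
  rw [encode, rawConcept,
    occurs_skip (ℬ.notMem_sig_encode id (by simp) (by simp) (by simp)), ABox.encode]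

theorem occurs_role {r a b : Name} :
    (occurs (rawRole (bits r) (bits a) (bits b)) ℬ.encode).head? = none ↔
      .role r a b ∉ ℬ.abox := by
  rw [List.head?_eq_none_iff, ← not_iff_not, not_not]
  refine Iff.trans ?_ (occurs_assertions_role ℬ.abox.assertions)
  rw [encode, rawRole,
    occurs_skip (ℬ.notMem_sig_encode id (by simp) (by simp) (by simp)), ABox.encode]

theorem freshWord_encode : freshWord ℬ.encode = bits ℬ.fresh := freshWord_eq _

theorem encode_color (d : Name) :
    (Concept.atom (ℬ.color d)).encode = colorNameWord (bits ℬ.fresh) (bits d) := by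
  simp [Concept.encode, color, colorNameWord, encodeName, bits]

theorem encode_hidden (d : Name) :
    (ℬ.hidden d).encode = hiddenWord (bits ℬ.fresh) (bits d) := by
  rw [hidden, hiddenWord, ← encode_color]
  simp [Concept.encode, roleR, roleS, encodeName, bits]

theorem encode_cov : ℬ.cov.encode = covWord (bits ℬ.fresh) (elemsWord ℬ.encode) := by
  rw [covWord, forEntry_elemsWord, cov]
  induction ℬ.inds with
  | nil => rfl
  | cons d l ih =>
    rw [List.foldr_cons, Concept.encode, ih, encode_hidden]
    simp

theorem encode_allColors :
    ℬ.allColors.encode = allColorsWord (bits ℬ.fresh) (elemsWord ℬ.encode) := by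
  rw [allColorsWord, forEntry_elemsWord, allColors]
  induction ℬ.inds with
  | nil => rfl
  | cons d l ih =>
    rw [List.foldr_cons, Concept.encode, ih, encode_color]
    simp

/-- The six groups of inclusions are compared one by one; in the last two, a failed search for an
assertion matches its absence from the template. -/
theorem constructWord_encode :
    constructWord ℬ.encode = encodeTBoxWithName (ℬ.tbox, ℬ.fresh) := by
  have happ : ∀ T T' : TBox, encodeTBox (T ++ T') = encodeTBox T ++ encodeTBox T' :=
    fun T T' => List.flatMap_append
  have hflat : ∀ (l : List Name) (g : Name → TBox),
      encodeTBox (l.flatMap g) = l.flatMap fun x => encodeTBox (g x) :=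
    fun l g => List.flatMap_assoc
  rw [constructWord, tboxWord, conceptAxiomsWord, roleAxiomsWord, encodeTBoxWithName, tbox,
    happ, happ, happ, happ, happ]
  simp only [forEntry_conceptName, forEntry_roleName, forEntry_elemsWord, freshWord_encode,
    ← encode_cov, ← encode_allColors, ← encode_hidden, hflat,
    encodeName_eq, List.append_assoc, List.singleton_append]
  refine congrArg (fun w => bits ℬ.fresh ++ Sym.delim :: w) ?_
  refine congrArg₂ _ ?_ (congrArg₂ _ ?_ (congrArg₂ _ ?_ (congrArg₂ _ ?_ (congrArg₂ _ ?_ ?_))))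
  · simp [encodeTBox, List.flatMap_map, Concept.encode, encodeName_eq]
  · simp [encodeTBox, List.flatMap_map, Concept.encode, encodeName_eq]
  · simp [encodeTBox, List.flatMap_map, Concept.encode, encodeName_eq]
  · simp [encodeTBox, Concept.encode, encodeName_eq, roleR, roleS, bits]
  · congr 1; funext A
    congr 1; funext d
    have ho := ℬ.occurs_concept (A := A) (a := d)
    rw [List.head?_eq_none_iff] at ho
    by_cases h : .concept A d ∈ ℬ.abox
    · simp [ho, h, encodeTBox]
    · simp [ho, h, encodeTBox, Concept.encode, encodeName_eq]
  · congr 1; funext r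
    congr 1; funext d
    congr 1; funext e
    have ho := ℬ.occurs_role (r := r) (a := d) (b := e)
    rw [List.head?_eq_none_iff] at ho
    by_cases h : .role r d e ∈ ℬ.abox
    · simp [ho, h, encodeTBox]
    · simp [ho, h, encodeTBox, Concept.encode, encodeName_eq]

theorem polyTimeComputable_tbox : PolyTimeComputable Template.encode encodeTBoxWithName
    fun ℬ : Template => (ℬ.tbox, ℬ.fresh) :=
  Poly.polyTimeComputable (Poly.arg.constructWord) id fun ℬ => by
    rw [List.map_id]
    exact ℬ.constructWord_encode

end Template

/-! ### Query evaluation -/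

/-- The `i`-th of the answer entries at the beginning of a word. -/
def answerWord (i : ℕ) (w : Word) : Word := field ((fun u => rest u.tail)^[i] w).tail

theorem answerWord_flatMap (w : Word) : ∀ (l : List Name) (i : ℕ) (hi : i < l.length),
    answerWord i ((l.flatMap fun a => .answer :: encodeName a) ++ w) = bits l[i] := by
  intro l
  induction l with
  | nil => simp
  | cons a l ih =>
    intro i hi
    have h : ((a :: l).flatMap fun a => Sym.answer :: encodeName a) ++ w =
        .answer :: (bits a ++ .delim :: ((l.flatMap fun a => .answer :: encodeName a) ++ w)) := by
      simp [encodeName_eq]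
    rw [h]
    rcases i with _ | i
    · simp [answerWord, field_append (plain_bits a)]
    · have := ih i (by simpa using hi)
      rw [answerWord] at this
      rw [answerWord, Function.iterate_succ_apply, List.tail_cons, rest_append (plain_bits a), this]
      simp

theorem Poly.answerWord {α : Type} [Ctx α] (i : ℕ) {f : α → Word} (hf : Poly f) :
    Poly (fun v => answerWord i (f v)) := by
  refine Poly.field (Poly.tail ?_)
  induction i with
  | zero => exact hf
  | succ i ih =>
    simp only [Function.iterate_succ_apply']
    exact ih.tail.rest

/-! ### The reduction to the complement of the CSP -/

namespace Template

variable (ℬ : Template)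

/-- Evaluation of the query in the universal model of an encoded query instance. -/
noncomputable def queryWord {n : ℕ} (q : PEQ n) (w : Word) : Word :=
  evalWord (ℬ.universalWord w) (elemsWord (ℬ.universalWord w)) q fun i => answerWord i w

theorem poly_queryWord {n : ℕ} (q : PEQ n) : Poly (ℬ.queryWord q) :=
  Poly.evalWord (α := Word) q (xs := fun w i => answerWord i w) (Poly.arg.universalWord ℬ)
    (Poly.arg.universalWord ℬ).elemsWord fun i => Poly.arg.answerWord i

theorem queryWord_encode {n : ℕ} (q : PEQ n) (x : QueryInstance n) :
    ℬ.queryWord q x.encode ≠ [] ↔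
      (interp {f | f ∈ ℬ.universal x.abox}).Answers q x.tuple := by
  have hu : ∀ c : Sym, ¬ c.plain → c ≠ .delim → c ≠ .answer →
      c ∉ (List.ofFn x.tuple).flatMap fun a => Sym.answer :: encodeName a :=
    fun c h₁ h₂ h₃ => notMem_flatMap_encodeName h₁ h₂ h₃ _
  have hans : (fun i : Fin n => answerWord i x.encode) = fun i => (Elem.ind (x.tuple i)).word := by
    funext i
    rw [QueryInstance.encode, answerWord_flatMap _ _ _ (by simp)]
    simp [Elem.word]
  -- ABoxes are nonempty, so there is an element to witness quantified variables that occur in no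
  -- atom.
  have hne : ℬ.universal x.abox ≠ [] := by
    obtain ⟨α, hα⟩ := List.exists_mem_of_ne_nil _ x.abox.nonempty
    rcases α with ⟨A, a⟩ | ⟨r, a, b⟩
    · exact List.ne_nil_of_mem (Template.concept_mem_universal.2 (.inl ⟨a, rfl, hα⟩))
    · exact List.ne_nil_of_mem (Template.role_mem_universal.2 (.inl ⟨a, b, rfl, rfl, hα⟩))
  have hmem : ∀ i, Elem.ind (x.tuple i) ∈ (ℬ.universal x.abox).flatMap Fact.elems := by
    intro i
    obtain ⟨α, hα, hi⟩ := x.mem i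
    rcases α with ⟨A, a⟩ | ⟨r, a, b⟩
    · obtain rfl : x.tuple i = a := hi
      exact List.mem_flatMap.2 ⟨_, Template.concept_mem_universal.2 (.inl ⟨_, rfl, hα⟩),
        by simp [Fact.elems]⟩
    · refine List.mem_flatMap.2 ⟨_, Template.role_mem_universal.2 (.inl ⟨a, b, rfl, rfl, hα⟩), ?_⟩
      rcases hi with hi | hi
      · simp [Fact.elems, show x.tuple i = a from hi]
      · simp [Fact.elems, show x.tuple i = b from hi]
  rw [queryWord, hans, QueryInstance.encode,
    ℬ.universalWord_encode _ (hu _ id (by simp) (by simp)) (hu _ id (by simp) (by simp)),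
    evalWord_iff hne q _ hmem]
  constructor
  · intro h
    exact ⟨_, fun i => rfl, h⟩
  · rintro ⟨π, hπ, h⟩
    have : (fun i => Elem.ind (x.tuple i)) = π := funext fun i => Option.some.inj (hπ i)
    rwa [this]

open Classical in
/-- The assertions over the signature of the template. -/
noncomputable def restrict (𝒜 : ABox) : List Assertion :=
  𝒜.assertions.filter fun α => decide (α.Over ℬ.sig)

noncomputable def restrictWord (w : Word) : Word :=
  forAssertion
    (fun A a => if (memWord ℬ.sig.concepts A).head? = none then [] else rawConcept A a)
    (fun r a b => if (memWord ℬ.sig.roles r).head? = none then [] else rawRole r a b) w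

theorem poly_restrictWord : Poly ℬ.restrictWord :=
  Poly.forAssertion (α := Word)
    (g := fun _ A a => if (memWord ℬ.sig.concepts A).head? = none then [] else rawConcept A a)
    (h := fun _ r a b => if (memWord ℬ.sig.roles r).head? = none then [] else rawRole r a b)
    Poly.arg
    (Poly.ite_head _ (Poly.last.weaken.memWord _) Poly.nil (Poly.last.weaken.rawConcept Poly.last))
    (Poly.ite_head _ (Poly.last.weaken.weaken.memWord _) Poly.nil
      (Poly.last.weaken.weaken.rawRole Poly.last.weaken Poly.last))

theorem restrictWord_encode (𝒜 : ABox) {u : Word} (h₁ : Sym.conceptAssertion ∉ u)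
    (h₂ : Sym.roleAssertion ∉ u) :
    ℬ.restrictWord (u ++ 𝒜.encode) = (ℬ.restrict 𝒜).flatMap Assertion.encode := by
  rw [restrictWord, forAssertion_skip h₁ h₂, ABox.encode, forAssertion_encode, restrict]
  induction 𝒜.assertions with
  | nil => rfl
  | cons α l ih =>
    rw [List.flatMap_cons, ih, List.filter_cons]
    rcases α with ⟨A, a⟩ | ⟨r, a, b⟩
    · have hm := memWord_bits (l := ℬ.sig.concepts) (a := A)
      rw [List.head?_eq_none_iff] at hm
      by_cases h : A ∈ ℬ.sig.concepts <;>
        simp [hm, Assertion.Over, h, Assertion.encode_concept]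
    · have hm := memWord_bits (l := ℬ.sig.roles) (a := r)
      rw [List.head?_eq_none_iff] at hm
      by_cases h : r ∈ ℬ.sig.roles <;>
        simp [hm, Assertion.Over, h, Assertion.encode_role]

theorem mem_restrict {𝒜 : ABox} {α : Assertion} :
    α ∈ ℬ.restrict 𝒜 ↔ α ∈ 𝒜 ∧ α.Over ℬ.sig := by
  simp only [restrict, List.mem_filter, decide_eq_true_eq]
  rfl

open Classical in
/-- The restriction of an ABox to the signature, or the template itself if it is empty. -/
noncomputable def restrictABox (𝒜 : ABox) : {𝒜 : ABox // 𝒜.Over ℬ.sig} :=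
  if h : ℬ.restrict 𝒜 = [] then ⟨ℬ.abox, ℬ.abox_over⟩
  else ⟨⟨ℬ.restrict 𝒜, h⟩, fun _ hα => (ℬ.mem_restrict.1 hα).2⟩

/-- If no assertion is over the signature, the right side holds vacuously and the left side by the
identity of the template; this justifies the default value. -/
theorem homTo_restrictABox (𝒜 : ABox) :
    (ℬ.restrictABox 𝒜).1.HomTo ℬ.abox ↔ ∃ h, ℬ.SigHom 𝒜 h := by
  by_cases hr : ℬ.restrict 𝒜 = []
  · rw [restrictABox, dif_pos hr]
    have hn : ∀ α ∈ 𝒜, ¬ α.Over ℬ.sig := fun α hα ho => by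
      have := ℬ.mem_restrict.2 ⟨hα, ho⟩
      rw [hr] at this
      simp at this
    exact ⟨fun _ => ⟨id, fun A hA a ha => absurd hA (hn _ ha),
      fun r hr a b hab => absurd hr (hn _ hab)⟩,
      fun _ => ⟨id, fun _ _ h => h, fun _ _ _ h => h⟩⟩
  · rw [restrictABox, dif_neg hr]
    refine exists_congr fun h => ?_
    constructor
    · rintro ⟨hc, hr⟩
      exact ⟨fun A hA a ha => hc A a (ℬ.mem_restrict.2 ⟨ha, hA⟩),
        fun r hr' a b hab => hr r a b (ℬ.mem_restrict.2 ⟨hab, hr'⟩)⟩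
    · rintro ⟨hc, hr⟩
      exact ⟨fun A a ha => hc A (ℬ.mem_restrict.1 ha).2 a (ℬ.mem_restrict.1 ha).1,
        fun r a b hab => hr r (ℬ.mem_restrict.1 hab).2 a b (ℬ.mem_restrict.1 hab).1⟩

theorem encode_ne_nil_of_ne_nil {l : List Assertion} (hl : l ≠ []) :
    l.flatMap Assertion.encode ≠ [] := by
  obtain ⟨α, l, rfl⟩ := List.exists_cons_of_ne_nil hl
  rcases α with ⟨A, a⟩ | ⟨r, a, b⟩ <;> simp [Assertion.encode]

theorem polyTimeReducible {𝒩 : ABox} (h𝒩 : 𝒩.Over ℬ.sig) (hn : ¬ 𝒩.HomTo ℬ.abox) {n : ℕ}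
    (q : PEQ n) : (queryEvaluation ℬ.tbox q).PolyTimeReducible (CSP ℬ).compl := by
  classical
  -- An answer in the universal model is certain regardless of homomorphisms, so such an instance
  -- goes to `𝒩`, a fixed yes-instance of the complement. Otherwise the tuple is certain iff the
  -- Σ-part does not map to the template.
  let f : QueryInstance n → {𝒜 : ABox // 𝒜.Over ℬ.sig} := fun x =>
    if (interp {f | f ∈ ℬ.universal x.abox}).Answers q x.tuple then ⟨𝒩, h𝒩⟩
    else ℬ.restrictABox x.abox
  let F : Word → Word := fun w => if (ℬ.queryWord q w).head? = none then
      if (ℬ.restrictWord w).head? = none then ℬ.abox.encode else ℬ.restrictWord w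
    else 𝒩.encode
  have hF : Poly F := Poly.ite_head _ (ℬ.poly_queryWord q)
    (Poly.ite_head _ ℬ.poly_restrictWord (Poly.const _) ℬ.poly_restrictWord) (Poly.const _)
  refine ⟨f, hF.polyTimeComputable id fun x => ?_, fun x => ?_⟩
  · rw [List.map_id]
    change F x.encode = (f x).1.encode
    have hu : ∀ c : Sym, ¬ c.plain → c ≠ .delim → c ≠ .answer →
        c ∉ (List.ofFn x.tuple).flatMap fun a => Sym.answer :: encodeName a :=
      fun c h₁ h₂ h₃ => notMem_flatMap_encodeName h₁ h₂ h₃ _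
    by_cases hx : (interp {f | f ∈ ℬ.universal x.abox}).Answers q x.tuple
    · have := (ℬ.queryWord_encode q x).2 hx
      simp only [F, f, List.head?_eq_none_iff, if_neg this, if_pos hx]
    · have := not_not.1 (mt (ℬ.queryWord_encode q x).1 hx)
      have hr : ℬ.restrictWord x.encode = (ℬ.restrict x.abox).flatMap Assertion.encode :=
        ℬ.restrictWord_encode _ (hu _ id (by simp) (by simp)) (hu _ id (by simp) (by simp))
      simp only [F, f, List.head?_eq_none_iff, if_pos this, if_neg hx, hr]
      by_cases hr : ℬ.restrict x.abox = []
      · rw [restrictABox, dif_pos hr, hr]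
        rfl
      · rw [restrictABox, dif_neg hr, if_neg (encode_ne_nil_of_ne_nil hr)]
        rfl
  · change CertainAnswer ℬ.tbox x.abox q x.tuple ↔ ¬ (f x).1.HomTo ℬ.abox
    rw [certainAnswer_iff x.mem]
    by_cases hx : (interp {f | f ∈ ℬ.universal x.abox}).Answers q x.tuple
    · simp only [f, if_pos hx, hx, true_or, true_iff]
      exact hn
    · simp only [f, if_neg hx, hx, false_or, homTo_restrictABox]

/-- The Σ-part always maps to the template, so evaluation in the universal model alone decides the
problem. -/
theorem inPTime (hall : ∀ 𝒜 : ABox, 𝒜.Over ℬ.sig → 𝒜.HomTo ℬ.abox) {n : ℕ} (q : PEQ n) :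
    (queryEvaluation ℬ.tbox q).InPTime := by
  classical
  let F : Word → Word := fun w =>
    if (ℬ.queryWord q w).head? = none then [.bit false] else [.bit true]
  have hF : Poly F := Poly.ite_head _ (ℬ.poly_queryWord q) (Poly.const _) (Poly.const _)
  refine ⟨fun x : QueryInstance n =>
    decide ((interp {f | f ∈ ℬ.universal x.abox}).Answers q x.tuple),
    -- The symbol map turns the one-letter output word into the encoding of a Boolean.
    hF.polyTimeComputable (fun c => decide (c = .bit true)) fun x => ?_, fun x => ?_⟩
  · change (F x.encode).map _ = _
    by_cases hx : (interp {f | f ∈ ℬ.universal x.abox}).Answers q x.tuple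
    · have := (ℬ.queryWord_encode q x).2 hx
      simp only [F, List.head?_eq_none_iff, if_neg this, hx]
      rfl
    · have := not_not.1 (mt (ℬ.queryWord_encode q x).1 hx)
      simp only [F, List.head?_eq_none_iff, if_pos this, hx]
      rfl
  · change CertainAnswer ℬ.tbox x.abox q x.tuple ↔ _
    have : ∃ h, ℬ.SigHom x.abox h :=
      (ℬ.homTo_restrictABox x.abox).1 (hall _ (ℬ.restrictABox x.abox).2)
    rw [certainAnswer_iff x.mem, decide_eq_true_iff]
    simp [this]

end Template

end DL

/-! ### The theorem -/

theorem mainTheorem9 :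
    ∃ construct : DL.Template → DL.TBox × DL.Name,
      DL.PolyTimeComputable DL.Template.encode DL.encodeTBoxWithName construct ∧
      ∀ (ℬ : DL.Template) (𝒯 : DL.TBox) (M : DL.Name), construct ℬ = (𝒯, M) →
        DL.Materializable 𝒯 ∧
        (∀ 𝒜 : DL.ABox, 𝒜.Over ℬ.sig →
          (𝒜.HomTo ℬ.abox ↔
            ¬ DL.CertainAnswer 𝒯 𝒜 (DL.PEQ.someInstance M) Fin.elim0)) ∧
        (∀ (n : ℕ) (q : DL.PEQ n),
          ((∃ 𝒜 : DL.ABox, 𝒜.Over ℬ.sig ∧ ¬ 𝒜.HomTo ℬ.abox) →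
            (DL.queryEvaluation 𝒯 q).PolyTimeReducible (DL.CSP ℬ).compl) ∧
          ((∀ 𝒜 : DL.ABox, 𝒜.Over ℬ.sig → 𝒜.HomTo ℬ.abox) →
            (DL.queryEvaluation 𝒯 q).InPTime)) := by
  refine ⟨fun ℬ => (ℬ.tbox, ℬ.fresh), DL.Template.polyTimeComputable_tbox, ?_⟩
  rintro ℬ 𝒯 M h
  obtain ⟨rfl, rfl⟩ := Prod.mk.inj h
  refine ⟨DL.Template.materializable, fun 𝒜 h𝒜 => DL.Template.homTo_iff h𝒜, fun n q => ⟨?_, ?_⟩⟩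
  · rintro ⟨𝒩, h𝒩, hn⟩
    exact ℬ.polyTimeReducible h𝒩 hn q
  · exact fun hall => ℬ.inPTime hall q
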